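/- Let $G$ be a finite group. A \emph{semi-Mackey functor} $M$ on $G$ assigns to each finite $G$-set $X$ a commutative monoid $M(X)$ and to each $G$-map $f\colon X\to Y$ monoid homomorphisms $f^*\colon M(Y)\to M(X)$ and $f_*\colon M(X)\to M(Y)$, functorially, such that $M(X\sqcup Y)\to M(X)\times M(Y)$ is bijective for all $X,Y$ and the Mackey (base change) condition holds for pullback squares. A semi-Mackey subfunctor $\mathcal S\subseteq M$ is a family of submonoids $\mathcal S(X)\subseteq M(X)$ stable under all $f^*$ and $f_*$, and $\mathcal S^{-1}M$ is the semi-Mackey functor $X\mapsto \mathcal S(X)^{-1}M(X)$ with $f^*(y/t)=f^*(y)/f^*(t)$ and $f_*(x/s)=f_*(x)/f_*(s)$. A \emph{Tambara functor} $T$ assigns to each finite $G$-set a commutative ring, with restrictions $f^*$ (ring homomorphisms), additive transfers $f_+$ and multiplicative transfers $f_\bullet$, such that $(f^*,f_+)$ is a Mackey functor, $(f^*,f_\bullet)$ is a semi-Mackey functor $T^\mu$ (the multiplicative part), and the distributive law holds for every exponential diagram. For a semi-Mackey subfunctor $\mathcal S\subseteq T^\mu$, the Tambara functor $\mathcal S^{-1}T$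 has values $\mathcal S(X)^{-1}T(X)$ and $$f^*(y/t)=\frac{f^*(y)}{f^*(t)},\qquad f_\bullet(x/s)=\frac{f_\bullet(x)}{f_\bullet(s)},\qquad f_+(x/s)=\frac{f_+(ax)}{f_\bullet(s)}\quad\text{where } f^*f_\bullet(s)=as .$$ For a semi-Mackey functor $M$, its Tambarization $\Omega[M]$ (the value at $M$ of the left adjoint of $T\mapsto T^\mu$) is the following Tambara functor. $\Omega[M](X)$ is the Grothendieck ring of the semiring of isomorphism classes of pairs $(A\xrightarrow{p}X,\,m)$ with $A$ a finite $G$-set over $X$ and $m\in M(A)$, with sum given by disjoint union and product by the fibre product $A_1\times_XA_2$ with the element $\varpi_1^*(m_1)\cdot\varpi_2^*(m_2)$, where $\varpi_1,\varpi_2$ are its projections. Restriction is pullback, the additive transfer along $f$ is $[A\xrightarrow{p}X,m]\mapsto[A\xrightarrow{f\circ p}Y,m]$, and the multiplicative transfer along $f$ is the polynomial extension of $[A\xrightarrow{p}X,m]\mapsto[B\xrightarrow{q}Y,\rho_*\lambda^*m]$, where $X\xleftarrow{p}A\xleftarrow{\lambda}Z\xrightarrow{\rho}B\xrightarrow{q}Y$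 is the exponential diagram of $f$ and $p$. Let $\varepsilon\colon M\to\Omega[M]^\mu$, $m\mapsto[X\xrightarrow{\mathrm{id}}X,m]$. \textbf{Proposition.} For every semi-Mackey functor $M$ on $G$ and every semi-Mackey subfunctor $\mathcal S\subseteq M$, put $\mathcal S^{-1}(\Omega[M]):=\varepsilon(\mathcal S)^{-1}(\Omega[M])$. There are isomorphisms of Tambara functors $$\Phi_{M,\mathcal S}\colon\ \mathcal S^{-1}(\Omega[M])\ \xrightarrow{\ \cong\ }\ \Omega[\mathcal S^{-1}M]$$ that are compatible with the canonical morphisms from $\Omega[M]$ (that is, $\Phi_{M,\mathcal S}$ composed with $\Omega[M]\to\mathcal S^{-1}(\Omega[M])$ is $\Omega$ applied to $M\to\mathcal S^{-1}M$) and natural in $(M,\mathcal S)$: for every morphism $\theta\colon M\to N$ of semi-Mackey functors with $\theta(\mathcal S)\subseteq\mathcal S'$, the square formed by $\Phi_{M,\mathcal S}$, $\Phi_{N,\mathcal S'}$ and the morphisms induced by $\theta$ commutes. -/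

import Mathlib

universe u v w

/-- A finite set with a left action of the group `G`. -/
structure FinGSet (G : Type u) [Group G] : Type (u + 1) where
  carrier : Type u
  [action : MulAction G carrier]
  [finite : Finite carrier]

namespace FinGSet

variable {G : Type u} [Group G]

instance : CoeSort (FinGSet G) (Type u) := ⟨carrier⟩

attribute [instance] action finite

/-- The disjoint union of two finite `G`-sets. -/
def sum (X Y : FinGSet G) : FinGSet G := ⟨X ⊕ Y⟩

/-- The `G`-subset cut out by a `G`-stable predicate. -/
def sub (X : FinGSet G) (P : X → Prop) (hP : ∀ (g : G) (x : X), P x → P (g • x)) : FinGSet G :=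
  letI : MulAction G {x : X // P x} :=
    { smul := fun g x => ⟨g • x.1, hP g x.1 x.2⟩
      one_smul := fun x => Subtype.ext (one_smul G x.1)
      mul_smul := fun g h x => Subtype.ext (mul_smul g h x.1) }
  ⟨{x : X // P x}⟩

/-- The inclusion of a `G`-subset. -/
def subVal (X : FinGSet G) (P : X → Prop) (hP : ∀ (g : G) (x : X), P x → P (g • x)) :
    sub X P hP →[G] X where
  toFun x := x.1
  map_smul' _ _ := rfl

/-- The empty `G`-set. -/
def empty : FinGSet G :=
  letI : MulAction G PEmpty.{u + 1} :=
    { smul := fun _ x => x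
      one_smul := fun x => x.elim
      mul_smul := fun _ _ x => x.elim }
  ⟨PEmpty⟩

variable {X Y Z A B C W X' Y' : FinGSet G}

/-- The unique map out of a `G`-set without elements. -/
def elim (h : X → False) (Y : FinGSet G) : X →[G] Y where
  toFun x := (h x).elim
  map_smul' _ x := (h x).elim

/-- The first inclusion into a disjoint union. -/
def inl (X Y : FinGSet G) : X →[G] sum X Y where
  toFun := Sum.inl
  map_smul' _ _ := rfl

/-- The second inclusion into a disjoint union. -/
def inr (X Y : FinGSet G) : Y →[G] sum X Y where
  toFun := Sum.inr
  map_smul' _ _ := rfl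

/-- The map out of a disjoint union with given restrictions. -/
def desc (f : X →[G] Z) (g : Y →[G] Z) : sum X Y →[G] Z where
  toFun := Sum.elim f g
  map_smul' a x := by
    cases x
    · exact map_smul f a _
    · exact map_smul g a _

/-- The fibre product `{(x, y) | f x = g y}`. -/
def pull (f : X →[G] Z) (g : Y →[G] Z) : FinGSet G :=
  sub ⟨X × Y⟩ (fun t => f t.1 = g t.2) fun a t h => by
    simpa using congrArg (a • ·) h

/-- The first projection of a fibre product. -/
def pullFst (f : X →[G] Z) (g : Y →[G] Z) : pull f g →[G] X where
  toFun t := t.1.1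
  map_smul' _ _ := rfl

/-- The second projection of a fibre product. -/
def pullSnd (f : X →[G] Z) (g : Y →[G] Z) : pull f g →[G] Y where
  toFun t := t.1.2
  map_smul' _ _ := rfl

/-- The square with sides `ξ : X' → X`, `f' : X' → Y'`, `f : X → Y` and `η : Y' → Y` is a pullback
square of finite `G`-sets. -/
structure IsPullback (ξ : X' →[G] X) (f' : X' →[G] Y') (f : X →[G] Y) (η : Y' →[G] Y) :
    Prop where
  comm : ∀ a, f (ξ a) = η (f' a)
  existsUnique : ∀ x y, f x = η y → ∃! a, ξ a = x ∧ f' a = y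

/-- The maps `f : X → Y`, `p : A → X`, `lam : Z → A`, `rho : Z → B` and `q : B → Y` form an
exponential diagram: the outer rectangle `f ∘ p ∘ lam = q ∘ rho` is a pullback, so that the fibre of `rho` over
`b` is identified with the fibre of `f` over `q b`, and via `lam` the elements `b` of `B` over
`y` correspond bijectively to the sections of `p` over the fibre of `f` at `y`. -/
structure IsExponential (f : X →[G] Y) (p : A →[G] X) (lam : Z →[G] A) (rho : Z →[G] B)
    (q : B →[G] Y) : Prop where
  isPullback : IsPullback (p.comp lam) rho f q
  existsUnique : ∀ (y : Y) (s : {x : X // f x = y} → A), (∀ x, p (s x) = x.1) →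
    ∃! b, q b = y ∧ ∀ z (h : f (p (lam z)) = y), rho z = b → lam z = s ⟨p (lam z), h⟩

theorem isPullback_pull (f : X →[G] Z) (g : Y →[G] Z) :
    IsPullback (pullFst f g) (pullSnd f g) f g where
  comm a := a.2
  existsUnique x y h := ⟨⟨(x, y), h⟩, ⟨rfl, rfl⟩, fun _ hb => Subtype.ext (Prod.ext hb.1 hb.2)⟩

namespace IsPullback

variable {ξ : X' →[G] X} {f' : X' →[G] Y'} {f : X →[G] Y} {η : Y' →[G] Y}

theorem ext (h : IsPullback ξ f' f η) {a b : X'} (h₁ : ξ a = ξ b) (h₂ : f' a = f' b) : a = b :=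
  (h.existsUnique (ξ b) (f' b) (h.comm b)).unique ⟨h₁, h₂⟩ ⟨rfl, rfl⟩

theorem exists_of (h : IsPullback ξ f' f η) {x : X} {y : Y'} (e : f x = η y) :
    ∃ a, ξ a = x ∧ f' a = y := (h.existsUnique x y e).exists

theorem mk' (comm : ∀ a, f (ξ a) = η (f' a))
    (inj : ∀ a b, ξ a = ξ b → f' a = f' b → a = b)
    (surj : ∀ x y, f x = η y → ∃ a, ξ a = x ∧ f' a = y) : IsPullback ξ f' f η where
  comm := comm
  existsUnique x y e := by
    obtain ⟨a, h₁, h₂⟩ := surj x y e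
    exact ⟨a, ⟨h₁, h₂⟩, fun b hb => inj _ _ (hb.1.trans h₁.symm) (hb.2.trans h₂.symm)⟩

theorem symm (h : IsPullback ξ f' f η) : IsPullback f' ξ η f :=
  mk' (fun a => (h.comm a).symm) (fun _ _ h₁ h₂ => h.ext h₂ h₁) fun _ _ e =>
    let ⟨a, h₁, h₂⟩ := h.exists_of e.symm
    ⟨a, h₂, h₁⟩

end IsPullback

/-- A map that is determined by a functional `G`-stable relation. -/
theorem exists_hom (R : X → Y → Prop) (hR : ∀ (g : G) x y, R x y → R (g • x) (g • y))
    (ex : ∀ x, ∃ y, R x y) (uniq : ∀ x y y', R x y → R x y' → y = y') :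
    ∃ e : X →[G] Y, ∀ x, R x (e x) := by
  choose e he using ex
  exact ⟨⟨e, fun g x => uniq _ _ _ (he _) (hR _ _ _ (he x))⟩, he⟩

theorem IsPullback.lift {ξ : X' →[G] X} {f' : X' →[G] Y'} {f : X →[G] Y} {η : Y' →[G] Y}
    (h : IsPullback ξ f' f η) (a : W →[G] X) (b : W →[G] Y') (hab : ∀ w, f (a w) = η (b w)) :
    ∃ e : W →[G] X', (∀ w, ξ (e w) = a w) ∧ ∀ w, f' (e w) = b w := by
  obtain ⟨e, he⟩ := exists_hom (fun w x => ξ x = a w ∧ f' x = b w)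
    (fun g w x hx => by simp [hx.1, hx.2]) (fun w => h.exists_of (hab w))
    (fun w x x' hx hx' => h.ext (hx.1.trans hx'.1.symm) (hx.2.trans hx'.2.symm))
  exact ⟨e, fun w => (he w).1, fun w => (he w).2⟩

/-- `X` is the disjoint union of the images of the injective maps `i` and `j`. -/
def IsSum (i : A →[G] X) (j : B →[G] X) : Prop := Function.Bijective (desc i j)

theorem isSum_inl_inr : IsSum (inl X Y) (inr X Y) := by
  have : ⇑(desc (inl X Y) (inr X Y)) = id := by
    funext x; cases x <;> rfl
  unfold IsSum; rw [this]; exact Function.bijective_id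

theorem isSum_sub (P : X → Prop) (hP : ∀ (g : G) (x : X), P x → P (g • x))
    (hP' : ∀ (g : G) (x : X), ¬ P x → ¬ P (g • x)) :
    IsSum (subVal X P hP) (subVal X (fun x => ¬ P x) hP') := by
  constructor
  · rintro (x | x) (y | y) h
    · exact congrArg Sum.inl (Subtype.ext h)
    · exact (y.2 ((show x.1 = y.1 from h) ▸ x.2)).elim
    · exact (x.2 ((show x.1 = y.1 from h) ▸ y.2)).elim
    · exact congrArg Sum.inr (Subtype.ext h)
  · intro x
    by_cases h : P x
    · exact ⟨Sum.inl ⟨x, h⟩, rfl⟩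
    · exact ⟨Sum.inr ⟨x, h⟩, rfl⟩

namespace IsSum

variable {i : A →[G] X} {j : B →[G] X}

theorem inl_inj (h : IsSum i j) : Function.Injective i := fun a b e =>
  Sum.inl_injective (h.1 (show desc i j (Sum.inl a) = desc i j (Sum.inl b) from e))

theorem inr_inj (h : IsSum i j) : Function.Injective j := fun a b e =>
  Sum.inr_injective (h.1 (show desc i j (Sum.inr a) = desc i j (Sum.inr b) from e))

theorem ne (h : IsSum i j) (a : A) (b : B) : i a ≠ j b := fun e => by
  cases h.1 (show desc i j (Sum.inl a) = desc i j (Sum.inr b) from e)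

theorem cases (h : IsSum i j) (x : X) : (∃ a, i a = x) ∨ ∃ b, j b = x := by
  obtain ⟨a | b, e⟩ := h.2 x
  exacts [Or.inl ⟨a, e⟩, Or.inr ⟨b, e⟩]

end IsSum

end FinGSet

open FinGSet

/-- A semi-Mackey functor on `G`: a contravariant functor `res` and a covariant functor `tr` from
finite `G`-sets to commutative monoids that agree on objects, turn disjoint unions into products
and satisfy the Mackey condition. (The monoid structures are determined by the underlying sets
and maps: `a * b` is the transfer along the fold map of the element with restrictions `a` and
`b`, see `SemiMackey.mul_eq`.) -/
structure SemiMackey (G : Type u) [Group G] where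
  obj : FinGSet.{u} G → Type v
  [commMonoid : ∀ X, CommMonoid (obj X)]
  res : ∀ {X Y : FinGSet G}, (X →[G] Y) → (obj Y →* obj X)
  tr : ∀ {X Y : FinGSet G}, (X →[G] Y) → (obj X →* obj Y)
  res_id : ∀ {X : FinGSet G} (m : obj X), res (MulActionHom.id G) m = m
  res_comp : ∀ {X Y Z : FinGSet G} (g : Y →[G] Z) (f : X →[G] Y) (m : obj Z),
    res (g.comp f) m = res f (res g m)
  tr_id : ∀ {X : FinGSet G} (m : obj X), tr (MulActionHom.id G) m = m
  tr_comp : ∀ {X Y Z : FinGSet G} (g : Y →[G] Z) (f : X →[G] Y) (m : obj X),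
    tr (g.comp f) m = tr g (tr f m)
  additive : ∀ X Y : FinGSet G, Function.Bijective
    fun m : obj (sum X Y) => (res (inl X Y) m, res (inr X Y) m)
  mackey : ∀ {X' X Y' Y : FinGSet G} {ξ : X' →[G] X} {f' : X' →[G] Y'} {f : X →[G] Y}
    {η : Y' →[G] Y}, IsPullback ξ f' f η → ∀ m, tr ξ (res f' m) = res f (tr η m)

namespace SemiMackey

variable {G : Type u} [Group G]

attribute [instance] commMonoid

/-- Morphisms of semi-Mackey functors. -/
@[ext]
structure Hom (M : SemiMackey.{u, v} G) (N : SemiMackey.{u, w} G) where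
  app : ∀ X, M.obj X →* N.obj X
  app_res : ∀ {X Y : FinGSet G} (f : X →[G] Y) (m : M.obj Y),
    app X (M.res f m) = N.res f (app Y m)
  app_tr : ∀ {X Y : FinGSet G} (f : X →[G] Y) (m : M.obj X),
    app Y (M.tr f m) = N.tr f (app X m)

/-- A semi-Mackey subfunctor. -/
@[ext]
structure Sub (M : SemiMackey.{u, v} G) where
  carrier : ∀ X, Submonoid (M.obj X)
  res_mem : ∀ {X Y : FinGSet G} (f : X →[G] Y) (m : M.obj Y),
    m ∈ carrier Y → M.res f m ∈ carrier X
  tr_mem : ∀ {X Y : FinGSet G} (f : X →[G] Y) (m : M.obj X),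
    m ∈ carrier X → M.tr f m ∈ carrier Y

/-- The image of a semi-Mackey subfunctor under a morphism. -/
def Sub.map {M : SemiMackey.{u, v} G} {N : SemiMackey.{u, w} G} (S : M.Sub) (θ : Hom M N) :
    N.Sub where
  carrier X := (S.carrier X).map (θ.app X)
  res_mem f := by
    rintro _ ⟨m, hm, rfl⟩
    exact ⟨_, S.res_mem f m hm, θ.app_res f m⟩
  tr_mem f := by
    rintro _ ⟨m, hm, rfl⟩
    exact ⟨_, S.tr_mem f m hm, θ.app_tr f m⟩

variable (M : SemiMackey.{u, v} G) {X Y Z A B C : FinGSet G}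

theorem subsingleton_of_empty (h : X → False) (a b : M.obj X) : a = b := by
  obtain ⟨m, hm⟩ := (M.additive X X).2 (a, b)
  have e : inl X X = inr X X := by ext x; exact (h x).elim
  simp only [e, Prod.mk.injEq] at hm
  exact hm.1.symm.trans hm.2

theorem res_tr_of_inj {i : A →[G] X} (hi : Function.Injective i) (m : M.obj A) :
    M.res i (M.tr i m) = m := by
  have : IsPullback (MulActionHom.id G) (MulActionHom.id G) i i :=
    IsPullback.mk' (fun _ => rfl) (fun _ _ h _ => h) fun x y e => ⟨x, rfl, hi e⟩
  rw [← M.mackey this, M.res_id, M.tr_id]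

theorem tr_res_of_bij {e : A →[G] X} (he : Function.Bijective e) (m : M.obj X) :
    M.tr e (M.res e m) = m := by
  have : IsPullback e e (MulActionHom.id G) (MulActionHom.id G) :=
    IsPullback.mk' (fun _ => rfl) (fun _ _ h _ => he.1 h) fun x y e' => by
      obtain ⟨a, rfl⟩ := he.2 x
      exact ⟨a, rfl, e'⟩
  rw [M.mackey this, M.res_id, M.tr_id]

theorem res_tr_of_disjoint {i : A →[G] X} {j : B →[G] X} (h : ∀ a b, i a ≠ j b) (m : M.obj B) :
    M.res i (M.tr j m) = 1 := by
  have : IsPullback (elim (X := empty) PEmpty.elim A) (elim PEmpty.elim B) i j :=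
    IsPullback.mk' (fun a => PEmpty.elim a) (fun a => PEmpty.elim a)
      fun x y e => (h x y e).elim
  rw [← M.mackey this, M.subsingleton_of_empty PEmpty.elim (M.res _ m) 1, map_one]

theorem ext_of_isSum {i : A →[G] X} {j : B →[G] X} (h : IsSum i j) {m n : M.obj X}
    (h₁ : M.res i m = M.res i n) (h₂ : M.res j m = M.res j n) : m = n := by
  rw [← M.tr_res_of_bij h m, ← M.tr_res_of_bij h n]
  congr 1
  apply (M.additive A B).1
  have e₁ : (desc i j).comp (inl A B) = i := rfl
  have e₂ : (desc i j).comp (inr A B) = j := rfl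
  simp only [← M.res_comp, e₁, e₂, h₁, h₂]

theorem decomp {i : A →[G] X} {j : B →[G] X} (h : IsSum i j) (m : M.obj X) :
    M.tr i (M.res i m) * M.tr j (M.res j m) = m := by
  apply M.ext_of_isSum h
  · rw [map_mul, M.res_tr_of_inj h.inl_inj, M.res_tr_of_disjoint h.ne, mul_one]
  · rw [map_mul, M.res_tr_of_inj h.inr_inj, M.res_tr_of_disjoint fun a b => (h.ne b a).symm,
      one_mul]

theorem tr_eq_mul {i : A →[G] X} {j : B →[G] X} (h : IsSum i j) (f : X →[G] Y) (m : M.obj X) :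
    M.tr f m = M.tr (f.comp i) (M.res i m) * M.tr (f.comp j) (M.res j m) := by
  conv_lhs => rw [← M.decomp h m, map_mul]
  rw [M.tr_comp, M.tr_comp]

/-- The element of `M (A ⨿ B)` with given restrictions to `A` and `B`. -/
noncomputable def glue (a : M.obj A) (b : M.obj B) : M.obj (sum A B) :=
  (Equiv.ofBijective _ (M.additive A B)).symm (a, b)

theorem glue_spec (a : M.obj A) (b : M.obj B) :
    (M.res (inl A B) (M.glue a b), M.res (inr A B) (M.glue a b)) = (a, b) :=
  (Equiv.ofBijective _ (M.additive A B)).apply_symm_apply (a, b)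

@[simp] theorem res_inl_glue (a : M.obj A) (b : M.obj B) : M.res (inl A B) (M.glue a b) = a :=
  congrArg Prod.fst (M.glue_spec a b)

@[simp] theorem res_inr_glue (a : M.obj A) (b : M.obj B) : M.res (inr A B) (M.glue a b) = b :=
  congrArg Prod.snd (M.glue_spec a b)

/-- The multiplication is determined by transfer along the fold map. -/
theorem mul_eq (a b : M.obj X) :
    a * b = M.tr (desc (MulActionHom.id G) (MulActionHom.id G)) (M.glue a b) := by
  have e₁ : (desc (MulActionHom.id G) (MulActionHom.id G)).comp (inl X X) =
    MulActionHom.id G := rfl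
  have e₂ : (desc (MulActionHom.id G) (MulActionHom.id G)).comp (inr X X) =
    MulActionHom.id G := rfl
  rw [M.tr_eq_mul isSum_inl_inr, e₁, e₂]
  simp [M.tr_id]

/-- For a transfer `f_* s`, the restriction `f^* f_* s` is a multiple of `s`. -/
theorem exists_res_tr (f : X →[G] Y) (s : M.obj X) : ∃ a, M.res f (M.tr f s) = a * s := by
  have hP : ∀ (g : G) (t : pull f f), t.1.1 = t.1.2 → (g • t).1.1 = (g • t).1.2 :=
    fun g t h => congrArg (g • ·) h
  have hP' : ∀ (g : G) (t : pull f f), ¬ t.1.1 = t.1.2 → ¬ (g • t).1.1 = (g • t).1.2 :=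
    fun g t h e => h (MulAction.injective g e)
  have hS := isSum_sub (fun t : pull f f => t.1.1 = t.1.2) hP hP'
  rw [← M.mackey (isPullback_pull f f), M.tr_eq_mul hS]
  set D := FinGSet.sub (pull f f) _ hP
  let d := (pullFst f f).comp (subVal _ _ hP)
  have hd : Function.Bijective d := by
    constructor
    · intro a b h
      exact Subtype.ext (Subtype.ext (Prod.ext h (a.2.symm.trans (Eq.trans h b.2))))
    · exact fun x => ⟨⟨⟨(x, x), rfl⟩, rfl⟩, rfl⟩
  have e : (pullSnd f f).comp (subVal _ _ hP) = d := by
    ext a; exact a.2.symm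
  refine ⟨_, (mul_comm _ _).trans (congrArg _ ?_)⟩
  rw [← M.res_comp, e]
  exact M.tr_res_of_bij hd s

end SemiMackey

namespace SemiMackey

variable {G : Type u} [Group G]

/-- The map induced on monoids of fractions by a monoid homomorphism. -/
noncomputable def fracMap {A : Type v} {B : Type w} [CommMonoid A] [CommMonoid B] {S : Submonoid A}
    {T : Submonoid B} (φ : A →* B) (h : ∀ s ∈ S, φ s ∈ T) : Localization S →* Localization T :=
  (Localization.monoidOf S).map (g := φ) (T := T) (fun s => h s s.2) (Localization.monoidOf T)

theorem fracMap_mk {A : Type v} {B : Type w} [CommMonoid A] [CommMonoid B] {S : Submonoid A}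
    {T : Submonoid B} (φ : A →* B) (h : ∀ s ∈ S, φ s ∈ T) (a : A) (s : S) :
    fracMap φ h (Localization.mk a s) = (Localization.mk (φ a) ⟨φ s, h s s.2⟩ : Localization T) := by
  simp only [fracMap, Localization.mk_eq_monoidOf_mk']
  exact Submonoid.LocalizationMap.map_mk' (f := Localization.monoidOf S) (T := T)
    (fun s => h s s.2) a s

/-- The map induced on semirings of fractions by a homomorphism of semirings. -/
noncomputable def fracRingMap {A : Type v} {B : Type w} [CommSemiring A] [CommSemiring B]
    {S : Submonoid A} {T : Submonoid B} (φ : A →+* B) (h : ∀ s ∈ S, φ s ∈ T) :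
    Localization S →+* Localization T :=
  { fracMap φ.toMonoidHom h with
    map_zero' := by
      change fracMap _ _ 0 = _
      rw [← Localization.mk_zero (1 : S), fracMap_mk]
      exact (congrArg (fun z => Localization.mk z _) (map_zero φ)).trans (Localization.mk_zero _)
    map_add' x y := by
      change fracMap _ _ _ = fracMap _ _ _ + fracMap _ _ _
      induction x using Localization.induction_on with | H x => ?_
      induction y using Localization.induction_on with | H y => ?_
      simp only [fracMap_mk, Localization.add_mk]
      congr 1
      · exact (map_add φ _ _).trans (congrArg₂ _ (map_mul φ _ _) (map_mul φ _ _))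
      · exact Subtype.ext (map_mul φ _ _) }

theorem fracRingMap_mk {A : Type v} {B : Type w} [CommSemiring A] [CommSemiring B]
    {S : Submonoid A} {T : Submonoid B} (φ : A →+* B) (h : ∀ s ∈ S, φ s ∈ T) (a : A) (s : S) :
    fracRingMap φ h (Localization.mk a s) =
      (Localization.mk (φ a) ⟨φ s, h s s.2⟩ : Localization T) :=
  fracMap_mk _ _ _ _

theorem frac_mk_eq_iff {A : Type v} [CommMonoid A] {S : Submonoid A} {a b : A} {s t : S} :
    (Localization.mk a s : Localization S) = Localization.mk b t ↔
      ∃ c ∈ S, c * (t.1 * a) = c * (s.1 * b) := by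
  rw [Localization.mk_eq_mk_iff, Localization.r_iff_exists]
  exact ⟨fun ⟨c, h⟩ => ⟨c, c.2, h⟩, fun ⟨c, hc, h⟩ => ⟨⟨c, hc⟩, h⟩⟩

variable {M : SemiMackey.{u, v} G} {N : SemiMackey.{u, w} G}

theorem Sub.glue_mem (S : M.Sub) {X Y : FinGSet G} {a : M.obj X} {b : M.obj Y}
    (ha : a ∈ S.carrier X) (hb : b ∈ S.carrier Y) : M.glue a b ∈ S.carrier (sum X Y) := by
  rw [← M.decomp isSum_inl_inr (M.glue a b), M.res_inl_glue, M.res_inr_glue]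
  exact mul_mem (S.tr_mem _ _ ha) (S.tr_mem _ _ hb)

/-- The fraction `S⁻¹M`, with `(S⁻¹M)(X) = S(X)⁻¹M(X)` and structure morphisms
`f^*(y/t) = f^*(y)/f^*(t)` and `f_*(x/s) = f_*(x)/f_*(s)`. -/
noncomputable def loc (M : SemiMackey.{u, v} G) (S : M.Sub) : SemiMackey.{u, v} G where
  obj X := Localization (S.carrier X)
  res f := fracMap (M.res f) (S.res_mem f)
  tr f := fracMap (M.tr f) (S.tr_mem f)
  res_id m := by
    induction m using Localization.induction_on with | H m => simp [fracMap_mk, M.res_id]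
  res_comp g f m := by
    induction m using Localization.induction_on with | H m => simp [fracMap_mk, M.res_comp]
  tr_id m := by
    induction m using Localization.induction_on with | H m => simp [fracMap_mk, M.tr_id]
  tr_comp g f m := by
    induction m using Localization.induction_on with | H m => simp [fracMap_mk, M.tr_comp]
  additive X Y := by
    constructor
    · intro m n h
      induction m using Localization.induction_on with | H m => ?_
      induction n using Localization.induction_on with | H n => ?_
      simp only [Prod.mk.injEq, fracMap_mk, frac_mk_eq_iff] at h
      obtain ⟨⟨c, hc, h₁⟩, d, hd, h₂⟩ := h
      refine frac_mk_eq_iff.2 ⟨M.glue c d, S.glue_mem hc hd, ?_⟩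
      apply M.ext_of_isSum isSum_inl_inr <;> simpa using by assumption
    · rintro ⟨m, n⟩
      induction m using Localization.induction_on with | H m => ?_
      induction n using Localization.induction_on with | H n => ?_
      refine ⟨Localization.mk (M.glue m.1 n.1) ⟨_, S.glue_mem m.2.2 n.2.2⟩, ?_⟩
      simp [fracMap_mk]
  mackey h m := by
    induction m using Localization.induction_on with | H m => simp [fracMap_mk, M.mackey h]

/-- The morphism `M → S⁻¹M`, `x ↦ x/1`. -/
noncomputable def toLoc (M : SemiMackey.{u, v} G) (S : M.Sub) : Hom M (M.loc S) where
  app X := (Localization.monoidOf (S.carrier X)).toMonoidHom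
  app_res f m := by
    refine Eq.trans ?_ (fracMap_mk (M.res f) (S.res_mem f) m 1).symm
    refine (Localization.mk_one_eq_monoidOf_mk _).symm.trans (congrArg _ (Subtype.ext ?_))
    exact (map_one (M.res f)).symm
  app_tr f m := by
    refine Eq.trans ?_ (fracMap_mk (M.tr f) (S.tr_mem f) m 1).symm
    refine (Localization.mk_one_eq_monoidOf_mk _).symm.trans (congrArg _ (Subtype.ext ?_))
    exact (map_one (M.tr f)).symm

/-- The morphism `S⁻¹M → S'⁻¹N` induced by a morphism `θ : M → N` with `θ(S) ⊆ S'`. -/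
noncomputable def Hom.loc (θ : Hom M N) (S : M.Sub) (S' : N.Sub)
    (h : ∀ X, ∀ s ∈ S.carrier X, θ.app X s ∈ S'.carrier X) : Hom (M.loc S) (N.loc S') where
  app X := fracMap (θ.app X) (h X)
  app_res f m := by
    induction m using Localization.induction_on with
    | H m =>
      change fracMap _ (h _) (fracMap (M.res f) (S.res_mem f) _) =
        fracMap (N.res f) (S'.res_mem f) (fracMap _ (h _) _)
      simp only [fracMap_mk, θ.app_res]
  app_tr f m := by
    induction m using Localization.induction_on with
    | H m =>
      change fracMap _ (h _) (fracMap (M.tr f) (S.tr_mem f) _) =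
        fracMap (N.tr f) (S'.tr_mem f) (fracMap _ (h _) _)
      simp only [fracMap_mk, θ.app_tr]

end SemiMackey

/-- A semi-Tambara functor on `G`: finite `G`-sets are sent to commutative semirings, with
restrictions `res`, additive transfers `tr` and multiplicative transfers `nm`, such that
`(res, tr)` and `(res, nm)` are semi-Mackey functors and the distributive law holds for every
exponential diagram. -/
structure SemiTambara (G : Type u) [Group G] where
  obj : FinGSet.{u} G → Type v
  [commSemiring : ∀ X, CommSemiring (obj X)]
  res : ∀ {X Y : FinGSet G}, (X →[G] Y) → (obj Y →+* obj X)
  tr : ∀ {X Y : FinGSet G}, (X →[G] Y) → (obj X →+ obj Y)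
  nm : ∀ {X Y : FinGSet G}, (X →[G] Y) → (obj X →* obj Y)
  res_id : ∀ {X : FinGSet G} (t : obj X), res (MulActionHom.id G) t = t
  res_comp : ∀ {X Y Z : FinGSet G} (g : Y →[G] Z) (f : X →[G] Y) (t : obj Z),
    res (g.comp f) t = res f (res g t)
  tr_id : ∀ {X : FinGSet G} (t : obj X), tr (MulActionHom.id G) t = t
  tr_comp : ∀ {X Y Z : FinGSet G} (g : Y →[G] Z) (f : X →[G] Y) (t : obj X),
    tr (g.comp f) t = tr g (tr f t)
  nm_id : ∀ {X : FinGSet G} (t : obj X), nm (MulActionHom.id G) t = t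
  nm_comp : ∀ {X Y Z : FinGSet G} (g : Y →[G] Z) (f : X →[G] Y) (t : obj X),
    nm (g.comp f) t = nm g (nm f t)
  additive : ∀ X Y : FinGSet G, Function.Bijective
    fun t : obj (sum X Y) => (res (inl X Y) t, res (inr X Y) t)
  mackey_tr : ∀ {X' X Y' Y : FinGSet G} {ξ : X' →[G] X} {f' : X' →[G] Y'} {f : X →[G] Y}
    {η : Y' →[G] Y}, IsPullback ξ f' f η → ∀ t, tr ξ (res f' t) = res f (tr η t)
  mackey_nm : ∀ {X' X Y' Y : FinGSet G} {ξ : X' →[G] X} {f' : X' →[G] Y'} {f : X →[G] Y}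
    {η : Y' →[G] Y}, IsPullback ξ f' f η → ∀ t, nm ξ (res f' t) = res f (nm η t)
  distrib : ∀ {X Y A Z B : FinGSet G} {f : X →[G] Y} {p : A →[G] X} {lam : Z →[G] A}
    {rho : Z →[G] B} {q : B →[G] Y}, IsExponential f p lam rho q →
    ∀ t, nm f (tr p t) = tr q (nm rho (res lam t))

/-- A Tambara functor on `G`: a semi-Tambara functor whose additive part is a Mackey functor,
that is, takes values in abelian groups (hence in commutative rings). -/
structure Tambara (G : Type u) [Group G] extends SemiTambara.{u, v} G where
  exists_neg : ∀ (X : FinGSet.{u} G) (t : obj X), ∃ t', t + t' = 0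

namespace SemiTambara

variable {G : Type u} [Group G]

attribute [instance] commSemiring

/-- Morphisms of (semi-)Tambara functors. -/
@[ext]
structure Hom (T : SemiTambara.{u, v} G) (U : SemiTambara.{u, w} G) where
  app : ∀ X, T.obj X →+* U.obj X
  app_res : ∀ {X Y : FinGSet G} (f : X →[G] Y) (t : T.obj Y),
    app X (T.res f t) = U.res f (app Y t)
  app_tr : ∀ {X Y : FinGSet G} (f : X →[G] Y) (t : T.obj X),
    app Y (T.tr f t) = U.tr f (app X t)
  app_nm : ∀ {X Y : FinGSet G} (f : X →[G] Y) (t : T.obj X),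
    app Y (T.nm f t) = U.nm f (app X t)

/-- The multiplicative part of a (semi-)Tambara functor. -/
abbrev mul (T : SemiTambara.{u, v} G) : SemiMackey.{u, v} G where
  obj := T.obj
  res f := (T.res f).toMonoidHom
  tr := T.nm
  res_id := T.res_id
  res_comp := T.res_comp
  tr_id := T.nm_id
  tr_comp := T.nm_comp
  additive := T.additive
  mackey := T.mackey_nm

/-- The additive part of a (semi-)Tambara functor. -/
abbrev add (T : SemiTambara.{u, v} G) : SemiMackey.{u, v} G where
  obj X := Multiplicative (T.obj X)
  res f := AddMonoidHom.toMultiplicative (T.res f).toAddMonoidHom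
  tr f := AddMonoidHom.toMultiplicative (T.tr f)
  res_id := T.res_id
  res_comp := T.res_comp
  tr_id := T.tr_id
  tr_comp := T.tr_comp
  additive := T.additive
  mackey := T.mackey_tr

variable (T : SemiTambara.{u, v} G) {X Y Z A B C : FinGSet G}

/-- The projection formula. -/
theorem tr_mul_res (f : X →[G] Y) (x : T.obj X) (y : T.obj Y) :
    T.tr f (x * T.res f y) = T.tr f x * y := by
  have hE : IsExponential (desc (MulActionHom.id G) (MulActionHom.id G))
      (desc ((inl Y Y).comp f) (inr Y Y)) (desc (inl X Y) ((inr X Y).comp f))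
      (desc (MulActionHom.id G) (MulActionHom.id G)) f := by
    constructor
    · apply IsPullback.mk'
      · rintro (a | a) <;> rfl
      · rintro (a | a) (b | b) h h'
        · exact congrArg Sum.inl h'
        · cases h
        · cases h
        · exact congrArg Sum.inr h'
      · rintro (a | a) b h
        · exact ⟨Sum.inl b, congrArg Sum.inl h.symm, rfl⟩
        · exact ⟨Sum.inr b, congrArg Sum.inr h.symm, rfl⟩
    · intro y s hs
      have h₁ := hs ⟨Sum.inl y, rfl⟩
      have h₂ := hs ⟨Sum.inr y, rfl⟩
      rcases e₁ : s ⟨Sum.inl y, rfl⟩ with x | x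
      swap
      · rw [e₁] at h₁; cases h₁
      rcases e₂ : s ⟨Sum.inr y, rfl⟩ with x' | x'
      · rw [e₂] at h₂; cases h₂
      rw [e₁] at h₁; rw [e₂] at h₂
      have h₁ : f x = y := Sum.inl_injective h₁
      have h₂ : x' = y := Sum.inr_injective h₂
      subst h₂
      subst h₁
      refine ⟨x, ⟨rfl, ?_⟩, ?_⟩
      · rintro (z | z) h hz
        · obtain rfl : z = x := hz
          exact e₁.symm
        · obtain rfl : z = x := hz
          exact e₂.symm
      · rintro b ⟨hb, hb'⟩
        exact Sum.inl_injective <|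
          (hb' (Sum.inl b) hb rfl).trans ((congrArg s (Subtype.ext (congrArg Sum.inl hb))).trans e₁)
  have key := T.distrib hE (T.mul.glue x y)
  have l₁ : T.tr (desc ((inl Y Y).comp f) (inr Y Y)) (T.mul.glue x y)
      = T.mul.glue (T.tr f x) y := by
    apply T.mul.ext_of_isSum isSum_inl_inr
    · rw [T.mul.res_inl_glue]
      have : IsPullback f (inl X Y) (inl Y Y) (desc ((inl Y Y).comp f) (inr Y Y)) := by
        apply IsPullback.mk'
        · exact fun a => rfl
        · exact fun a b _ h => Sum.inl_injective h
        · rintro a (b | b) h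
          · exact ⟨b, (Sum.inl_injective h).symm, rfl⟩
          · cases h
      exact (T.mackey_tr this _).symm.trans (congrArg _ (T.mul.res_inl_glue x y))
    · rw [T.mul.res_inr_glue]
      have : IsPullback (MulActionHom.id G) (inr X Y) (inr Y Y)
          (desc ((inl Y Y).comp f) (inr Y Y)) := by
        apply IsPullback.mk'
        · exact fun a => rfl
        · exact fun a b _ h => Sum.inr_injective h
        · rintro a (b | b) h
          · cases h
          · exact ⟨b, (Sum.inr_injective h).symm, rfl⟩
      exact (T.mackey_tr this _).symm.trans
        ((T.tr_id _).trans (T.mul.res_inr_glue x y))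
  have l₂ : T.res (desc (inl X Y) ((inr X Y).comp f)) (T.mul.glue x y)
      = T.mul.glue x (T.res f y) := by
    apply T.mul.ext_of_isSum isSum_inl_inr
    · rw [T.mul.res_inl_glue]
      exact (T.res_comp _ _ _).symm.trans (T.mul.res_inl_glue x y)
    · rw [T.mul.res_inr_glue]
      refine (T.res_comp _ _ _).symm.trans ((T.res_comp (inr X Y) f _).trans ?_)
      exact congrArg (T.res f) (T.mul.res_inr_glue x y)
  rw [l₁, l₂] at key
  exact ((T.mul.mul_eq (T.tr f x) y).trans (key.trans (congrArg (T.tr f)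
    (T.mul.mul_eq x (T.res f y)).symm))).symm

section Localization

open SemiMackey

variable (S : T.mul.Sub)

theorem exists_denom (f : X →[G] Y) (s : S.carrier X) :
    ∃ (a : T.obj X) (t : S.carrier Y), T.res f t.1 = a * s.1 ∧ t.1 = T.nm f s.1 := by
  obtain ⟨a, ha⟩ := T.mul.exists_res_tr f s.1
  exact ⟨a, ⟨_, S.tr_mem f s.1 s.2⟩, ha, rfl⟩

theorem locTr_aux (f : X →[G] Y) {x x' : T.obj X} {s s' : S.carrier X} {a a' : T.obj X}
    {t t' : S.carrier Y} (h : Localization.mk x s = Localization.mk x' s')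
    (ht : T.res f t.1 = a * s.1) (ht' : T.res f t'.1 = a' * s'.1) :
    Localization.mk (T.tr f (a * x)) t = Localization.mk (T.tr f (a' * x')) t' := by
  obtain ⟨c, hc, e⟩ := frac_mk_eq_iff.1 h
  obtain ⟨b, r, hr, -⟩ := T.exists_denom S f ⟨c, hc⟩
  refine frac_mk_eq_iff.2 ⟨r.1, r.2, ?_⟩
  change r.1 * (t'.1 * T.tr f (a * x)) = r.1 * (t.1 * T.tr f (a' * x'))
  have e : c * (s'.1 * x) = c * (s.1 * x') := e
  have h₁ : r.1 * (t'.1 * T.tr f (a * x)) = T.tr f (a * x * T.res f (r.1 * t'.1)) := by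
    rw [T.tr_mul_res]; ring
  have h₂ : r.1 * (t.1 * T.tr f (a' * x')) = T.tr f (a' * x' * T.res f (r.1 * t.1)) := by
    rw [T.tr_mul_res]; ring
  rw [h₁, h₂, map_mul (T.res f), map_mul (T.res f), hr, ht, ht']
  congr 1
  calc a * x * (b * c * (a' * s'.1)) = a * a' * b * (c * (s'.1 * x)) := by ring
    _ = a * a' * b * (c * (s.1 * x')) := by rw [e]
    _ = _ := by ring

/-- The additive transfer of the fraction: `f_+(x/s) = f_+(a x)/f_•(s)`, where
`f^* f_•(s) = a s`. -/
noncomputable def locTrFun (f : X →[G] Y) :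
    Localization (S.carrier X) → Localization (S.carrier Y) :=
  fun z => Localization.liftOn z
    (fun x s => Localization.mk (T.tr f ((T.exists_denom S f s).choose * x))
      (T.exists_denom S f s).choose_spec.choose)
    fun h => T.locTr_aux S f (Localization.mk_eq_mk_iff.2 h)
      (T.exists_denom S f _).choose_spec.choose_spec.1
      (T.exists_denom S f _).choose_spec.choose_spec.1

theorem locTrFun_mk (f : X →[G] Y) (x : T.obj X) {s : S.carrier X} {a : T.obj X}
    {t : S.carrier Y} (ht : T.res f t.1 = a * s.1) :
    T.locTrFun S f (Localization.mk x s) = Localization.mk (T.tr f (a * x)) t := by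
  rw [locTrFun, Localization.liftOn_mk]
  exact T.locTr_aux S f rfl (T.exists_denom S f s).choose_spec.choose_spec.1 ht

/-- The additive transfer of the fraction, as an additive map. -/
noncomputable def locTr (f : X →[G] Y) :
    Localization (S.carrier X) →+ Localization (S.carrier Y) where
  toFun := T.locTrFun S f
  map_zero' := by
    rw [← Localization.mk_zero (1 : S.carrier X),
      T.locTrFun_mk S f 0 (a := 1) (t := 1) (by simp), mul_zero, map_zero, Localization.mk_zero]
  map_add' x y := by
    induction x using Localization.induction_on with | H x => ?_
    induction y using Localization.induction_on with | H y => ?_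
    obtain ⟨x, s⟩ := x
    obtain ⟨x', s'⟩ := y
    obtain ⟨a, t, ht, -⟩ := T.exists_denom S f s
    obtain ⟨a', t', ht', -⟩ := T.exists_denom S f s'
    have hh : T.res f (t * t').1 = a * a' * (s * s').1 := by
      change T.res f (t.1 * t'.1) = a * a' * (s.1 * s'.1)
      rw [map_mul, ht, ht']; ring
    rw [Localization.add_mk, T.locTrFun_mk S f x ht, T.locTrFun_mk S f x' ht',
      T.locTrFun_mk S f _ hh, Localization.add_mk]
    congr 1
    change _ = t.1 * _ + t'.1 * _
    have h₁ : t.1 * T.tr f (a' * x') = T.tr f (a' * x' * T.res f t.1) := by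
      rw [T.tr_mul_res]; ring
    have h₂ : t'.1 * T.tr f (a * x) = T.tr f (a * x * T.res f t'.1) := by
      rw [T.tr_mul_res]; ring
    rw [h₁, h₂, ← map_add, ht, ht']
    congr 1
    change _ * (s.1 * _ + s'.1 * _) = _
    ring

/-- The restriction of the fraction, as a ring homomorphism. -/
noncomputable def locRes (f : X →[G] Y) :
    Localization (S.carrier Y) →+* Localization (S.carrier X) :=
  fracRingMap (T.res f) (S.res_mem f)

theorem locRes_mk (f : X →[G] Y) (y : T.obj Y) (t : S.carrier Y) :
    T.locRes S f (Localization.mk y t) =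
      Localization.mk (T.res f y) ⟨T.res f t.1, S.res_mem f t.1 t.2⟩ :=
  fracMap_mk _ _ _ _

/-- The multiplicative transfer of the fraction. -/
noncomputable def locNm (f : X →[G] Y) :
    Localization (S.carrier X) →* Localization (S.carrier Y) :=
  fracMap (T.nm f) (S.tr_mem f)

theorem locNm_mk (f : X →[G] Y) (x : T.obj X) (s : S.carrier X) :
    T.locNm S f (Localization.mk x s) =
      Localization.mk (T.nm f x) ⟨T.nm f s.1, S.tr_mem f s.1 s.2⟩ :=
  fracMap_mk _ _ _ _

theorem locTr_mk (f : X →[G] Y) (x : T.obj X) {s : S.carrier X} {a : T.obj X}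
    {t : S.carrier Y} (ht : T.res f t.1 = a * s.1) :
    T.locTr S f (Localization.mk x s) = Localization.mk (T.tr f (a * x)) t :=
  T.locTrFun_mk S f x ht

theorem locTr_id (t : Localization (S.carrier X)) : T.locTr S (MulActionHom.id G) t = t := by
  induction t using Localization.induction_on with | H t => ?_
  rw [T.locTr_mk S _ t.1 (a := 1) (t := t.2) (by rw [T.res_id, one_mul]), T.tr_id, one_mul]

theorem locTr_comp (g : Y →[G] Z) (f : X →[G] Y) (t : Localization (S.carrier X)) :
    T.locTr S (g.comp f) t = T.locTr S g (T.locTr S f t) := by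
  induction t using Localization.induction_on with | H t => ?_
  obtain ⟨x, s⟩ := t
  obtain ⟨a, t, ht, -⟩ := T.exists_denom S f s
  obtain ⟨b, r, hr, -⟩ := T.exists_denom S g t
  rw [T.locTr_mk S f x ht, T.locTr_mk S g _ hr,
    T.locTr_mk S _ x (a := T.res f b * a) (t := r), T.tr_comp, mul_comm b, ← T.tr_mul_res]
  · congr 3; ring
  · rw [T.res_comp, hr, map_mul, ht]; ring

theorem locTr_mackey {X' Y' : FinGSet G} {ξ : X' →[G] X} {f' : X' →[G] Y'} {f : X →[G] Y}
    {η : Y' →[G] Y} (h : FinGSet.IsPullback ξ f' f η) (t : Localization (S.carrier Y')) :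
    T.locTr S ξ (T.locRes S f' t) = T.locRes S f (T.locTr S η t) := by
  induction t using Localization.induction_on with | H t => ?_
  obtain ⟨y, t⟩ := t
  obtain ⟨b, r, hr, -⟩ := T.exists_denom S η t
  rw [T.locTr_mk S η y hr, locRes_mk, locRes_mk,
    T.locTr_mk S ξ _ (a := T.res f' b) (t := ⟨T.res f r.1, S.res_mem f r.1 r.2⟩),
    ← T.mackey_tr h, map_mul (T.res f')]
  have e : f.comp ξ = η.comp f' := by ext a; exact h.comm a
  rw [← T.res_comp, e, T.res_comp, hr, map_mul (T.res f')]

theorem loc_distrib {f : X →[G] Y} {p : A →[G] X} {lam : Z →[G] A} {rho : Z →[G] B}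
    {q : B →[G] Y} (h : IsExponential f p lam rho q) (t : Localization (S.carrier A)) :
    T.locNm S f (T.locTr S p t) = T.locTr S q (T.locNm S rho (T.locRes S lam t)) := by
  induction t using Localization.induction_on with | H t => ?_
  obtain ⟨x, s⟩ := t
  obtain ⟨a, t, ht, -⟩ := T.exists_denom S p s
  rw [T.locTr_mk S p x ht, locRes_mk, locNm_mk, locNm_mk,
    T.locTr_mk S q _ (a := T.nm rho (T.res lam a))
      (t := ⟨T.nm f t.1, S.tr_mem f t.1 t.2⟩), T.distrib h, map_mul, map_mul]
  rw [← map_mul, ← map_mul, ← ht, ← T.res_comp, T.mackey_nm h.isPullback.symm]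

/-- The fraction `S⁻¹T` of a semi-Tambara functor by a semi-Mackey subfunctor `S` of its
multiplicative part, with `(S⁻¹T)(X) = S(X)⁻¹T(X)` and structure morphisms
`f^*(y/t) = f^*(y)/f^*(t)`, `f_•(x/s) = f_•(x)/f_•(s)` and `f_+(x/s) = f_+(a x)/f_•(s)`, where
`f^* f_•(s) = a s`. -/
noncomputable def loc : SemiTambara.{u, v} G where
  obj X := Localization (S.carrier X)
  res f := T.locRes S f
  tr f := T.locTr S f
  nm f := T.locNm S f
  res_id := (T.mul.loc S).res_id
  res_comp := (T.mul.loc S).res_comp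
  tr_id := T.locTr_id S
  tr_comp := T.locTr_comp S
  nm_id := (T.mul.loc S).tr_id
  nm_comp := (T.mul.loc S).tr_comp
  additive := (T.mul.loc S).additive
  mackey_tr := T.locTr_mackey S
  mackey_nm := (T.mul.loc S).mackey
  distrib := T.loc_distrib S

/-- The morphism `T → S⁻¹T`, `x ↦ x/1`. -/
noncomputable def toLoc : Hom T (T.loc S) where
  app X := algebraMap (T.obj X) (Localization (S.carrier X))
  app_res f t := ((T.mul.toLoc S).app_res f t)
  app_tr f t := by
    refine Eq.trans ?_ (T.locTr_mk S f t (s := 1) (a := 1) (t := 1) (by simp)).symm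
    rw [one_mul]; exact (Localization.mk_one_eq_algebraMap _).symm
  app_nm f t := ((T.mul.toLoc S).app_tr f t)

/-- The morphism `S⁻¹T → S'⁻¹U` induced by a morphism `φ : T → U` with `φ(S) ⊆ S'`. -/
noncomputable def Hom.loc {T : SemiTambara.{u, v} G} {U : SemiTambara.{u, w} G} (φ : Hom T U)
    (S : T.mul.Sub) (S' : U.mul.Sub)
    (h : ∀ X, ∀ s ∈ S.carrier X, φ.app X s ∈ S'.carrier X) : Hom (T.loc S) (U.loc S') where
  app X := fracRingMap (φ.app X) (h X)
  app_res f t := by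
    induction t using Localization.induction_on with | H t => ?_
    change fracRingMap (φ.app _) _ (T.locRes S f _) = U.locRes S' f (fracRingMap (φ.app _) _ _)
    rw [locRes_mk, fracRingMap_mk, fracRingMap_mk, locRes_mk]
    simp [φ.app_res]
  app_tr {X Y} f t := by
    induction t using Localization.induction_on with | H t => ?_
    obtain ⟨x, s⟩ := t
    obtain ⟨a, t, ht, -⟩ := T.exists_denom S f s
    change fracRingMap (φ.app Y) _ (T.locTr S f _) =
      U.locTr S' f (fracRingMap (φ.app X) _ _)
    rw [T.locTr_mk S f x ht, fracRingMap_mk, fracRingMap_mk,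
      U.locTr_mk S' f _ (a := φ.app X a) (t := ⟨φ.app Y t.1, h Y t.1 t.2⟩)]
    · congr 1
      exact (φ.app_tr f _).trans (congrArg _ (map_mul _ _ _))
    · rw [← φ.app_res, ht, map_mul]
  app_nm f t := by
    induction t using Localization.induction_on with | H t => ?_
    change fracRingMap (φ.app _) _ (T.locNm S f _) = U.locNm S' f (fracRingMap (φ.app _) _ _)
    rw [locNm_mk, fracRingMap_mk, fracRingMap_mk, locNm_mk]
    simp [φ.app_nm]

end Localization

end SemiTambara

/-- The Grothendieck ring (additive group completion) of a commutative semiring. -/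
def GrothRing (R : Type v) [CommSemiring R] : Type v := Algebra.GrothendieckAddGroup R

namespace GrothRing

variable {R : Type v} [CommSemiring R]

noncomputable instance : AddCommGroup (GrothRing R) :=
  inferInstanceAs (AddCommGroup (Algebra.GrothendieckAddGroup R))

/-- The class of an element of the semiring. -/
noncomputable def of : R →+ GrothRing R := Algebra.GrothendieckAddGroup.of

theorem exists_sub (z : GrothRing R) : ∃ a b : R, z = of a - of b := by
  obtain ⟨p, h⟩ := (AddLocalization.addMonoidOf (⊤ : AddSubmonoid R)).surj z
  exact ⟨p.1, p.2.1, eq_sub_of_add_eq h⟩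

theorem of_eq_of {a b : R} : (of a : GrothRing R) = of b ↔ ∃ c, c + a = c + b := by
  change (AddLocalization.addMonoidOf ⊤) a = (AddLocalization.addMonoidOf ⊤) b ↔ _
  rw [← AddLocalization.mk_zero_eq_addMonoidOf_mk, ← AddLocalization.mk_zero_eq_addMonoidOf_mk,
    AddLocalization.mk_eq_mk_iff, AddLocalization.r_iff_exists]
  simp

/-- The universal property of the additive group completion. -/
noncomputable def lift {B : Type w} [AddCommGroup B] (φ : R →+ B) : GrothRing R →+ B :=
  Algebra.GrothendieckAddGroup.lift φ

@[simp] theorem lift_of {B : Type w} [AddCommGroup B] (φ : R →+ B) (a : R) :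
    lift φ (of a) = φ a :=
  DFunLike.congr_fun (Algebra.GrothendieckAddGroup.lift.left_inv φ) a

theorem hom_ext {B : Type w} [AddCommGroup B] {φ ψ : GrothRing R →+ B}
    (h : ∀ a, φ (of a) = ψ (of a)) : φ = ψ := by
  ext z
  obtain ⟨a, b, rfl⟩ := exists_sub z
  rw [map_sub, map_sub, h, h]

/-- The biadditive extension of the multiplication. -/
noncomputable def mulHom : GrothRing R →+ GrothRing R →+ GrothRing R :=
  lift
    { toFun := fun a => lift (of.comp (AddMonoidHom.mulLeft a))
      map_zero' := hom_ext fun b => by simp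
      map_add' := fun a a' => hom_ext fun b => by simp [add_mul] }

theorem mulHom_of (a b : R) : mulHom (of a) (of b) = (of (a * b) : GrothRing R) := by
  simp [mulHom]

noncomputable instance : CommRing (GrothRing R) :=
  { (inferInstance : AddCommGroup (GrothRing R)) with
    mul := fun x y => mulHom x y
    one := of 1
    left_distrib := fun x y z => map_add (mulHom x) y z
    right_distrib := fun x y z => by
      change mulHom _ _ = mulHom _ _ + mulHom _ _
      rw [map_add]; rfl
    zero_mul := fun x => by
      change mulHom _ _ = _
      rw [map_zero]; rfl
    mul_zero := fun x => map_zero (mulHom x)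
    mul_assoc := fun x y z => by
      change mulHom (mulHom x y) z = mulHom x (mulHom y z)
      obtain ⟨a, a', rfl⟩ := exists_sub x
      obtain ⟨b, b', rfl⟩ := exists_sub y
      obtain ⟨c, c', rfl⟩ := exists_sub z
      simp only [map_sub, AddMonoidHom.sub_apply, mulHom_of, mul_assoc]
    one_mul := fun x => by
      change mulHom _ x = x
      obtain ⟨a, a', rfl⟩ := exists_sub x
      change mulHom (of 1) _ = _
      simp only [map_sub, mulHom_of, one_mul]
    mul_one := fun x => by
      change mulHom x _ = x
      obtain ⟨a, a', rfl⟩ := exists_sub x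
      change mulHom _ (of 1) = _
      simp only [map_sub, AddMonoidHom.sub_apply, mulHom_of, mul_one]
    mul_comm := fun x y => by
      change mulHom x y = mulHom y x
      obtain ⟨a, a', rfl⟩ := exists_sub x
      obtain ⟨b, b', rfl⟩ := exists_sub y
      simp only [map_sub, AddMonoidHom.sub_apply, mulHom_of, mul_comm b, mul_comm b']
      abel }

theorem of_mul (a b : R) : (of (a * b) : GrothRing R) = of a * of b := (mulHom_of a b).symm

theorem of_one : (of 1 : GrothRing R) = 1 := rfl

/-- The additive map of Grothendieck rings induced by an additive map. -/
noncomputable def mapAdd {R' : Type w} [CommSemiring R'] (φ : R →+ R') :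
    GrothRing R →+ GrothRing R' := lift (of.comp φ)

@[simp] theorem mapAdd_of {R' : Type w} [CommSemiring R'] (φ : R →+ R') (a : R) :
    mapAdd φ (of a) = of (φ a) := by simp [mapAdd]

/-- The ring homomorphism of Grothendieck rings induced by a homomorphism of semirings. -/
noncomputable def mapRing {R' : Type w} [CommSemiring R'] (φ : R →+* R') :
    GrothRing R →+* GrothRing R' :=
  { mapAdd φ.toAddMonoidHom with
    map_one' := by
      change mapAdd φ.toAddMonoidHom (of 1) = of 1
      simp
    map_mul' := fun x y => by
      change mapAdd _ _ = mapAdd _ _ * mapAdd _ _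
      obtain ⟨a, a', rfl⟩ := exists_sub x
      obtain ⟨b, b', rfl⟩ := exists_sub y
      simp only [map_sub, mapAdd_of, sub_mul, mul_sub, ← of_mul]
      simp }

@[simp] theorem mapRing_of {R' : Type w} [CommSemiring R'] (φ : R →+* R') (a : R) :
    mapRing φ (of a) = of (φ a) := mapAdd_of _ a

end GrothRing

/-- A map from an additive monoid to an abelian group is polynomial of degree `< d` if all its
iterated differences of order `d` vanish. -/
def PolyDegLT {A : Type v} {B : Type w} [AddCommMonoid A] [AddCommGroup B] : ℕ → (A → B) → Prop
  | 0, φ => ∀ x, φ x = 0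
  | d + 1, φ => ∀ a, PolyDegLT d fun x => φ (x + a) - φ x

namespace PolyDegLT

section

variable {A : Type v} {B : Type w} [AddCommMonoid A] [AddCommGroup B] {d e : ℕ} {φ ψ : A → B}

theorem add (h : PolyDegLT d φ) (h' : PolyDegLT d ψ) : PolyDegLT d fun x => φ x + ψ x := by
  induction d generalizing φ ψ with
  | zero => exact fun x => by simp [h x, h' x]
  | succ d ih =>
    intro a
    convert! ih (h a) (h' a) using 2
    beta_reduce
    abel

theorem map {C : Type*} [AddCommGroup C] (g : B →+ C) (h : PolyDegLT d φ) :
    PolyDegLT d fun x => g (φ x) := by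
  induction d generalizing φ with
  | zero => exact fun x => by simp [h x]
  | succ d ih =>
    intro a
    convert! ih (h a) using 2
    rw [map_sub]

theorem sub (h : PolyDegLT d φ) (h' : PolyDegLT d ψ) : PolyDegLT d fun x => φ x - ψ x := by
  convert! h.add (h'.map (-AddMonoidHom.id B)) using 2
  simp [sub_eq_add_neg]

theorem comp {C : Type*} [AddCommMonoid C] (g : C →+ A) (h : PolyDegLT d φ) :
    PolyDegLT d fun x => φ (g x) := by
  induction d generalizing φ with
  | zero => exact fun x => h _
  | succ d ih =>
    intro a
    convert! ih (h (g a)) using 2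
    beta_reduce
    rw [map_add]

theorem shift (b : A) (h : PolyDegLT d φ) : PolyDegLT d fun x => φ (x + b) := by
  induction d generalizing φ with
  | zero => exact fun x => h _
  | succ d ih =>
    intro a
    convert! ih (h a) using 2
    rw [add_right_comm]

theorem succ (h : PolyDegLT d φ) : PolyDegLT (d + 1) φ := by
  induction d generalizing φ with
  | zero => exact fun a x => by simp [h (x + a), h x]
  | succ d ih => exact fun a => ih (h a)

theorem mono (h : PolyDegLT d φ) (hd : d ≤ e) : PolyDegLT e φ := by
  induction hd with
  | refl => exact h
  | step _ ih => exact ih.succ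

theorem const (b : B) : PolyDegLT 1 fun _ : A => b := fun _ _ => sub_self b

theorem mul {B : Type w} [CommRing B] {φ ψ : A → B} (h : PolyDegLT d φ) (h' : PolyDegLT e ψ) :
    PolyDegLT (d + e) fun x => φ x * ψ x := by
  induction hn : d + e generalizing d e φ ψ with
  | zero =>
    obtain ⟨rfl, rfl⟩ : d = 0 ∧ e = 0 := by omega
    exact fun x => by simp [h x]
  | succ n ih =>
    intro a
    rcases d with _ | d
    · exact (show PolyDegLT 0 _ from fun x => by simp [h x, h (x + a)]).mono (Nat.zero_le _)
    rcases e with _ | e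
    · exact (show PolyDegLT 0 _ from fun x => by simp [h' x, h' (x + a)]).mono (Nat.zero_le _)
    convert! (ih (h a) (h'.shift a) (by omega)).add (ih h (h' a) (by omega)) using 2
    ring

end

section

variable {R : Type v} [CommSemiring R] {B : Type w} [AddCommGroup B] {d e : ℕ}

theorem eq_zero {Φ : GrothRing R → B} (h : PolyDegLT d Φ) (h0 : ∀ a, Φ (.of a) = 0)
    (z : GrothRing R) : Φ z = 0 := by
  induction d generalizing Φ z with
  | zero => exact h z
  | succ d ih =>
    obtain ⟨a, b, rfl⟩ := GrothRing.exists_sub z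
    have := ih (h (.of b)) (fun c => by rw [← map_add, h0, h0, sub_zero])
      (.of a - .of b)
    rw [sub_add_cancel, h0, zero_sub, neg_eq_zero] at this
    exact this

theorem eq_of {Φ Ψ : GrothRing R → B} (h : PolyDegLT d Φ) (h' : PolyDegLT e Ψ)
    (h0 : ∀ a, Φ (.of a) = Ψ (.of a)) (z : GrothRing R) : Φ z = Ψ z :=
  sub_eq_zero.1 (((h.mono (le_max_left d e)).sub (h'.mono (le_max_right d e))).eq_zero
    (fun a => sub_eq_zero.2 (h0 a)) z)

/-- A polynomial map on a semiring extends to a polynomial map on its Grothendieck ring. -/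
theorem exists_extend {φ : R → B} (h : PolyDegLT d φ) :
    ∃ Φ : GrothRing R → B, PolyDegLT d Φ ∧ ∀ a, Φ (.of a) = φ a := by
  induction d generalizing φ with
  | zero => exact ⟨fun _ => 0, fun _ => rfl, fun a => (h a).symm⟩
  | succ d ih =>
    choose D hD hD' using fun a => ih (h a)
    choose p q hpq using GrothRing.exists_sub (R := R)
    have coc : ∀ a b k, D (a + b) k = D a (k + .of b) + D b k := fun a b k =>
      (hD (a + b)).eq_of (((hD a).shift (.of b)).add (hD b)) (fun c => by
        rw [hD', hD', ← map_add, hD', ← add_assoc, add_right_comm]; abel) k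
    have indep : ∀ a b a' b' : R, (GrothRing.of a - .of b : GrothRing R) = .of a' - .of b' →
        φ a - D b (.of a - .of b) = φ a' - D b' (.of a' - .of b') := by
      have key : ∀ a b c : R, φ a - D b (.of a - .of b) =
          φ (c + a) - D (c + b) (.of a - .of b) := fun a b c => by
        rw [coc, sub_add_cancel, hD', add_comm a c]; abel
      intro a b a' b' e
      have e' : (GrothRing.of (a + b') : GrothRing R) = .of (a' + b) := by
        rw [map_add, map_add]
        exact sub_eq_sub_iff_add_eq_add.1 e
      obtain ⟨c, hc⟩ := GrothRing.of_eq_of.1 e'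
      rw [key a b (c + b'), key a' b' (c + b), ← e]
      congr 2
      · rw [add_assoc, add_comm b', hc]; abel
      · rw [add_right_comm]
    refine ⟨fun k => φ (p k) - D (q k) k, fun l => ?_, fun a => ?_⟩
    · have Φ_of : ∀ a b : R, φ (p (.of a - .of b)) - D (q (.of a - .of b)) (.of a - .of b) =
          φ a - D b (.of a - .of b) := fun a b => by
        have := indep (p (.of a - .of b)) (q (.of a - .of b)) a b (hpq _).symm
        rwa [← hpq] at this
      have step : ∀ (u : R) (k : GrothRing R),
          (φ (p (k + .of u)) - D (q (k + .of u)) (k + .of u)) - (φ (p k) - D (q k) k) =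
            D u k := by
        intro u k
        obtain ⟨a, b, rfl⟩ := GrothRing.exists_sub k
        have e : (GrothRing.of a - .of b + .of u : GrothRing R) = .of (a + u) - .of b := by
          rw [map_add]; abel
        have c₁ := coc u b (.of a - .of b)
        have c₂ := coc b u (.of a - .of b)
        rw [sub_add_cancel, hD'] at c₁
        rw [add_comm b u, c₁, e] at c₂
        rw [e, Φ_of, Φ_of]
        calc _ = φ (a + u) - φ a + D b (.of a - .of b) - D b (.of (a + u) - .of b) := by abel
          _ = _ := by rw [c₂]; abel
      obtain ⟨u, w, rfl⟩ := GrothRing.exists_sub l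
      convert! ((hD u).shift (-.of w)).sub ((hD w).shift (-.of w)) using 2 with k
      rw [← step u, ← step w]
      have e₁ : k + (.of u - .of w) = k + -.of w + .of u := by abel
      have e₂ : k + -.of w + .of w = k := by abel
      rw [e₁, e₂]; beta_reduce; abel
    · have := indep (p (.of a)) (q (.of a)) a 0 (by rw [← hpq, map_zero, sub_zero])
      rw [← hpq] at this
      beta_reduce
      rw [this, map_zero, sub_zero, hD']; simp

end

end PolyDegLT

namespace FinGSet

variable {G : Type u} [Group G] {X Y A B Z : FinGSet G}

/-- The `G`-set `{(y, s)}` of points `y` of `Y` together with a section of `p` over the fibre of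
`f` at `y`; the section is given by its image `s ⊆ A`. -/
def expo (f : X →[G] Y) (p : A →[G] X) : FinGSet G :=
  letI : MulAction G (Set A) := Set.mulActionSet
  sub ⟨Y × Set A⟩
    (fun t => (∀ a ∈ t.2, f (p a) = t.1) ∧ ∀ x, f x = t.1 → ∃! a, a ∈ t.2 ∧ p a = x) <| by
      rintro g ⟨y, s⟩ ⟨h₁, h₂⟩
      constructor
      · rintro _ ⟨a, ha, rfl⟩
        change f (p (g • a)) = g • y
        rw [map_smul, map_smul, h₁ a ha]
      · intro x hx
        have hx' : f (g⁻¹ • x) = y := by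
          rw [map_smul, show f x = g • y from hx, inv_smul_smul]
        obtain ⟨a, ⟨ha, ha'⟩, ha''⟩ := h₂ _ hx'
        refine ⟨g • a, ⟨⟨a, ha, rfl⟩, by rw [map_smul, ha', smul_inv_smul]⟩, ?_⟩
        rintro _ ⟨⟨b, hb, rfl⟩, hb'⟩
        refine congrArg (g • ·) (ha'' b ⟨hb, ?_⟩)
        rw [← hb', eq_inv_smul_iff]
        exact (map_smul p g b).symm

/-- The projection `(y, s) ↦ y`. -/
def expoProj (f : X →[G] Y) (p : A →[G] X) : expo f p →[G] Y where
  toFun t := t.1.1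
  map_smul' _ _ := rfl

/-- The incidence `G`-set `{(a, (y, s)) | a ∈ s}`, which is identified with the fibre product of
`X` and `expo f p` over `Y`. -/
def expoInc (f : X →[G] Y) (p : A →[G] X) : FinGSet G :=
  sub ⟨A × expo f p⟩ (fun t => t.1 ∈ t.2.1.2) fun _ t h => ⟨t.1, h, rfl⟩

/-- The evaluation map `(a, (y, s)) ↦ a`. -/
def expoEval (f : X →[G] Y) (p : A →[G] X) : expoInc f p →[G] A where
  toFun t := t.1.1
  map_smul' _ _ := rfl

/-- The projection `(a, (y, s)) ↦ (y, s)`. -/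
def expoFst (f : X →[G] Y) (p : A →[G] X) : expoInc f p →[G] expo f p where
  toFun t := t.1.2
  map_smul' _ _ := rfl

theorem isExponential_expo (f : X →[G] Y) (p : A →[G] X) :
    IsExponential f p (expoEval f p) (expoFst f p) (expoProj f p) where
  isPullback := by
    refine FinGSet.IsPullback.mk' (fun z => z.1.2.2.1 _ z.2) ?_ ?_
    · intro z z' h h'
      have h : p z.1.1 = p z'.1.1 := h
      have h' : z.1.2 = z'.1.2 := h'
      refine Subtype.ext (Prod.ext ?_ h')
      exact (z.1.2.2.2 _ (z.1.2.2.1 _ z.2)).unique ⟨z.2, rfl⟩ ⟨h' ▸ z'.2, h.symm⟩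
    · intro x b h
      obtain ⟨a, ha, -⟩ := b.2.2 x h
      exact ⟨⟨(a, b), ha.1⟩, ha.2, rfl⟩
  existsUnique y s hs := by
    refine ⟨⟨(y, Set.range s), ?_, ?_⟩, ⟨rfl, ?_⟩, ?_⟩
    · rintro _ ⟨x, rfl⟩
      exact (congrArg f (hs x)).trans x.2
    · intro x hx
      refine ⟨s ⟨x, hx⟩, ⟨⟨_, rfl⟩, hs _⟩, ?_⟩
      rintro _ ⟨⟨x', rfl⟩, hx'⟩
      exact congrArg s (Subtype.ext ((hs x').symm.trans hx'))
    · rintro ⟨⟨a, b⟩, hab⟩ h (rfl : b = _)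
      obtain ⟨x, hx⟩ := hab
      have hx : s x = a := hx
      exact hx.symm.trans (congrArg s (Subtype.ext ((hs x).symm.trans (congrArg p hx))))
    · rintro b ⟨rfl, hb⟩
      refine Subtype.ext (Prod.ext rfl (Set.ext fun a => ⟨fun ha => ?_, ?_⟩))
      · exact ⟨_, (hb ⟨(a, b), ha⟩ (b.2.1 a ha) rfl).symm⟩
      · rintro ⟨x, rfl⟩
        obtain ⟨a, ⟨ha, hax⟩, -⟩ := b.2.2 x.1 x.2
        have := hb ⟨(a, b), ha⟩ (b.2.1 a ha) rfl
        have e : (⟨p a, b.2.1 a ha⟩ : {x // f x = b.1.1}) = x := Subtype.ext hax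
        have this' : a = s x := this.trans (congrArg s e)
        exact this' ▸ ha

end FinGSet

namespace SemiTambara

variable {G : Type u} [Group G] (T : SemiTambara.{u, v} G) {X Y : FinGSet G}

/-- The number of elements of a fibre. -/
noncomputable def fib (f : X →[G] Y) (y : Y) : ℕ := (f ⁻¹' {y}).ncard

/-- The expansion of a multiplicative transfer of a sum. -/
theorem nm_add (f : X →[G] Y) :
    ∃ (B Z₁ Z₂ : FinGSet G) (q : B →[G] Y) (ρ₁ : Z₁ →[G] B) (ρ₂ : Z₂ →[G] B) (π₁ : Z₁ →[G] X)
      (π₂ : Z₂ →[G] X), (∀ b, fib ρ₁ b < fib f (q b)) ∧ (∀ b, fib ρ₂ b ≤ fib f (q b)) ∧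
      ∀ x t : T.obj X, T.nm f (x + t) =
        T.nm f x + T.tr q (T.nm ρ₁ (T.res π₁ x) * T.nm ρ₂ (T.res π₂ t)) := by
  let nab : sum X X →[G] X := desc (MulActionHom.id G) (MulActionHom.id G)
  let B := expo f nab
  let Z := expoInc f nab
  let lam : Z →[G] sum X X := expoEval f nab
  let rho : Z →[G] B := expoFst f nab
  let q : B →[G] Y := expoProj f nab
  have hE : IsExponential f nab lam rho q := isExponential_expo f nab
  -- being in the first summand is a `G`-stable property
  let L : sum X X → Prop := fun a => ∃ x : X, inl X X x = a
  have hL : ∀ (g : G) a, L a → L (g • a) := by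
    rintro g _ ⟨x, rfl⟩; exact ⟨g • x, rfl⟩
  have hL' : ∀ (g : G) a, ¬ L a → ¬ L (g • a) := fun g a h h' =>
    h (by simpa using hL g⁻¹ _ h')
  let F : B → Prop := fun b => ∀ z, rho z = b → L (lam z)
  have hF : ∀ (g : G) b, F b → F (g • b) := fun g b h z hz => by
    have := hL g _ (h (g⁻¹ • z) (by rw [map_smul, hz, inv_smul_smul]))
    rwa [map_smul, smul_inv_smul] at this
  have hF' : ∀ (g : G) b, ¬ F b → ¬ F (g • b) := fun g b h h' =>
    h (by simpa using hF g⁻¹ _ h')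
  let i := subVal B F hF
  let j := subVal B (fun b => ¬ F b) hF'
  have hB : IsSum i j := isSum_sub F hF hF'
  let Z' := pull rho j
  let ρ' : Z' →[G] _ := pullSnd rho j
  let π' : Z' →[G] Z := pullFst rho j
  have hZ' : FinGSet.IsPullback π' ρ' rho j := isPullback_pull rho j
  let P : Z' → Prop := fun z => L (lam (π' z))
  have hP : ∀ (g : G) z, P z → P (g • z) := fun g z h => by
    change L (lam (π' (g • z))); rw [map_smul, map_smul]; exact hL g _ h
  have hP' : ∀ (g : G) z, ¬ P z → ¬ P (g • z) := fun g z h => by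
    change ¬ L (lam (π' (g • z))); rw [map_smul, map_smul]; exact hL' g _ h
  let i₁ := subVal Z' P hP
  let i₂ := subVal Z' (fun z => ¬ P z) hP'
  have hZ : IsSum i₁ i₂ := isSum_sub P hP hP'
  let σ : Z' →[G] X := nab.comp (lam.comp π')
  have hσ : ∀ z z' : Z', ρ' z = ρ' z' → σ z = σ z' → z = z' := fun z z' h h' =>
    hZ'.ext (hE.isPullback.ext h' ((hZ'.comm z).trans ((congrArg j h).trans (hZ'.comm z').symm))) h
  have hσf : ∀ z, f (σ z) = q (j (ρ' z)) := fun z =>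
    (hE.isPullback.comm _).trans (congrArg q (hZ'.comm z))
  refine ⟨_, _, _, q.comp j, ρ'.comp i₁, ρ'.comp i₂, σ.comp i₁, σ.comp i₂, ?_, ?_, ?_⟩
  · intro b
    obtain ⟨z, hz, hzL⟩ : ∃ z, rho z = j b ∧ ¬ L (lam z) := by
      by_contra! hc
      exact b.2 hc
    have himg : (fun z => σ (i₁ z)) '' ((ρ'.comp i₁) ⁻¹' {b}) ⊂ f ⁻¹' {(q.comp j) b} := by
      refine ⟨?_, fun h => ?_⟩
      · rintro _ ⟨z, rfl, rfl⟩
        exact hσf _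
      · obtain ⟨w, hw, hw'⟩ := h (show nab (lam z) ∈ _ from
          (hE.isPullback.comm z).trans (congrArg q hz))
        have hw : ρ' (i₁ w) = b := hw
        have e : π' (i₁ w) = z :=
          hE.isPullback.ext hw' (by rw [hz, ← hw]; exact hZ'.comm _)
        exact hzL (e ▸ w.2)
    have := Set.ncard_lt_ncard himg (Set.toFinite _)
    rwa [Set.InjOn.ncard_image] at this
    intro z hz z' hz' h
    exact hZ.inl_inj (hσ _ _ ((show ρ' (i₁ z) = b from hz).trans
      (show ρ' (i₁ z') = b from hz').symm) h)
  · intro b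
    have himg : (fun z => σ (i₂ z)) '' ((ρ'.comp i₂) ⁻¹' {b}) ⊆ f ⁻¹' {(q.comp j) b} := by
      rintro _ ⟨z, rfl, rfl⟩
      exact hσf _
    have := Set.ncard_le_ncard himg (Set.toFinite _)
    rwa [Set.InjOn.ncard_image] at this
    intro z hz z' hz' h
    exact hZ.inr_inj (hσ _ _ ((show ρ' (i₂ z) = b from hz).trans
      (show ρ' (i₂ z') = b from hz').symm) h)
  · intro x t
    let m : T.obj (sum X X) := T.mul.glue x t
    have hm₁ : T.res (inl X X) m = x := T.mul.res_inl_glue x t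
    have hm₂ : T.res (inr X X) m = t := T.mul.res_inr_glue x t
    have hsum : x + t = T.tr nab m := by
      have := T.add.tr_eq_mul isSum_inl_inr nab (m : T.obj (sum X X))
      refine (Eq.trans this ?_).symm
      change T.tr (MulActionHom.id G) (T.res (inl X X) m) +
        T.tr (MulActionHom.id G) (T.res (inr X X) m) = _
      rw [hm₁, hm₂, T.tr_id, T.tr_id]
    have hsplit : ∀ w : T.obj B, T.tr q w = T.tr (q.comp i) (T.res i w) +
        T.tr (q.comp j) (T.res j w) := T.add.tr_eq_mul hB q
    rw [hsum, T.distrib hE, hsplit]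
    congr 1
    · let Zf := pull rho i
      have hZf : FinGSet.IsPullback (pullFst rho i) (pullSnd rho i) rho i := isPullback_pull rho i
      let π : Zf →[G] X := nab.comp (lam.comp (pullFst rho i))
      have hlam : lam.comp (pullFst rho i) = (inl X X).comp π := by
        ext z
        obtain ⟨x, hx⟩ := (pullSnd rho i z).2 (pullFst rho i z) (hZf.comm z)
        change lam _ = inl X X (nab (lam _))
        rw [← hx]; rfl
      have hπ : FinGSet.IsPullback (pullSnd rho i) π (q.comp i) f := by
        refine FinGSet.IsPullback.mk' ?_ ?_ ?_
        · intro z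
          exact ((hE.isPullback.comm _).trans (congrArg q (hZf.comm z))).symm
        · intro z z' h h'
          exact hZf.ext (hE.isPullback.ext h'
            ((hZf.comm z).trans ((congrArg i h).trans (hZf.comm z').symm))) h
        · intro b x h
          obtain ⟨z, hz, hz'⟩ := hE.isPullback.exists_of h.symm
          obtain ⟨z₁, hz₁, hz₁'⟩ := hZf.exists_of hz'
          refine ⟨z₁, hz₁', ?_⟩
          change nab (lam (pullFst rho i z₁)) = x
          rw [hz₁]; exact hz
      have hbij : Function.Bijective (q.comp i) := by
        have key : ∀ y, ∃! b, q b = y ∧ ∀ z (h : f (nab (lam z)) = y), rho z = b →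
            lam z = inl X X (nab (lam z)) := fun y =>
          hE.existsUnique y (fun x => inl X X x.1) fun x => rfl
        have hF'' : ∀ b, F b → ∀ z, rho z = b → lam z = inl X X (nab (lam z)) := by
          intro b hb z hz
          obtain ⟨x, hx⟩ := hb z hz
          rw [← hx]; rfl
        constructor
        · intro b b' h
          exact Subtype.ext ((key (q b'.1)).unique ⟨h, fun z _ hz => hF'' b.1 b.2 z hz⟩
            ⟨rfl, fun z _ hz => hF'' b'.1 b'.2 z hz⟩)
        · intro y
          obtain ⟨b, ⟨hb, hb'⟩, -⟩ := key y
          exact ⟨⟨b, fun z hz => ⟨_, (hb' z ((hE.isPullback.comm z).trans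
            ((congrArg q hz).trans hb)) hz).symm⟩⟩, hb⟩
      rw [← T.mackey_nm hZf.symm, ← T.res_comp, hlam, T.res_comp, hm₁, T.mackey_nm hπ]
      exact T.add.tr_res_of_bij hbij (T.nm f x)
    · congr 1
      have hlam₁ : (lam.comp π').comp i₁ = (inl X X).comp (σ.comp i₁) := by
        ext z
        obtain ⟨x, hx⟩ := z.2
        change lam _ = inl X X (nab (lam (π' z.1)))
        rw [← hx]; exact hx.symm
      have hlam₂ : (lam.comp π').comp i₂ = (inr X X).comp (σ.comp i₂) := by
        ext z
        change lam (π' z.1) = inr X X (nab (lam (π' z.1)))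
        rcases e : lam (π' z.1) with x | x
        · exact (z.2 ⟨x, e.symm⟩).elim
        · rfl
      rw [← T.mackey_nm hZ'.symm, ← T.res_comp]
      have := T.mul.tr_eq_mul hZ ρ' (T.res (lam.comp π') m)
      refine this.trans ?_
      change T.nm (ρ'.comp i₁) (T.res i₁ (T.res (lam.comp π') m)) *
        T.nm (ρ'.comp i₂) (T.res i₂ (T.res (lam.comp π') m)) = _
      rw [← T.res_comp, ← T.res_comp, hlam₁, hlam₂, T.res_comp (inl X X), T.res_comp (inr X X), hm₁,
        hm₂]

/-- The multiplicative transfer, followed by the map to the Grothendieck ring, is polynomial. -/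
theorem polyDegLT_nm (d : ℕ) {X Y : FinGSet G} (f : X →[G] Y) (hf : ∀ y, fib f y < d) :
    PolyDegLT d fun x : T.obj X => GrothRing.of (T.nm f x) := by
  induction d generalizing X Y with
  | zero =>
    intro x
    exact (congrArg GrothRing.of (T.mul.subsingleton_of_empty (fun y => by simpa using hf y)
      (T.nm f x) 0)).trans (map_zero _)
  | succ d ih =>
    intro t
    obtain ⟨B, Z₁, Z₂, q, ρ₁, ρ₂, π₁, π₂, h₁, -, h⟩ := T.nm_add f
    have := (ih ρ₁ fun b => (h₁ b).trans_le (Nat.lt_succ_iff.1 (hf _))).comp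
      (T.res π₁).toAddMonoidHom
    have := this.map ((GrothRing.mapAdd (T.tr q)).comp
      (AddMonoidHom.mulRight (GrothRing.of (T.nm ρ₂ (T.res π₂ t)))))
    convert! this using 2 with x
    simp only [h x t, map_add, add_sub_cancel_left, AddMonoidHom.comp_apply,
      AddMonoidHom.coe_mulRight, RingHom.toAddMonoidHom_eq_coe, AddMonoidHom.coe_coe,
      ← GrothRing.of_mul, GrothRing.mapAdd_of]

theorem exists_nm_extend (f : X →[G] Y) :
    ∃ (d : ℕ) (Φ : GrothRing (T.obj X) → GrothRing (T.obj Y)), PolyDegLT d Φ ∧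
      ∀ a, Φ (.of a) = .of (T.nm f a) := by
  have hf : ∀ y, fib f y < Nat.card X + 1 := fun y => Nat.lt_succ_of_le <| by
    rw [← Set.ncard_univ]
    exact Set.ncard_le_ncard (Set.subset_univ _) (Set.toFinite _)
  exact ⟨_, (T.polyDegLT_nm _ f hf).exists_extend⟩

/-- The extension of the multiplicative transfer to Grothendieck rings: the unique polynomial map
that agrees with the multiplicative transfer on the classes of elements of the semirings. -/
noncomputable def grothNmFun (f : X →[G] Y) : GrothRing (T.obj X) → GrothRing (T.obj Y) :=
  (T.exists_nm_extend f).choose_spec.choose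

theorem exists_grothNm_deg (f : X →[G] Y) : ∃ d, PolyDegLT d (T.grothNmFun f) :=
  ⟨_, (T.exists_nm_extend f).choose_spec.choose_spec.1⟩

theorem grothNmFun_of (f : X →[G] Y) (a : T.obj X) :
    T.grothNmFun f (.of a) = .of (T.nm f a) :=
  (T.exists_nm_extend f).choose_spec.choose_spec.2 a

/-- The extension of the multiplicative transfer, as a multiplicative map. -/
noncomputable def grothNm (f : X →[G] Y) : GrothRing (T.obj X) →* GrothRing (T.obj Y) where
  toFun := T.grothNmFun f
  map_one' := (T.grothNmFun_of f 1).trans (by rw [map_one]; rfl)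
  map_mul' k l := by
    obtain ⟨d, hd⟩ := T.exists_grothNm_deg f
    have h₁ : PolyDegLT d fun k => T.grothNmFun f (k * l) := hd.comp (AddMonoidHom.mulRight l)
    have h₂ : PolyDegLT d fun k => T.grothNmFun f k * T.grothNmFun f l :=
      hd.map (AddMonoidHom.mulRight _)
    refine h₁.eq_of h₂ (fun a => ?_) k
    have h₃ : PolyDegLT d fun l => T.grothNmFun f (.of a * l) :=
      hd.comp (AddMonoidHom.mulLeft (GrothRing.of a))
    have h₄ : PolyDegLT d fun l => T.grothNmFun f (.of a) * T.grothNmFun f l :=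
      hd.map (AddMonoidHom.mulLeft _)
    refine h₃.eq_of h₄ (fun b => ?_) l
    simp only [← GrothRing.of_mul, T.grothNmFun_of, map_mul]

theorem grothNm_of (f : X →[G] Y) (a : T.obj X) : T.grothNm f (.of a) = .of (T.nm f a) :=
  T.grothNmFun_of f a

theorem grothNm_deg (f : X →[G] Y) : ∃ d, PolyDegLT d (T.grothNm f) := T.exists_grothNm_deg f

theorem grothNm_add (f : X →[G] Y) :
    ∃ (B Z₁ Z₂ : FinGSet G) (q : B →[G] Y) (ρ₁ : Z₁ →[G] B) (ρ₂ : Z₂ →[G] B) (π₁ : Z₁ →[G] X)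
      (π₂ : Z₂ →[G] X), (∀ b, fib ρ₁ b < fib f (q b)) ∧ (∀ b, fib ρ₂ b ≤ fib f (q b)) ∧
      ∀ k l : GrothRing (T.obj X), T.grothNm f (k + l) = T.grothNm f k +
        GrothRing.mapAdd (T.tr q) (T.grothNm ρ₁ (GrothRing.mapRing (T.res π₁) k) *
          T.grothNm ρ₂ (GrothRing.mapRing (T.res π₂) l)) := by
  obtain ⟨B, Z₁, Z₂, q, ρ₁, ρ₂, π₁, π₂, h₁, h₂, h⟩ := T.nm_add f
  refine ⟨B, Z₁, Z₂, q, ρ₁, ρ₂, π₁, π₂, h₁, h₂, fun k l => ?_⟩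
  obtain ⟨d, hd⟩ := T.grothNm_deg f
  obtain ⟨d₁, hd₁⟩ := T.grothNm_deg ρ₁
  obtain ⟨d₂, hd₂⟩ := T.grothNm_deg ρ₂
  have H : PolyDegLT (max d d₁) fun k => T.grothNm f k +
      GrothRing.mapAdd (T.tr q) (T.grothNm ρ₁ (GrothRing.mapRing (T.res π₁) k) *
        T.grothNm ρ₂ (GrothRing.mapRing (T.res π₂) l)) := by
    have k₁ : PolyDegLT d₁ fun k => T.grothNm ρ₁ (GrothRing.mapRing (T.res π₁) k) :=
      hd₁.comp (GrothRing.mapRing (T.res π₁)).toAddMonoidHom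
    have k₂ := k₁.map ((GrothRing.mapAdd (T.tr q)).comp
      (AddMonoidHom.mulRight (T.grothNm ρ₂ (GrothRing.mapRing (T.res π₂) l))))
    exact (hd.mono (le_max_left _ _)).add (k₂.mono (le_max_right _ _))
  refine (hd.shift l).eq_of H (fun a => ?_) k
  have H' : PolyDegLT (1 + d₂) fun l => T.grothNm f (.of a) +
      GrothRing.mapAdd (T.tr q) (T.grothNm ρ₁ (GrothRing.mapRing (T.res π₁) (.of a)) *
        T.grothNm ρ₂ (GrothRing.mapRing (T.res π₂) l)) := by
    have k₁ : PolyDegLT d₂ fun k => T.grothNm ρ₂ (GrothRing.mapRing (T.res π₂) k) :=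
      hd₂.comp (GrothRing.mapRing (T.res π₂)).toAddMonoidHom
    have k₂ := k₁.map ((GrothRing.mapAdd (T.tr q)).comp
      (AddMonoidHom.mulLeft (T.grothNm ρ₁ (GrothRing.mapRing (T.res π₁) (.of a)))))
    exact ((PolyDegLT.const _).mono (Nat.le_add_right _ _)).add (k₂.mono (Nat.le_add_left _ _))
  have H'' : PolyDegLT d fun l => T.grothNm f (.of a + l) := by
    simpa only [add_comm] using hd.shift (.of a)
  refine H''.eq_of H' (fun b => ?_) l
  simp only [← map_add, T.grothNm_of, h, GrothRing.mapRing_of, GrothRing.mapAdd_of,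
    ← GrothRing.of_mul]

/-- Multiplicative transfers preserve polynomial maps. -/
theorem grothNm_comp_deg {C : Type w} [AddCommMonoid C] (d : ℕ) : ∀ e : ℕ, ∃ N, ∀ {X Y : FinGSet G}
    (f : X →[G] Y), (∀ y, fib f y < d) → ∀ Q : C → GrothRing (T.obj X), PolyDegLT e Q →
      PolyDegLT N fun c => T.grothNm f (Q c) := by
  induction d with
  | zero =>
    refine fun e => ⟨0, fun {X Y} f hf Q _ c => ?_⟩
    obtain ⟨a, b, h⟩ := GrothRing.exists_sub (T.grothNm f (Q c))
    beta_reduce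
    rw [h, T.mul.subsingleton_of_empty (fun y => by simpa using hf y) a b, sub_self]
  | succ d ihd =>
    intro e
    induction e with
    | zero =>
      refine ⟨1, fun {X Y} f hf Q hQ => ?_⟩
      have : Q = fun _ => 0 := funext hQ
      rw [this]
      exact PolyDegLT.const _
    | succ e ihe =>
      obtain ⟨N₁, hN₁⟩ := ihd (e + 1)
      obtain ⟨N₂, hN₂⟩ := ihe
      refine ⟨N₁ + N₂ + 1, fun {X Y} f hf Q hQ c => ?_⟩
      obtain ⟨B, Z₁, Z₂, q, ρ₁, ρ₂, π₁, π₂, h₁, h₂, h⟩ := T.grothNm_add f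
      have k₁ := hN₁ ρ₁ (fun b => (h₁ b).trans_le (Nat.lt_succ_iff.1 (hf _))) _
        (hQ.map (GrothRing.mapRing (T.res π₁)).toAddMonoidHom)
      have k₂ := hN₂ ρ₂ (fun b => (h₂ b).trans_lt (hf _)) _
        ((hQ c).map (GrothRing.mapRing (T.res π₂)).toAddMonoidHom)
      convert! (k₁.mul k₂).map (GrothRing.mapAdd (T.tr q)) using 2 with x
      have := h (Q x) (Q (x + c) - Q x)
      rw [add_sub_cancel] at this
      exact sub_eq_iff_eq_add'.2 this

theorem exists_grothNm_comp_deg {C : Type w} [AddCommMonoid C] (f : X →[G] Y)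
    {Q : C → GrothRing (T.obj X)} (hQ : ∃ d, PolyDegLT d Q) :
    ∃ d, PolyDegLT d fun c => T.grothNm f (Q c) := by
  obtain ⟨e, he⟩ := hQ
  have hf : ∀ y, fib f y < Nat.card X + 1 := fun y => Nat.lt_succ_of_le <| by
    rw [← Set.ncard_univ]
    exact Set.ncard_le_ncard (Set.subset_univ _) (Set.toFinite _)
  obtain ⟨N, hN⟩ := T.grothNm_comp_deg (C := C) (Nat.card X + 1) e
  exact ⟨N, hN f hf Q he⟩

theorem groth_add_hom_deg {R R' : Type v} [CommSemiring R] [CommSemiring R']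
    (φ : GrothRing R →+ GrothRing R') : ∃ d, PolyDegLT d φ := by
  refine ⟨2, fun a b x => ?_⟩
  simp

/-- The group completion of a semi-Tambara functor: `T` is replaced by the Grothendieck rings of
its values, restrictions and additive transfers are extended additively, multiplicative transfers
polynomially. -/
noncomputable def completion : Tambara.{u, v} G where
  obj X := GrothRing (T.obj X)
  res f := GrothRing.mapRing (T.res f)
  tr f := GrothRing.mapAdd (T.tr f)
  nm f := T.grothNm f
  res_id {X} t := DFunLike.congr_fun (GrothRing.hom_ext (R := T.obj _)
    (φ := (GrothRing.mapRing (T.res (MulActionHom.id G : X →[G] X))).toAddMonoidHom) (ψ := AddMonoidHom.id _)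
    fun a => (GrothRing.mapRing_of _ a).trans (congrArg GrothRing.of (T.res_id a))) t
  res_comp g f t := DFunLike.congr_fun (GrothRing.hom_ext (R := T.obj _)
    (φ := (GrothRing.mapRing (T.res _)).toAddMonoidHom)
    (ψ := ((GrothRing.mapRing (T.res f)).comp (GrothRing.mapRing (T.res g))).toAddMonoidHom)
    fun a => by simp [T.res_comp]) t
  tr_id {X} t := DFunLike.congr_fun (GrothRing.hom_ext (R := T.obj _)
    (φ := GrothRing.mapAdd (T.tr _)) (ψ := AddMonoidHom.id _) fun a => by simp [T.tr_id]) t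
  tr_comp g f t := DFunLike.congr_fun (GrothRing.hom_ext (R := T.obj _)
    (φ := GrothRing.mapAdd (T.tr _))
    (ψ := (GrothRing.mapAdd (T.tr g)).comp (GrothRing.mapAdd (T.tr f)))
    fun a => by simp [T.tr_comp]) t
  nm_id {X} t := by
    obtain ⟨d, hd⟩ := T.grothNm_deg (X := X) (MulActionHom.id G)
    obtain ⟨e, he⟩ := groth_add_hom_deg (AddMonoidHom.id (GrothRing (T.obj X)))
    exact hd.eq_of he (fun a => by simp [T.grothNm_of, T.nm_id]) t
  nm_comp g f t := by
    obtain ⟨d, hd⟩ := T.grothNm_deg (g.comp f)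
    obtain ⟨e, he⟩ := T.exists_grothNm_comp_deg g (T.grothNm_deg f)
    exact hd.eq_of he (fun a => by simp [T.grothNm_of, T.nm_comp]) t
  additive X Y := by
    have hi : ∀ k, GrothRing.mapRing (T.res (inl X Y)) (GrothRing.mapAdd (T.tr (inl X Y)) k) = k :=
      fun k => by
        obtain ⟨a, b, rfl⟩ := GrothRing.exists_sub k
        have : ∀ a, T.res (inl X Y) (T.tr (inl X Y) a) = a :=
          T.add.res_tr_of_inj isSum_inl_inr.inl_inj
        simp [this]
    have hj : ∀ k, GrothRing.mapRing (T.res (inr X Y)) (GrothRing.mapAdd (T.tr (inr X Y)) k) = k :=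
      fun k => by
        obtain ⟨a, b, rfl⟩ := GrothRing.exists_sub k
        have : ∀ a, T.res (inr X Y) (T.tr (inr X Y) a) = a :=
          T.add.res_tr_of_inj isSum_inl_inr.inr_inj
        simp [this]
    have hij : ∀ k, GrothRing.mapRing (T.res (inl X Y)) (GrothRing.mapAdd (T.tr (inr X Y)) k) = 0 :=
      fun k => by
        obtain ⟨a, b, rfl⟩ := GrothRing.exists_sub k
        have : ∀ a, T.res (inl X Y) (T.tr (inr X Y) a) = 0 :=
          T.add.res_tr_of_disjoint isSum_inl_inr.ne
        simp [this]
    have hji : ∀ k, GrothRing.mapRing (T.res (inr X Y)) (GrothRing.mapAdd (T.tr (inl X Y)) k) = 0 :=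
      fun k => by
        obtain ⟨a, b, rfl⟩ := GrothRing.exists_sub k
        have : ∀ a, T.res (inr X Y) (T.tr (inl X Y) a) = 0 :=
          T.add.res_tr_of_disjoint fun a b => (isSum_inl_inr.ne b a).symm
        simp [this]
    have hd : ∀ k, GrothRing.mapAdd (T.tr (inl X Y)) (GrothRing.mapRing (T.res (inl X Y)) k) +
        GrothRing.mapAdd (T.tr (inr X Y)) (GrothRing.mapRing (T.res (inr X Y)) k) = k := fun k => by
      have hd : ∀ m, T.tr (inl X Y) (T.res (inl X Y) m) + T.tr (inr X Y) (T.res (inr X Y) m) = m :=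
        T.add.decomp isSum_inl_inr
      obtain ⟨a, b, rfl⟩ := GrothRing.exists_sub k
      simp only [map_sub, GrothRing.mapRing_of, GrothRing.mapAdd_of]
      conv_rhs => rw [← hd a, ← hd b, map_add, map_add]
      abel
    constructor
    · intro k l h
      have h₁ := congrArg Prod.fst h
      have h₂ := congrArg Prod.snd h
      dsimp only at h₁ h₂
      rw [← hd k, ← hd l, h₁, h₂]
    · rintro ⟨k, l⟩
      refine ⟨GrothRing.mapAdd (T.tr (inl X Y)) k + GrothRing.mapAdd (T.tr (inr X Y)) l, ?_⟩
      simp only [map_add, hi, hj, hij, hji, add_zero, zero_add]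
  mackey_tr h t := by
    obtain ⟨a, b, rfl⟩ := GrothRing.exists_sub t
    simp [T.mackey_tr h]
  mackey_nm {X' X Y' Y ξ f' f η} h t := by
    obtain ⟨d, hd⟩ := T.grothNm_deg ξ
    obtain ⟨e, he⟩ := T.grothNm_deg η
    refine (hd.comp (GrothRing.mapRing (T.res f')).toAddMonoidHom).eq_of
      (he.map (GrothRing.mapRing (T.res f)).toAddMonoidHom) (fun a => ?_) t
    simp [T.grothNm_of, T.mackey_nm h]
  distrib {X Y A Z B f p lam rho q} h t := by
    obtain ⟨d, hd⟩ := T.grothNm_deg f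
    obtain ⟨e, he⟩ := T.grothNm_deg rho
    refine (hd.comp (GrothRing.mapAdd (T.tr p))).eq_of
      ((he.comp (GrothRing.mapRing (T.res lam)).toAddMonoidHom).map (GrothRing.mapAdd (T.tr q)))
      (fun a => ?_) t
    simp [T.grothNm_of, T.distrib h]
  exists_neg X t := ⟨-t, add_neg_cancel t⟩

/-- The morphism of group completions induced by a morphism of semi-Tambara functors. -/
noncomputable def Hom.completion {T : SemiTambara.{u, v} G} {U : SemiTambara.{u, w} G}
    (φ : Hom T U) : Hom T.completion.toSemiTambara U.completion.toSemiTambara where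
  app X := GrothRing.mapRing (φ.app X)
  app_res f t := by
    change GrothRing.mapRing _ (GrothRing.mapRing (T.res f) _) =
      GrothRing.mapRing (U.res f) (GrothRing.mapRing _ _)
    obtain ⟨a, b, rfl⟩ := GrothRing.exists_sub (R := T.obj _) t
    simp [φ.app_res]
  app_tr f t := by
    change GrothRing.mapRing _ (GrothRing.mapAdd (T.tr f) _) =
      GrothRing.mapAdd (U.tr f) (GrothRing.mapRing _ _)
    obtain ⟨a, b, rfl⟩ := GrothRing.exists_sub (R := T.obj _) t
    simp [φ.app_tr]
  app_nm f t := by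
    change GrothRing.mapRing _ (T.grothNm f _) = U.grothNm f (GrothRing.mapRing _ _)
    obtain ⟨d, hd⟩ := T.grothNm_deg f
    obtain ⟨e, he⟩ := U.grothNm_deg f
    refine (hd.map (GrothRing.mapRing (φ.app _)).toAddMonoidHom).eq_of
      (he.comp (GrothRing.mapRing (φ.app _)).toAddMonoidHom) (fun a => ?_) t
    simp [grothNm_of, φ.app_nm]

end SemiTambara

namespace FinGSet

variable {G : Type u} [Group G] {X Y Z W A B C A' B' Z' X' Y' P : FinGSet G}

namespace IsExponential

variable {f : X →[G] Y} {p : A →[G] X} {lam : Z →[G] A} {rho : Z →[G] B} {q : B →[G] Y}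

theorem ext (h : IsExponential f p lam rho q) {b b' : B} (hb : q b = q b')
    (hz : ∀ z z', rho z = b → rho z' = b' → p (lam z) = p (lam z') → lam z = lam z') : b = b' := by
  have ex : ∀ x : {x // f x = q b'}, ∃ z, p (lam z) = x ∧ rho z = b' := fun x =>
    h.isPullback.exists_of x.2
  choose z hz₁ hz₂ using ex
  refine (h.existsUnique (q b') (fun x => lam (z x)) hz₁).unique ⟨hb, ?_⟩ ⟨rfl, ?_⟩
  · exact fun z₀ h₀ e => hz _ _ e (hz₂ _) (hz₁ ⟨p (lam z₀), h₀⟩).symm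
  · intro z₀ h₀ e
    exact congrArg lam (h.isPullback.ext (hz₁ ⟨p (lam z₀), h₀⟩).symm (e.trans (hz₂ _).symm))

theorem exists_of (h : IsExponential f p lam rho q) (y : Y) (R : A → Prop)
    (hR : ∀ x, f x = y → ∃ a, p a = x ∧ R a) :
    ∃ b, q b = y ∧ ∀ z, rho z = b → R (lam z) := by
  choose s hs hs' using hR
  obtain ⟨b, ⟨hb, hb'⟩, -⟩ := h.existsUnique y (fun x => s x.1 x.2) fun x => hs x.1 x.2
  refine ⟨b, hb, fun z hz => ?_⟩
  rw [hb' z ((h.isPullback.comm z).trans ((congrArg q hz).trans hb)) hz]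
  exact hs' _ _

theorem mk' (pb : FinGSet.IsPullback (p.comp lam) rho f q)
    (inj : ∀ b b', q b = q b' →
      (∀ z z', rho z = b → rho z' = b' → p (lam z) = p (lam z') → lam z = lam z') → b = b')
    (surj : ∀ (y : Y) (R : A → Prop), (∀ x, f x = y → ∃ a, p a = x ∧ R a) →
      ∃ b, q b = y ∧ ∀ z, rho z = b → R (lam z)) : IsExponential f p lam rho q where
  isPullback := pb
  existsUnique y s hs := by
    obtain ⟨b, hb, hb'⟩ := surj y (fun a => ∀ h : f (p a) = y, a = s ⟨p a, h⟩) fun x hx =>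
      ⟨s ⟨x, hx⟩, hs _, fun h => congrArg s (Subtype.ext (hs _).symm)⟩
    refine ⟨b, ⟨hb, fun z h hz => hb' z hz h⟩, ?_⟩
    rintro b' ⟨hb₁, hb₂⟩
    refine inj b' b (hb₁.trans hb.symm) fun z z' hz hz' e => ?_
    have h₁ : f (p (lam z)) = y := (pb.comm z).trans ((congrArg q hz).trans hb₁)
    have h₂ : f (p (lam z')) = y := (pb.comm z').trans ((congrArg q hz').trans hb)
    rw [hb₂ z h₁ hz, hb' z' hz' h₂]
    exact congrArg s (Subtype.ext e)

theorem of_id (f : X →[G] Y) :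
    IsExponential f (MulActionHom.id G) (MulActionHom.id G) f (MulActionHom.id G) :=
  mk' (FinGSet.IsPullback.mk' (fun _ => rfl) (fun _ _ h _ => h) fun x _ h => ⟨x, rfl, h⟩)
    (fun _ _ h _ => h) fun y R hR => ⟨y, rfl, fun z hz => by
      obtain ⟨a, rfl, ha⟩ := hR z hz; exact ha⟩

theorem id_left (p : A →[G] X) :
    IsExponential (MulActionHom.id G) p (MulActionHom.id G) (MulActionHom.id G) p :=
  mk' (FinGSet.IsPullback.mk' (fun _ => rfl) (fun _ _ _ h => h) fun _ a h => ⟨a, h.symm, rfl⟩)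
    (fun b b' h h' => h' b b' rfl rfl h) fun y R hR => by
      obtain ⟨a, ha, ha'⟩ := hR y rfl
      exact ⟨a, ha, fun z hz => (show z = a from hz) ▸ ha'⟩

/-- Exponential diagrams can be pasted vertically. -/
theorem comp {g : Y →[G] W} {lam₂ : Z' →[G] B} {rho₂ : Z' →[G] B'} {q₂ : B' →[G] W}
    {c₁ : P →[G] Z} {c₂ : P →[G] Z'} (h : IsExponential f p lam rho q)
    (h₂ : IsExponential g q lam₂ rho₂ q₂) (hP : FinGSet.IsPullback c₁ c₂ rho lam₂) :
    IsExponential (g.comp f) p (lam.comp c₁) (rho₂.comp c₂) q₂ := by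
  have e₁ : ∀ c, f (p (lam (c₁ c))) = q (lam₂ (c₂ c)) := fun c =>
    (h.isPullback.comm _).trans (congrArg q (hP.comm c))
  refine mk' (FinGSet.IsPullback.mk' ?_ ?_ ?_) ?_ ?_
  · exact fun c => (congrArg g (e₁ c)).trans (h₂.isPullback.comm (c₂ c))
  · intro c c' hc hc'
    have k : c₂ c = c₂ c' := h₂.isPullback.ext
      ((e₁ c).symm.trans ((congrArg f hc).trans (e₁ c'))) hc'
    exact hP.ext (h.isPullback.ext hc ((hP.comm c).trans ((congrArg lam₂ k).trans
      (hP.comm c').symm))) k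
  · intro x b hx
    obtain ⟨z₂, hz₂, rfl⟩ := h₂.isPullback.exists_of (x := f x) (y := b) hx
    obtain ⟨z₁, hz₁, hz₁'⟩ := h.isPullback.exists_of (x := x) (y := lam₂ z₂) hz₂.symm
    obtain ⟨c, rfl, rfl⟩ := hP.exists_of hz₁'
    exact ⟨c, hz₁, rfl⟩
  · intro b b' hb hz
    refine h₂.ext hb fun z₂ z₂' k k' hq => h.ext hq fun z₁ z₁' l l' hp => ?_
    obtain ⟨c, rfl, rfl⟩ := hP.exists_of l
    obtain ⟨c', rfl, rfl⟩ := hP.exists_of l'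
    exact hz c c' k k' hp
  · intro w R hR
    obtain ⟨b, hb, hb'⟩ := h₂.exists_of w (fun b₁ => ∀ z, rho z = b₁ → R (lam z)) fun y hy =>
      h.exists_of y R fun x hx => hR x ((congrArg g hx).trans hy)
    exact ⟨b, hb, fun c hc => hb' (c₂ c) hc (c₁ c) (hP.comm c)⟩

/-- Exponential diagrams can be pasted horizontally. -/
theorem distrib {r : C →[G] A} {π : P →[G] Z} {γ : P →[G] C} {lam₂ : Z' →[G] P}
    {rho₂ : Z' →[G] B'} {q₂ : B' →[G] B} (h : IsExponential f p lam rho q)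
    (hP : FinGSet.IsPullback π γ lam r) (h₂ : IsExponential rho π lam₂ rho₂ q₂) :
    IsExponential f (p.comp r) (γ.comp lam₂) rho₂ (q.comp q₂) := by
  have e₁ : ∀ z, p (r (γ (lam₂ z))) = p (lam (π (lam₂ z))) := fun z =>
    (congrArg p (hP.comm _)).symm
  have e₂ : ∀ z, rho (π (lam₂ z)) = q₂ (rho₂ z) := h₂.isPullback.comm
  refine mk' (FinGSet.IsPullback.mk' ?_ ?_ ?_) ?_ ?_
  · exact fun z => (congrArg f (e₁ z)).trans ((h.isPullback.comm _).trans (congrArg q (e₂ z)))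
  · intro z z' k k'
    refine h₂.isPullback.ext (h.isPullback.ext ?_ ?_) k'
    · exact (e₁ z).symm.trans (Eq.trans k (e₁ z'))
    · exact (e₂ z).trans ((congrArg q₂ k').trans (e₂ z').symm)
  · intro x b hx
    obtain ⟨z, hz, hz'⟩ := h.isPullback.exists_of (x := x) (y := q₂ b) hx
    obtain ⟨z₂, rfl, hz₂⟩ := h₂.isPullback.exists_of hz'
    exact ⟨z₂, (e₁ z₂).trans hz, hz₂⟩
  · intro b b' hb hz
    have hb₂ : q₂ b = q₂ b' := h.ext hb fun z z' k k' hp => by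
      obtain ⟨w, rfl, hw⟩ := h₂.isPullback.exists_of k
      obtain ⟨w', rfl, hw'⟩ := h₂.isPullback.exists_of k'
      have := hz w w' hw hw' ((e₁ w).trans (hp.trans (e₁ w').symm))
      exact (hP.comm _).trans ((congrArg r this).trans (hP.comm _).symm)
    refine h₂.ext hb₂ fun w w' k k' hπ => hP.ext hπ ?_
    exact hz w w' k k' ((e₁ w).trans ((congrArg (fun t => p (lam t)) hπ).trans (e₁ w').symm))
  · intro y R hR
    obtain ⟨b, hb, hb'⟩ := h.exists_of y (fun a => ∃ c, r c = a ∧ R c) fun x hx => by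
      obtain ⟨c, hc, hc'⟩ := hR x hx
      exact ⟨r c, hc, c, rfl, hc'⟩
    obtain ⟨b₂, hb₂, hb₂'⟩ := h₂.exists_of b (fun t => R (γ t)) fun z hz => by
      obtain ⟨c, hc, hc'⟩ := hb' z hz
      obtain ⟨t, ht, rfl⟩ := hP.exists_of hc.symm
      exact ⟨t, ht, hc'⟩
    exact ⟨b₂, (congrArg q hb₂).trans hb, hb₂'⟩

/-- Base change of exponential diagrams. -/
theorem baseChange {ξ : X' →[G] W} {f' : X' →[G] X} {k : W →[G] Y}
    {π : A' →[G] X'} {α : A' →[G] A} {x : B' →[G] W} {b' : B' →[G] B} {rho' : Z' →[G] B'}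
    {z' : Z' →[G] Z} {lam' : Z' →[G] A'}
    (h : IsExponential f p lam rho q) (hX : FinGSet.IsPullback ξ f' k f)
    (hA : FinGSet.IsPullback π α f' p) (hB : FinGSet.IsPullback x b' k q)
    (hZ : FinGSet.IsPullback rho' z' b' rho) (h₁ : ∀ t, ξ (π (lam' t)) = x (rho' t))
    (h₂ : ∀ t, α (lam' t) = lam (z' t)) :
    IsExponential ξ π lam' rho' x := by
  have h₃ : ∀ t, f' (π (lam' t)) = p (lam (z' t)) := fun t =>
    (hA.comm _).trans (congrArg p (h₂ t))
  refine mk' (FinGSet.IsPullback.mk' h₁ ?_ ?_) ?_ ?_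
  · intro t t' e e'
    refine hZ.ext e' (h.isPullback.ext ?_ ?_)
    · exact (h₃ t).symm.trans ((congrArg f' e).trans (h₃ t'))
    · exact (hZ.comm t).symm.trans ((congrArg b' e').trans (hZ.comm t'))
  · intro a c e
    obtain ⟨z, hz, hz'⟩ := h.isPullback.exists_of (x := f' a) (y := b' c)
      ((hX.comm a).symm.trans ((congrArg k e).trans (hB.comm c)))
    obtain ⟨t, ht, ht'⟩ := hZ.exists_of hz'.symm
    refine ⟨t, hX.ext ?_ ?_, ht⟩
    · exact (h₁ t).trans ((congrArg x ht).trans e.symm)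
    · exact (h₃ t).trans ((congrArg (fun s => p (lam s)) ht').trans hz)
  · intro c c' e hc
    refine hB.ext e (h.ext ?_ ?_)
    · exact (hB.comm c).symm.trans ((congrArg k e).trans (hB.comm c'))
    · intro z z₁ hz hz₁ hp
      obtain ⟨t, ht, rfl⟩ := hZ.exists_of hz.symm
      obtain ⟨t₁, ht₁, rfl⟩ := hZ.exists_of hz₁.symm
      have hh : π (lam' t) = π (lam' t₁) := hX.ext
        ((h₁ t).trans ((congrArg x ht).trans (e.trans ((congrArg x ht₁).symm.trans (h₁ t₁).symm))))
        ((h₃ t).trans (hp.trans (h₃ t₁).symm))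
      exact (h₂ t).symm.trans ((congrArg α (hc t t₁ ht ht₁ hh)).trans (h₂ t₁))
  · intro y R hR
    obtain ⟨b, hb, hb'⟩ := h.exists_of (k y) (fun a => ∃ a', α a' = a ∧ ξ (π a') = y ∧ R a')
      fun x₀ hx₀ => by
        obtain ⟨t, ht, rfl⟩ := hX.exists_of hx₀.symm
        obtain ⟨a', rfl, ha'⟩ := hR t ht
        exact ⟨α a', (hA.comm a').symm, a', rfl, ht, ha'⟩
    obtain ⟨c, hc, hc'⟩ := hB.exists_of hb.symm
    refine ⟨c, hc, fun t ht => ?_⟩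
    obtain ⟨a', ha', hξ, hR'⟩ := hb' (z' t) ((hZ.comm t).symm.trans
      ((congrArg b' ht).trans hc'))
    have e : a' = lam' t := by
      refine hA.ext (hX.ext ?_ ?_) (ha'.trans (h₂ t).symm)
      · exact hξ.trans (hc.symm.trans ((congrArg x ht).symm.trans (h₁ t).symm))
      · exact (hA.comm a').trans ((congrArg p (ha'.trans (h₂ t).symm)).trans (hA.comm _).symm)
    exact e ▸ hR'

/-- The exponential of a fibre product is the fibre product of the exponentials. -/
theorem mul {p' : A' →[G] X} {lam' : Z' →[G] A'} {rho' : Z' →[G] B'} {q' : B' →[G] Y}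
    {α : P →[G] A} {α' : P →[G] A'} {β : C →[G] B} {β' : C →[G] B'} {ζ : W →[G] Z} {ζ' : W →[G] Z'}
    {σ : W →[G] C} {μ : W →[G] P}
    (h : IsExponential f p lam rho q) (h' : IsExponential f p' lam' rho' q')
    (hP : FinGSet.IsPullback α α' p p') (hC : FinGSet.IsPullback β β' q q')
    (hZ : FinGSet.IsPullback σ ζ β rho) (hZ' : FinGSet.IsPullback σ ζ' β' rho')
    (h₁ : ∀ t, α (μ t) = lam (ζ t)) (h₂ : ∀ t, α' (μ t) = lam' (ζ' t)) :
    IsExponential f (p.comp α) μ σ (q.comp β) := by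
  refine mk' (FinGSet.IsPullback.mk' ?_ ?_ ?_) ?_ ?_
  · exact fun t => (congrArg (fun a => f (p a)) (h₁ t)).trans
      ((h.isPullback.comm _).trans (congrArg q (hZ.comm t)).symm)
  · intro t t' e e'
    refine hZ.ext e' (h.isPullback.ext ?_ ?_)
    · exact (congrArg p (h₁ t)).symm.trans (Eq.trans e (congrArg p (h₁ t')))
    · exact (hZ.comm t).symm.trans ((congrArg β e').trans (hZ.comm t'))
  · intro x c e
    obtain ⟨z, hz, hz'⟩ := h.isPullback.exists_of (x := x) (y := β c) e
    obtain ⟨t, ht, rfl⟩ := hZ.exists_of hz'.symm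
    exact ⟨t, (congrArg p (h₁ t)).trans hz, ht⟩
  · intro c c' e hc
    refine hC.ext (h.ext e ?_) (h'.ext ((hC.comm c).symm.trans (e.trans (hC.comm c'))) ?_)
    · intro z z' hz hz' hp
      obtain ⟨t, ht, rfl⟩ := hZ.exists_of hz.symm
      obtain ⟨t', ht', rfl⟩ := hZ.exists_of hz'.symm
      have := hc t t' ht ht' ((congrArg p (h₁ t)).trans (hp.trans (congrArg p (h₁ t')).symm))
      exact (h₁ t).symm.trans ((congrArg α this).trans (h₁ t'))
    · intro z z' hz hz' hp
      obtain ⟨t, ht, rfl⟩ := hZ'.exists_of hz.symm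
      obtain ⟨t', ht', rfl⟩ := hZ'.exists_of hz'.symm
      have := hc t t' ht ht' ((hP.comm _).trans ((congrArg p' (h₂ t)).trans
        (hp.trans ((congrArg p' (h₂ t')).symm.trans (hP.comm _).symm))))
      exact (h₂ t).symm.trans ((congrArg α' this).trans (h₂ t'))
  · intro y R hR
    choose s hs hs' using hR
    obtain ⟨b, hb, hb'⟩ := h.exists_of y (fun a => ∃ x hx, a = α (s x hx)) fun x hx =>
      ⟨_, hs x hx, x, hx, rfl⟩
    obtain ⟨b₂, hb₂, hb₂'⟩ := h'.exists_of y (fun a => ∃ x hx, a = α' (s x hx)) fun x hx =>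
      ⟨_, (hP.comm _).symm.trans (hs x hx), x, hx, rfl⟩
    obtain ⟨c, rfl, rfl⟩ := hC.exists_of (hb.trans hb₂.symm)
    refine ⟨c, hb, fun t ht => ?_⟩
    obtain ⟨x, hx, e⟩ := hb' (ζ t) ((hZ.comm t).symm.trans (congrArg β ht))
    obtain ⟨x', hx', e'⟩ := hb₂' (ζ' t) ((hZ'.comm t).symm.trans (congrArg β' ht))
    have k : x = x' := by
      have k₁ : p (α (μ t)) = x := (congrArg p ((h₁ t).trans e)).trans (hs x hx)
      have k₂ : p (α (μ t)) = x' := (hP.comm _).trans ((congrArg p' ((h₂ t).trans e')).trans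
        ((hP.comm _).symm.trans (hs x' hx')))
      exact k₁.symm.trans k₂
    subst k
    have : μ t = s x hx := hP.ext ((h₁ t).trans e) ((h₂ t).trans e')
    exact this ▸ hs' x hx

/-- Exponential diagrams of isomorphic maps are isomorphic. -/
theorem unique {p' : A' →[G] X} {lam' : Z' →[G] A'} {rho' : Z' →[G] B'} {q' : B' →[G] Y}
    (h : IsExponential f p lam rho q) (h' : IsExponential f p' lam' rho' q')
    (e : A →[G] A') (he : Function.Bijective e) (hp : ∀ a, p' (e a) = p a) :
    ∃ (ε : B →[G] B') (ζ : Z →[G] Z'), Function.Bijective ε ∧ (∀ b, q' (ε b) = q b) ∧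
      (∀ z, lam' (ζ z) = e (lam z)) ∧ FinGSet.IsPullback rho ζ ε rho' := by
  let R : B → B' → Prop := fun b b' => q' b' = q b ∧ ∀ z z', rho z = b → rho' z' = b' →
    p (lam z) = p' (lam' z') → e (lam z) = lam' z'
  have hR : ∀ (g : G) b b', R b b' → R (g • b) (g • b') := by
    rintro g b b' ⟨h₁, h₂⟩
    refine ⟨by rw [map_smul, map_smul, h₁], fun z z' hz hz' k => ?_⟩
    have := h₂ (g⁻¹ • z) (g⁻¹ • z') (by rw [map_smul, hz, inv_smul_smul])
      (by rw [map_smul, hz', inv_smul_smul]) (by simp only [map_smul, k])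
    rw [map_smul, map_smul, map_smul] at this
    exact MulAction.injective _ this
  have ex : ∀ b, ∃ b', R b b' := fun b => by
    obtain ⟨b', hb', k⟩ := h'.exists_of (q b)
      (fun a' => ∀ z, rho z = b → p (lam z) = p' a' → e (lam z) = a') fun x hx => by
        obtain ⟨z, rfl, hz'⟩ := h.isPullback.exists_of hx
        refine ⟨e (lam z), hp _, fun z₁ hz₁ k => ?_⟩
        rw [h.isPullback.ext (k.trans (hp _)) (hz₁.trans hz'.symm)]
    exact ⟨b', hb', fun z z' hz hz' => k z' hz' z hz⟩
  have un : ∀ b b₁ b₂, R b b₁ → R b b₂ → b₁ = b₂ := by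
    rintro b b₁ b₂ ⟨k₁, l₁⟩ ⟨k₂, l₂⟩
    refine h'.ext (k₁.trans k₂.symm) fun z z' hz hz' k => ?_
    obtain ⟨z₀, hz₀, hz₀'⟩ := h.isPullback.exists_of (x := p' (lam' z)) (y := b)
      ((h'.isPullback.comm z).trans ((congrArg q' hz).trans k₁))
    exact (l₁ z₀ z hz₀' hz hz₀).symm.trans (l₂ z₀ z' hz₀' hz' (hz₀.trans k))
  obtain ⟨ε, hε⟩ := exists_hom R hR ex un
  obtain ⟨ζ, hζ, hζ'⟩ := h'.isPullback.lift (p.comp lam) (ε.comp rho) fun z =>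
    (h.isPullback.comm z).trans (hε (rho z)).1.symm
  refine ⟨ε, ζ, ⟨?_, ?_⟩, fun b => (hε b).1, ?_, ?_⟩
  · intro b₁ b₂ hb
    refine h.ext ((hε b₁).1.symm.trans ((congrArg q' hb).trans (hε b₂).1)) fun z z' hz hz' k => ?_
    have l₁ := (hε b₁).2 z (ζ z) hz ((hζ' z).trans (congrArg ε hz)) (hζ z).symm
    have l₂ := (hε b₂).2 z' (ζ z) hz' ((hζ' z).trans ((congrArg ε hz).trans hb))
      (k.symm.trans (hζ z).symm)
    exact he.1 (l₁.trans l₂.symm)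
  · intro b'
    obtain ⟨b, hb, k⟩ := h.exists_of (q' b')
      (fun a => ∀ z', rho' z' = b' → p a = p' (lam' z') → e a = lam' z') fun x hx => by
        obtain ⟨z', rfl, hz'⟩ := h'.isPullback.exists_of hx
        obtain ⟨a, ha⟩ := he.2 (lam' z')
        refine ⟨a, ?_, fun z₁ hz₁ l => ?_⟩
        · rw [← hp, ha]; rfl
        · have l' : p' (lam' z') = p' (lam' z₁) := by rw [← ha, hp, l]
          rw [ha, h'.isPullback.ext l' (hz'.trans hz₁.symm)]
    exact ⟨b, un b _ _ (hε b) ⟨hb.symm, fun z z' hz hz' => k z hz z' hz'⟩⟩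
  · exact fun z => ((hε _).2 z (ζ z) rfl (hζ' z) (hζ z).symm).symm
  · refine FinGSet.IsPullback.mk' (fun z => (hζ' z).symm) ?_ ?_
    · exact fun z z' k k' => h.isPullback.ext ((hζ z).symm.trans
        ((congrArg (fun t => p' (lam' t)) k').trans (hζ z'))) k
    · intro b z' k
      obtain ⟨z, hz, hz'⟩ := h.isPullback.exists_of (x := p' (lam' z')) (y := b)
        ((h'.isPullback.comm z').trans ((congrArg q' k).symm.trans (hε b).1))
      exact ⟨z, hz', h'.isPullback.ext ((hζ z).trans hz)
        ((hζ' z).trans ((congrArg ε hz').trans k))⟩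

end IsExponential

end FinGSet

namespace SemiMackey

variable {G : Type u} [Group G]

/-- An object of the category `M-Gset/X`: a finite `G`-set `p : A → X` over `X` with an element
`m` of `M(A)`. -/
structure Obj (M : SemiMackey.{u, v} G) (X : FinGSet.{u} G) where
  A : FinGSet G
  p : A →[G] X
  m : M.obj A

/-- Two objects of `M-Gset/X` are isomorphic. -/
def Obj.Iso {M : SemiMackey.{u, v} G} {X : FinGSet.{u} G} (a b : Obj M X) : Prop :=
  ∃ e : a.A →[G] b.A, Function.Bijective e ∧ (∀ x, b.p (e x) = a.p x) ∧ M.res e b.m = a.m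

variable (M : SemiMackey.{u, v} G) {X Y Z A B C P A' B' : FinGSet.{u} G}

theorem exists_inverse {e : A →[G] B} (he : Function.Bijective e) :
    ∃ e' : B →[G] A, Function.Bijective e' ∧ (∀ a, e' (e a) = a) ∧ ∀ b, e (e' b) = b := by
  obtain ⟨e', h⟩ := exists_hom (fun b a => e a = b) (fun g b a h => by rw [map_smul, h]) he.2
    fun b a a' h h' => he.1 (h.trans h'.symm)
  refine ⟨e', ⟨fun b b' k => ?_, fun a => ⟨e a, he.1 (h _)⟩⟩, fun a => he.1 (h _), h⟩
  rw [← h b, k, h b']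

/-- Isomorphism of objects of `M-Gset/X`, as an equivalence relation. -/
def objSetoid (X : FinGSet.{u} G) : Setoid (Obj M X) where
  r := Obj.Iso
  iseqv :=
    { refl := fun a => ⟨MulActionHom.id G, Function.bijective_id, fun _ => rfl, M.res_id _⟩
      symm := by
        rintro a b ⟨e, he, hp, hm⟩
        obtain ⟨e', he', h₁, h₂⟩ := exists_inverse he
        refine ⟨e', he', fun x => by rw [← hp, h₂], ?_⟩
        have k : e.comp e' = MulActionHom.id G := by ext x; exact h₂ x
        rw [← hm, ← M.res_comp, k, M.res_id]
      trans := by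
        rintro a b c ⟨e, he, hp, hm⟩ ⟨e', he', hp', hm'⟩
        refine ⟨e'.comp e, he'.comp he, fun x => (hp' _).trans (hp x), ?_⟩
        rw [M.res_comp, hm', hm] }

/-- The set of isomorphism classes of objects of `M-Gset/X`. -/
def Eff (X : FinGSet.{u} G) : Type (max (u + 1) v) := Quotient (objSetoid M X)

namespace Eff

variable {M}

/-- The isomorphism class of an object of `M-Gset/X`. -/
def mk (p : A →[G] X) (m : M.obj A) : Eff M X := Quotient.mk (objSetoid M X) ⟨A, p, m⟩

theorem mk_eq {p : A →[G] X} {m : M.obj A} {p' : B →[G] X} {m' : M.obj B} (e : A →[G] B)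
    (he : Function.Bijective e) (hp : ∀ x, p' (e x) = p x) (hm : M.res e m' = m) :
    mk p m = mk p' m' := Quotient.sound (s := objSetoid M X) ⟨e, he, hp, hm⟩

theorem ind {motive : Eff M X → Prop}
    (h : ∀ (A : FinGSet.{u} G) (p : A →[G] X) (m : M.obj A), motive (mk p m)) (a : Eff M X) :
    motive a := Quotient.inductionOn a fun a => h a.A a.p a.m

theorem pull_eq {Z : FinGSet.{u} G} {f : Y →[G] X} {p : A →[G] X} {p' : A' →[G] X}
    {π : P →[G] Y} {α : P →[G] A} {π' : Z →[G] Y} {α' : Z →[G] A'}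
    (h : FinGSet.IsPullback π α f p) (h' : FinGSet.IsPullback π' α' f p') (e : A →[G] A')
    (he : Function.Bijective e) (hp : ∀ a, p' (e a) = p a) :
    ∃ ε : P →[G] Z, Function.Bijective ε ∧ (∀ t, π' (ε t) = π t) ∧ ∀ t, α' (ε t) = e (α t) := by
  obtain ⟨ε, h₁, h₂⟩ := h'.lift π (e.comp α) fun t => (h.comm t).trans (hp _).symm
  refine ⟨ε, ⟨fun t t' k => ?_, fun t => ?_⟩, h₁, h₂⟩
  · refine h.ext ?_ (he.1 ?_)
    · rw [← h₁, k, h₁]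
    · exact (h₂ t).symm.trans ((congrArg α' k).trans (h₂ t'))
  · obtain ⟨a, ha⟩ := he.2 (α' t)
    obtain ⟨s, hs, hs'⟩ := h.exists_of (x := π' t) (y := a) ((h'.comm t).trans
      ((congrArg p' ha).symm.trans (hp a)))
    exact ⟨s, h'.ext ((h₁ s).trans hs) ((h₂ s).trans ((congrArg e hs').trans ha))⟩

/-- Restriction of classes along `f`: pullback along `f`. -/
def res (f : X →[G] Y) : Eff M Y → Eff M X :=
  Quotient.lift (s := objSetoid M Y) (fun a => mk (pullFst f a.p) (M.res (pullSnd f a.p) a.m)) <| by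
    rintro a b ⟨e, he, hp, hm⟩
    obtain ⟨ε, hε, h₁, h₂⟩ := pull_eq (isPullback_pull f a.p) (isPullback_pull f b.p) e he hp
    refine mk_eq ε hε h₁ ?_
    have k : (pullSnd f b.p).comp ε = e.comp (pullSnd f a.p) := by ext t; exact h₂ t
    rw [← M.res_comp, k, M.res_comp, hm]

theorem res_mk {f : X →[G] Y} {p : A →[G] Y} {π : P →[G] X} {α : P →[G] A}
    (h : FinGSet.IsPullback π α f p) (m : M.obj A) : res f (mk p m) = mk π (M.res α m) := by
  obtain ⟨ε, hε, h₁, h₂⟩ := pull_eq (isPullback_pull f p) h (MulActionHom.id G)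
    Function.bijective_id fun _ => rfl
  refine mk_eq ε hε h₁ ?_
  have k : α.comp ε = pullSnd f p := by ext t; exact h₂ t
  rw [← M.res_comp, k]

/-- Additive transfer of classes along `f`: composition with `f`. -/
def tr (f : X →[G] Y) : Eff M X → Eff M Y :=
  Quotient.lift (s := objSetoid M X) (fun a => mk (f.comp a.p) a.m) <| by
    rintro a b ⟨e, he, hp, hm⟩
    exact mk_eq e he (fun x => congrArg f (hp x)) hm

theorem tr_mk (f : X →[G] Y) (p : A →[G] X) (m : M.obj A) : tr f (mk p m) = mk (f.comp p) m := rfl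

theorem expo_eq {B' Z' : FinGSet.{u} G} {f : X →[G] Y} {p : A →[G] X} {p' : A' →[G] X}
    {lam : Z →[G] A} {rho : Z →[G] B} {q : B →[G] Y}
    {lam' : Z' →[G] A'} {rho' : Z' →[G] B'} {q' : B' →[G] Y}
    (h : IsExponential f p lam rho q) (h' : IsExponential f p' lam' rho' q')
    (e : A →[G] A') (he : Function.Bijective e) (hp : ∀ a, p' (e a) = p a) (m : M.obj A') :
    mk q (M.tr rho (M.res lam (M.res e m))) = mk q' (M.tr rho' (M.res lam' m)) := by
  obtain ⟨ε, ζ, hε, h₁, h₂, h₃⟩ := h.unique h' e he hp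
  refine mk_eq ε hε h₁ ?_
  have k : lam'.comp ζ = e.comp lam := by ext t; exact h₂ t
  rw [← M.mackey h₃, ← M.res_comp, k, M.res_comp]

/-- Multiplicative transfer of classes along `f`: the class of `(p : A → X, m)` is sent to the
class of `(q : B → Y, rho_* lam^* m)` for the exponential diagram of `f` and `p`. -/
def nm (f : X →[G] Y) : Eff M X → Eff M Y :=
  Quotient.lift (s := objSetoid M X)
    (fun a => mk (expoProj f a.p) (M.tr (expoFst f a.p) (M.res (expoEval f a.p) a.m))) <| by
    rintro a b ⟨e, he, hp, hm⟩
    have := expo_eq (isExponential_expo f a.p) (isExponential_expo f b.p) e he hp b.m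
    rwa [hm] at this

theorem nm_mk {f : X →[G] Y} {p : A →[G] X} {lam : Z →[G] A} {rho : Z →[G] B} {q : B →[G] Y}
    (h : IsExponential f p lam rho q) (m : M.obj A) :
    nm f (mk p m) = mk q (M.tr rho (M.res lam m)) := by
  have := expo_eq (isExponential_expo f p) h (MulActionHom.id G) Function.bijective_id
    (fun _ => rfl) m
  rwa [M.res_id] at this

/-- Sum of classes: disjoint union. -/
noncomputable def add : Eff M X → Eff M X → Eff M X :=
  Quotient.map₂ (sa := objSetoid M X) (sb := objSetoid M X) (sc := objSetoid M X)
    (fun a b => ⟨sum a.A b.A, desc a.p b.p, M.glue a.m b.m⟩) <| by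
    rintro a a' ⟨e, he, hp, hm⟩ b b' ⟨e', he', hp', hm'⟩
    refine ⟨desc ((inl _ _).comp e) ((inr _ _).comp e'), ?_, ?_, ?_⟩
    · have : ⇑(desc ((inl a'.A b'.A).comp e) ((inr a'.A b'.A).comp e')) = Sum.map e e' := by
        funext t; cases t <;> rfl
      rw [this]
      exact Sum.map_bijective.2 ⟨he, he'⟩
    · rintro (t | t)
      exacts [hp t, hp' t]
    · apply M.ext_of_isSum isSum_inl_inr
      · rw [← M.res_comp]
        refine (M.res_comp (inl a'.A b'.A) e _).trans ?_
        rw [M.res_inl_glue, M.res_inl_glue, hm]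
      · rw [← M.res_comp]
        refine (M.res_comp (inr a'.A b'.A) e' _).trans ?_
        rw [M.res_inr_glue, M.res_inr_glue, hm']

theorem add_mk {i : A →[G] C} {j : B →[G] C} (h : IsSum i j) (r : C →[G] X) (m : M.obj C) :
    add (mk (r.comp i) (M.res i m)) (mk (r.comp j) (M.res j m)) = mk r m := by
  refine mk_eq (desc i j) h ?_ ?_
  · rintro (t | t) <;> rfl
  · apply M.ext_of_isSum isSum_inl_inr
    · rw [← M.res_comp, M.res_inl_glue]; rfl
    · rw [← M.res_comp, M.res_inr_glue]; rfl

theorem add_mk' {p : A →[G] X} {m : M.obj A} {p' : B →[G] X} {m' : M.obj B}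
    {i : A →[G] C} {j : B →[G] C} (h : IsSum i j) (r : C →[G] X) (n : M.obj C)
    (h₁ : ∀ a, r (i a) = p a) (h₂ : ∀ b, r (j b) = p' b) (h₃ : M.res i n = m)
    (h₄ : M.res j n = m') : add (mk p m) (mk p' m') = mk r n := by
  have k₁ : r.comp i = p := by ext a; exact h₁ a
  have k₂ : r.comp j = p' := by ext a; exact h₂ a
  rw [← add_mk h, k₁, k₂, h₃, h₄]

theorem add_eq_glue (p : A →[G] X) (m : M.obj A) (p' : B →[G] X) (m' : M.obj B) :
    add (mk p m) (mk p' m') = mk (desc p p') (M.glue m m') := rfl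

/-- Product of classes: fibre product. -/
noncomputable def mul : Eff M X → Eff M X → Eff M X :=
  Quotient.map₂ (sa := objSetoid M X) (sb := objSetoid M X) (sc := objSetoid M X)
    (fun a b => ⟨pull a.p b.p, a.p.comp (pullFst a.p b.p),
      M.res (pullFst a.p b.p) a.m * M.res (pullSnd a.p b.p) b.m⟩) <| by
    rintro a a' ⟨e, he, hp, hm⟩ b b' ⟨e', he', hp', hm'⟩
    have hP : FinGSet.IsPullback (e.comp (pullFst a.p b.p)) (e'.comp (pullSnd a.p b.p)) a'.p b'.p := by
      refine FinGSet.IsPullback.mk' ?_ ?_ ?_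
      · exact fun t => (hp _).trans (t.2.trans (hp' _).symm)
      · exact fun t t' h h' => (isPullback_pull a.p b.p).ext (he.1 h) (he'.1 h')
      · intro x y hxy
        obtain ⟨x, rfl⟩ := he.2 x
        obtain ⟨y, rfl⟩ := he'.2 y
        exact ⟨⟨(x, y), (hp x).symm.trans (hxy.trans (hp' y))⟩, rfl, rfl⟩
    obtain ⟨ε, hε, h₁, h₂⟩ := pull_eq hP (isPullback_pull a'.p b'.p) (MulActionHom.id G)
      Function.bijective_id fun _ => rfl
    refine ⟨ε, hε, fun t => (congrArg a'.p (h₁ t)).trans (hp _), ?_⟩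
    have k₁ : (pullFst a'.p b'.p).comp ε = e.comp (pullFst a.p b.p) := by ext t; exact h₁ t
    have k₂ : (pullSnd a'.p b'.p).comp ε = e'.comp (pullSnd a.p b.p) := by ext t; exact h₂ t
    rw [map_mul, ← M.res_comp, ← M.res_comp, k₁, k₂, M.res_comp, M.res_comp, hm, hm']

theorem mul_mk {p : A →[G] X} {p' : B →[G] X} {α : P →[G] A} {β : P →[G] B}
    (h : FinGSet.IsPullback α β p p') (m : M.obj A) (m' : M.obj B) :
    mul (mk p m) (mk p' m') = mk (p.comp α) (M.res α m * M.res β m') := by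
  obtain ⟨ε, hε, h₁, h₂⟩ := pull_eq (isPullback_pull p p') h (MulActionHom.id G)
    Function.bijective_id fun _ => rfl
  refine mk_eq ε hε (fun t => congrArg p (h₁ t)) ?_
  have k₁ : α.comp ε = pullFst p p' := by ext t; exact h₁ t
  have k₂ : β.comp ε = pullSnd p p' := by ext t; exact h₂ t
  rw [map_mul, ← M.res_comp, ← M.res_comp, k₁, k₂]

/-- The class of the empty `G`-set. -/
def zero : Eff M X := mk (elim (X := empty) PEmpty.elim X) 1

theorem mk_eq_zero (hA : A → False) (p : A →[G] X) (m : M.obj A) : mk p m = zero := by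
  refine mk_eq (elim hA empty) ⟨fun a => (hA a).elim, fun a => PEmpty.elim a⟩
    (fun a => (hA a).elim) (M.subsingleton_of_empty hA _ _)

theorem isPullback_id_left (f : X →[G] Y) :
    FinGSet.IsPullback f (MulActionHom.id G) (MulActionHom.id G) f :=
  FinGSet.IsPullback.mk' (fun _ => rfl) (fun _ _ _ h => h) fun _ y h => ⟨y, h.symm, rfl⟩

theorem mul_comm' (a b : Eff M X) : mul a b = mul b a := by
  induction a using ind with | h A p m => ?_
  induction b using ind with | h B p' m' => ?_
  have h := isPullback_pull p p'
  rw [mul_mk h, mul_mk h.symm, mul_comm]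
  congr 1
  ext t; exact h.comm t

theorem left_distrib' (a b c : Eff M X) : mul a (add b c) = add (mul a b) (mul a c) := by
  induction a using ind with | h A p m => ?_
  induction b using ind with | h B p' m' => ?_
  induction c using ind with | h C p'' m'' => ?_
  have h := isPullback_pull p (desc p' p'')
  have h₁ := isPullback_pull p p'
  have h₂ := isPullback_pull p p''
  obtain ⟨i, i₁, i₂⟩ := h.lift (pullFst p p') ((inl B C).comp (pullSnd p p')) h₁.comm
  obtain ⟨j, j₁, j₂⟩ := h.lift (pullFst p p'') ((inr B C).comp (pullSnd p p'')) h₂.comm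
  rw [add_eq_glue, mul_mk h, mul_mk h₁, mul_mk h₂]
  symm
  refine add_mk' (i := i) (j := j) ⟨?_, ?_⟩ _ _ (fun t => congrArg p (i₁ t))
    (fun t => congrArg p (j₁ t)) ?_ ?_
  · rintro (t | t) (s | s) e
    · have e : i t = i s := e
      refine congrArg Sum.inl (h₁.ext ((i₁ t).symm.trans ((congrArg _ e).trans (i₁ s))) ?_)
      exact Sum.inl_injective ((i₂ t).symm.trans ((congrArg _ e).trans (i₂ s)))
    · have e : i t = j s := e
      cases (i₂ t).symm.trans ((congrArg _ e).trans (j₂ s))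
    · have e : j t = i s := e
      cases (j₂ t).symm.trans ((congrArg _ e).trans (i₂ s))
    · have e : j t = j s := e
      refine congrArg Sum.inr (h₂.ext ((j₁ t).symm.trans ((congrArg _ e).trans (j₁ s))) ?_)
      exact Sum.inr_injective ((j₂ t).symm.trans ((congrArg _ e).trans (j₂ s)))
  · intro t
    rcases e : pullSnd p (desc p' p'') t with b | b
    · obtain ⟨s, hs, hs'⟩ := h₁.exists_of (x := pullFst _ _ t) (y := b)
        ((h.comm t).trans (congrArg (desc p' p'') e))
      exact ⟨Sum.inl s, h.ext ((i₁ s).trans hs) ((i₂ s).trans ((congrArg _ hs').trans e.symm))⟩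
    · obtain ⟨s, hs, hs'⟩ := h₂.exists_of (x := pullFst _ _ t) (y := b)
        ((h.comm t).trans (congrArg (desc p' p'') e))
      exact ⟨Sum.inr s, h.ext ((j₁ s).trans hs) ((j₂ s).trans ((congrArg _ hs').trans e.symm))⟩
  · have e₁ : (pullFst p (desc p' p'')).comp i = pullFst p p' := by ext t; exact i₁ t
    have e₂ : (pullSnd p (desc p' p'')).comp i = (inl B C).comp (pullSnd p p') := by
      ext t; exact i₂ t
    rw [map_mul, ← M.res_comp, ← M.res_comp, e₁, e₂, M.res_comp (inl B C), res_inl_glue]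
  · have e₁ : (pullFst p (desc p' p'')).comp j = pullFst p p'' := by ext t; exact j₁ t
    have e₂ : (pullSnd p (desc p' p'')).comp j = (inr B C).comp (pullSnd p p'') := by
      ext t; exact j₂ t
    rw [map_mul, ← M.res_comp, ← M.res_comp, e₁, e₂, M.res_comp (inr B C), res_inr_glue]

noncomputable instance : Add (Eff M X) := ⟨add⟩
noncomputable instance : Mul (Eff M X) := ⟨mul⟩
instance : Zero (Eff M X) := ⟨zero⟩
instance : One (Eff M X) := ⟨mk (MulActionHom.id G) 1⟩

/-- The semiring of isomorphism classes of objects of `M-Gset/X`. -/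
noncomputable instance : CommSemiring (Eff M X) where
  nsmul := nsmulRec
  npow := npowRec
  add_assoc a b c := by
    induction a using ind with | h A p m => ?_
    induction b using ind with | h B p' m' => ?_
    induction c using ind with | h C p'' m'' => ?_
    change add (add _ _) _ = add _ (add _ _)
    rw [add_eq_glue, add_eq_glue, add_eq_glue]
    symm
    refine add_mk' (i := (inl (sum A B) C).comp (inl A B))
      (j := desc ((inl (sum A B) C).comp (inr A B)) (inr (sum A B) C)) ?_ _ _ ?_ ?_ ?_ ?_
    · constructor
      · rintro (a | b | c) (a' | b' | c') h <;> cases h <;> rfl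
      · rintro ((a | b) | c)
        exacts [⟨Sum.inl a, rfl⟩, ⟨Sum.inr (Sum.inl b), rfl⟩, ⟨Sum.inr (Sum.inr c), rfl⟩]
    · exact fun a => rfl
    · rintro (b | c) <;> rfl
    · rw [M.res_comp, res_inl_glue, res_inl_glue]
    · apply M.ext_of_isSum isSum_inl_inr
      · rw [← M.res_comp, res_inl_glue]
        refine (M.res_comp (inl (sum A B) C) (inr A B) _).trans ?_
        rw [res_inl_glue, res_inr_glue]
      · rw [← M.res_comp, res_inr_glue]
        exact M.res_inr_glue _ _
  add_comm a b := by
    induction a using ind with | h A p m => ?_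
    induction b using ind with | h B p' m' => ?_
    change add _ _ = add _ _
    rw [add_eq_glue p' m']
    refine add_mk' (i := inr B A) (j := inl B A) ?_ _ _ (fun _ => rfl) (fun _ => rfl)
      (M.res_inr_glue _ _) (M.res_inl_glue _ _)
    constructor
    · rintro (a | a) (b | b) h <;> cases h <;> rfl
    · rintro (a | a)
      exacts [⟨Sum.inr a, rfl⟩, ⟨Sum.inl a, rfl⟩]
  zero_add a := by
    induction a using ind with | h A p m => ?_
    refine add_mk' (i := elim PEmpty.elim A) (j := MulActionHom.id G) ?_ _ _
      (fun a => PEmpty.elim a) (fun _ => rfl) (M.subsingleton_of_empty PEmpty.elim _ _) (M.res_id m)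
    constructor
    · rintro (a | a) (b | b) h
      · exact PEmpty.elim a
      · exact PEmpty.elim a
      · exact PEmpty.elim b
      · exact congrArg Sum.inr h
    · exact fun a => ⟨Sum.inr a, rfl⟩
  add_zero a := by
    induction a using ind with | h A p m => ?_
    refine add_mk' (i := MulActionHom.id G) (j := elim PEmpty.elim A) ?_ _ _
      (fun _ => rfl) (fun a => PEmpty.elim a) (M.res_id m) (M.subsingleton_of_empty PEmpty.elim _ _)
    constructor
    · rintro (a | a) (b | b) h
      · exact congrArg Sum.inl h
      · exact PEmpty.elim b
      · exact PEmpty.elim a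
      · exact PEmpty.elim a
    · exact fun a => ⟨Sum.inl a, rfl⟩
  mul_comm := mul_comm'
  mul_assoc a b c := by
    induction a using ind with | h A p m => ?_
    induction b using ind with | h B p' m' => ?_
    induction c using ind with | h C p'' m'' => ?_
    change mul (mul _ _) _ = mul _ (mul _ _)
    have h := isPullback_pull p p'
    have h₂ := isPullback_pull p' p''
    have h₁ := isPullback_pull (p.comp (pullFst p p')) p''
    obtain ⟨ε, k₁, k₂⟩ := h₂.lift ((pullSnd p p').comp
      (pullFst (p.comp (pullFst p p')) p'')) (pullSnd (p.comp (pullFst p p')) p'') fun t =>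
        (h.comm _).symm.trans (h₁.comm t)
    have h₃ : FinGSet.IsPullback ((pullFst p p').comp (pullFst (p.comp (pullFst p p')) p'')) ε p
        (p'.comp (pullFst p' p'')) := by
      refine FinGSet.IsPullback.mk' ?_ ?_ ?_
      · exact fun t => (h.comm _).trans (congrArg p' (k₁ t)).symm
      · intro t t' e e'
        refine h₁.ext (h.ext e ?_) ?_
        · exact (k₁ t).symm.trans ((congrArg _ e').trans (k₁ t'))
        · exact (k₂ t).symm.trans ((congrArg _ e').trans (k₂ t'))
      · intro x y e
        obtain ⟨t, ht, ht'⟩ := h.exists_of (x := x) (y := pullFst p' p'' y) e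
        obtain ⟨s, hs, hs'⟩ := h₁.exists_of (x := t) (y := pullSnd p' p'' y)
          ((h.comm t).trans ((congrArg p' ht').trans (h₂.comm y)))
        refine ⟨s, (congrArg _ hs).trans ht, h₂.ext ?_ ?_⟩
        · exact (k₁ s).trans ((congrArg _ hs).trans ht')
        · exact (k₂ s).trans hs'
    rw [mul_mk h, mul_mk h₁, mul_mk h₂, mul_mk h₃, map_mul, map_mul, ← M.res_comp, ← M.res_comp,
      ← M.res_comp, ← M.res_comp, mul_assoc]
    have e₁ : (pullFst p' p'').comp ε = (pullSnd p p').comp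
      (pullFst (p.comp (pullFst p p')) p'') := by ext t; exact k₁ t
    have e₂ : (pullSnd p' p'').comp ε = pullSnd (p.comp (pullFst p p')) p'' := by
      ext t; exact k₂ t
    rw [e₁, e₂]
    rfl
  one_mul a := by
    induction a using ind with | h A p m => ?_
    change mul (mk (MulActionHom.id G) 1) _ = _
    rw [mul_mk (isPullback_id_left p), map_one, one_mul, M.res_id]
    rfl
  mul_one a := by
    induction a using ind with | h A p m => ?_
    change mul _ (mk (MulActionHom.id G) 1) = _
    rw [mul_mk (isPullback_id_left p).symm, map_one, mul_one, M.res_id]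
    rfl
  zero_mul a := by
    induction a using ind with | h A p m => ?_
    exact (mul_mk (isPullback_pull _ _) _ _).trans (mk_eq_zero (fun t => PEmpty.elim (pullFst (elim (X := empty) PEmpty.elim X) p t)) _ _)
  mul_zero a := by
    induction a using ind with | h A p m => ?_
    exact (mul_mk (isPullback_pull _ _) _ _).trans (mk_eq_zero (fun t => PEmpty.elim (pullSnd p (elim (X := empty) PEmpty.elim X) t)) _ _)
  left_distrib := left_distrib'
  right_distrib a b c := by
    change mul (add a b) c = add (mul a c) (mul b c)
    rw [mul_comm', left_distrib', mul_comm' c, mul_comm' c]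

end Eff

end SemiMackey

namespace FinGSet.IsPullback

variable {G : Type u} [Group G] {X Y Z A B P Q : FinGSet.{u} G}

theorem paste {f : X →[G] Y} {g : Y →[G] Z} {p : A →[G] Z} {π : P →[G] Y} {α : P →[G] A}
    {π' : Q →[G] X} {β : Q →[G] P} (h : FinGSet.IsPullback π α g p)
    (h' : FinGSet.IsPullback π' β f π) : FinGSet.IsPullback π' (α.comp β) (g.comp f) p := by
  refine FinGSet.IsPullback.mk' ?_ ?_ ?_
  · exact fun t => (congrArg g (h'.comm t)).trans (h.comm (β t))
  · intro t t' e e'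
    refine h'.ext e (h.ext ?_ e')
    exact (h'.comm t).symm.trans ((congrArg f e).trans (h'.comm t'))
  · intro x a e
    obtain ⟨s, hs, rfl⟩ := h.exists_of (x := f x) (y := a) e
    obtain ⟨t, ht, rfl⟩ := h'.exists_of hs.symm
    exact ⟨t, ht, rfl⟩

end FinGSet.IsPullback

namespace SemiMackey

variable {G : Type u} [Group G]

namespace Eff

variable {M : SemiMackey.{u, v} G} {X Y Z A B C P A' B' W X' Y' : FinGSet.{u} G}

theorem mk_add_mk (p : A →[G] X) (m : M.obj A) (p' : B →[G] X) (m' : M.obj B) :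
    mk p m + mk p' m' = mk (desc p p') (M.glue m m') := rfl

theorem mk_mul_mk {p : A →[G] X} {p' : B →[G] X} {α : P →[G] A} {β : P →[G] B}
    (h : FinGSet.IsPullback α β p p') (m : M.obj A) (m' : M.obj B) :
    mk p m * mk p' m' = mk (p.comp α) (M.res α m * M.res β m') := mul_mk h m m'

theorem one_def : (1 : Eff M X) = mk (MulActionHom.id G) 1 := rfl

theorem eq_zero_of_empty (hX : X → False) (a : Eff M X) : a = 0 := by
  induction a using ind with | h A p m => ?_
  exact mk_eq_zero (fun a => hX (p a)) p m

/-- Restriction, as a ring homomorphism. -/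
noncomputable def resHom (f : X →[G] Y) : Eff M Y →+* Eff M X where
  toFun := res f
  map_one' := by
    rw [one_def, res_mk (isPullback_id_left f).symm, map_one]; rfl
  map_zero' := (res_mk (isPullback_pull f _) _).trans <| mk_eq_zero
    (fun t => PEmpty.elim (pullSnd f (elim (X := empty) PEmpty.elim Y) t)) _ _
  map_add' a b := by
    induction a using ind with | h A p m => ?_
    induction b using ind with | h B p' m' => ?_
    have h := isPullback_pull f (desc p p')
    have h₁ := isPullback_pull f p
    have h₂ := isPullback_pull f p'
    obtain ⟨i, i₁, i₂⟩ := h.lift (pullFst f p) ((inl A B).comp (pullSnd f p)) h₁.comm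
    obtain ⟨j, j₁, j₂⟩ := h.lift (pullFst f p') ((inr A B).comp (pullSnd f p')) h₂.comm
    rw [mk_add_mk, res_mk h, res_mk h₁, res_mk h₂]
    symm
    refine add_mk' (i := i) (j := j) ⟨?_, ?_⟩ _ _ i₁ j₁ ?_ ?_
    · rintro (t | t) (s | s) e
      · have e : i t = i s := e
        refine congrArg Sum.inl (h₁.ext ((i₁ t).symm.trans ((congrArg _ e).trans (i₁ s))) ?_)
        exact Sum.inl_injective ((i₂ t).symm.trans ((congrArg _ e).trans (i₂ s)))
      · have e : i t = j s := e
        cases (i₂ t).symm.trans ((congrArg _ e).trans (j₂ s))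
      · have e : j t = i s := e
        cases (j₂ t).symm.trans ((congrArg _ e).trans (i₂ s))
      · have e : j t = j s := e
        refine congrArg Sum.inr (h₂.ext ((j₁ t).symm.trans ((congrArg _ e).trans (j₁ s))) ?_)
        exact Sum.inr_injective ((j₂ t).symm.trans ((congrArg _ e).trans (j₂ s)))
    · intro t
      rcases e : pullSnd f (desc p p') t with b | b
      · obtain ⟨s, hs, hs'⟩ := h₁.exists_of (x := pullFst _ _ t) (y := b)
          ((h.comm t).trans (congrArg (desc p p') e))
        exact ⟨Sum.inl s, h.ext ((i₁ s).trans hs) ((i₂ s).trans ((congrArg _ hs').trans e.symm))⟩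
      · obtain ⟨s, hs, hs'⟩ := h₂.exists_of (x := pullFst _ _ t) (y := b)
          ((h.comm t).trans (congrArg (desc p p') e))
        exact ⟨Sum.inr s, h.ext ((j₁ s).trans hs) ((j₂ s).trans ((congrArg _ hs').trans e.symm))⟩
    · have e₂ : (pullSnd f (desc p p')).comp i = (inl A B).comp (pullSnd f p) := by
        ext t; exact i₂ t
      rw [← M.res_comp, e₂, M.res_comp (inl A B), res_inl_glue]
    · have e₂ : (pullSnd f (desc p p')).comp j = (inr A B).comp (pullSnd f p') := by
        ext t; exact j₂ t
      rw [← M.res_comp, e₂, M.res_comp (inr A B), res_inr_glue]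
  map_mul' a b := by
    induction a using ind with | h A p m => ?_
    induction b using ind with | h B p' m' => ?_
    have h := isPullback_pull p p'
    have h₁ := isPullback_pull f p
    have h₂ := isPullback_pull f p'
    have h₃ := isPullback_pull f (p.comp (pullFst p p'))
    obtain ⟨i, i₁, i₂⟩ := h₁.lift _ ((pullFst p p').comp (pullSnd f (p.comp (pullFst p p'))))
      h₃.comm
    obtain ⟨j, j₁, j₂⟩ := h₂.lift (pullFst f (p.comp (pullFst p p')))
      ((pullSnd p p').comp (pullSnd f (p.comp (pullFst p p'))))
      fun t => (h₃.comm t).trans (h.comm _)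
    have h₄ : FinGSet.IsPullback i j (pullFst f p) (pullFst f p') := by
      refine FinGSet.IsPullback.mk' (fun t => (i₁ t).trans (j₁ t).symm) ?_ ?_
      · intro t t' e e'
        refine h₃.ext ?_ (h.ext ?_ ?_)
        · exact (i₁ t).symm.trans ((congrArg _ e).trans (i₁ t'))
        · exact (i₂ t).symm.trans ((congrArg _ e).trans (i₂ t'))
        · exact (j₂ t).symm.trans ((congrArg _ e').trans (j₂ t'))
      · intro x y e
        obtain ⟨s, hs, hs'⟩ := h.exists_of (x := pullSnd f p x) (y := pullSnd f p' y)
          ((h₁.comm x).symm.trans ((congrArg f e).trans (h₂.comm y)))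
        obtain ⟨t, ht, ht'⟩ := h₃.exists_of (x := pullFst f p x) (y := s)
          ((h₁.comm x).trans (congrArg p hs.symm))
        refine ⟨t, h₁.ext ((i₁ t).trans ht) ((i₂ t).trans ?_),
          h₂.ext ((j₁ t).trans (ht.trans e)) ((j₂ t).trans ?_)⟩
        · exact (congrArg (pullFst p p') ht').trans hs
        · exact (congrArg (pullSnd p p') ht').trans hs'
    rw [mk_mul_mk h, res_mk h₃, res_mk h₁, res_mk h₂, mk_mul_mk h₄, map_mul]
    simp only [← M.res_comp]
    have e₁ : (pullFst f p).comp i = pullFst f (p.comp (pullFst p p')) := by ext t; exact i₁ t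
    have e₂ : (pullSnd f p).comp i = (pullFst p p').comp (pullSnd f (p.comp (pullFst p p'))) := by
      ext t; exact i₂ t
    have e₃ : (pullSnd f p').comp j = (pullSnd p p').comp (pullSnd f (p.comp (pullFst p p'))) := by
      ext t; exact j₂ t
    rw [e₁, e₂, e₃]

/-- Additive transfer, as an additive map. -/
noncomputable def trHom (f : X →[G] Y) : Eff M X →+ Eff M Y where
  toFun := tr f
  map_zero' := mk_eq_zero PEmpty.elim _ _
  map_add' a b := by
    induction a using ind with | h A p m => ?_
    induction b using ind with | h B p' m' => ?_
    rw [mk_add_mk, tr_mk, tr_mk, tr_mk, mk_add_mk]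
    congr 1
    ext t
    rcases t with t | t <;> rfl

/-- Multiplicative transfer, as a multiplicative map. -/
noncomputable def nmHom (f : X →[G] Y) : Eff M X →* Eff M Y where
  toFun := nm f
  map_one' := by
    rw [one_def, nm_mk (IsExponential.of_id f), map_one, map_one]; rfl
  map_mul' a b := by
    induction a using ind with | h A p m => ?_
    induction b using ind with | h A' p' m' => ?_
    have h := isExponential_expo f p
    have h' := isExponential_expo f p'
    have hP := isPullback_pull p p'
    have hC := isPullback_pull (expoProj f p) (expoProj f p')
    set β := pullFst (expoProj f p) (expoProj f p')
    set β' := pullSnd (expoProj f p) (expoProj f p')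
    have hZ := isPullback_pull β (expoFst f p)
    set σ := pullFst β (expoFst f p)
    set ζ := pullSnd β (expoFst f p)
    have c₁ : ∀ t, f (p (expoEval f p (ζ t))) = expoProj f p' (β' (σ t)) := fun t =>
      (h.isPullback.comm (ζ t)).trans ((congrArg (expoProj f p) (hZ.comm t)).symm.trans
        (hC.comm (σ t)))
    obtain ⟨ζ', k₁, k₂⟩ := h'.isPullback.lift ((p.comp (expoEval f p)).comp ζ) (β'.comp σ) c₁
    obtain ⟨μ, l₁, l₂⟩ := hP.lift ((expoEval f p).comp ζ) ((expoEval f p').comp ζ')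
      fun t => (k₁ t).symm
    have hZ' : FinGSet.IsPullback σ ζ' β' (expoFst f p') := by
      refine FinGSet.IsPullback.mk' (fun t => (k₂ t).symm) ?_ ?_
      · intro t t' e e'
        refine hZ.ext e (h.isPullback.ext ?_ ?_)
        · exact (k₁ t).symm.trans ((congrArg (fun z => p' (expoEval f p' z)) e').trans (k₁ t'))
        · exact (hZ.comm t).symm.trans ((congrArg β e).trans (hZ.comm t'))
      · intro c z e
        obtain ⟨z₁, hz₁, hz₁'⟩ := h.isPullback.exists_of (x := p' (expoEval f p' z)) (y := β c)
          ((h'.isPullback.comm z).trans ((congrArg (expoProj f p') e).symm.trans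
            (hC.comm c).symm))
        obtain ⟨t, ht, rfl⟩ := hZ.exists_of hz₁'.symm
        refine ⟨t, ht, h'.isPullback.ext ((k₁ t).trans hz₁) ((k₂ t).trans ?_)⟩
        exact (congrArg β' ht).trans e
    have hE := h.mul h' hP hC hZ hZ' l₁ l₂
    rw [mk_mul_mk hP, nm_mk hE, nm_mk h, nm_mk h', mk_mul_mk hC, map_mul, map_mul]
    rw [← M.mackey hZ, ← M.mackey hZ']
    simp only [← M.res_comp]
    have e₁ : (pullFst p p').comp μ = (expoEval f p).comp ζ := by ext t; exact l₁ t
    have e₂ : (pullSnd p p').comp μ = (expoEval f p').comp ζ' := by ext t; exact l₂ t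
    rw [e₁, e₂]

theorem res_comp (g : Y →[G] Z) (f : X →[G] Y) (a : Eff M Z) :
    res (g.comp f) a = res f (res g a) := by
  induction a using ind with | h A p m => ?_
  have h := isPullback_pull g p
  have h' := isPullback_pull f (pullFst g p)
  rw [res_mk h, res_mk h', res_mk (h.paste h'), M.res_comp]

theorem nm_comp (g : Y →[G] Z) (f : X →[G] Y) (a : Eff M X) :
    nm (g.comp f) a = nm g (nm f a) := by
  induction a using ind with | h A p m => ?_
  have h := isExponential_expo f p
  have h' := isExponential_expo g (expoProj f p)
  have hP := isPullback_pull (expoFst f p) (expoEval g (expoProj f p))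
  rw [nm_mk h, nm_mk h', nm_mk (h.comp h' hP), ← M.mackey hP.symm, M.res_comp, M.tr_comp]

theorem mackey_tr {ξ : X' →[G] X} {f' : X' →[G] Y'} {f : X →[G] Y} {η : Y' →[G] Y}
    (h : FinGSet.IsPullback ξ f' f η) (a : Eff M Y') : tr ξ (res f' a) = res f (tr η a) := by
  induction a using ind with | h A p m => ?_
  have h' := isPullback_pull f' p
  have h₂ := h.symm.paste h'.symm
  rw [tr_mk, res_mk h', tr_mk, res_mk h₂.symm]

theorem mackey_nm {ξ : X' →[G] X} {f' : X' →[G] Y'} {f : X →[G] Y} {η : Y' →[G] Y}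
    (hX : FinGSet.IsPullback ξ f' f η) (a : Eff M Y') : nm ξ (res f' a) = res f (nm η a) := by
  induction a using ind with | h A p m => ?_
  have h := isExponential_expo η p
  have hA := isPullback_pull f' p
  have hB := isPullback_pull f (expoProj η p)
  set x := pullFst f (expoProj η p)
  set b' := pullSnd f (expoProj η p)
  have hZ := isPullback_pull b' (expoFst η p)
  set rho' := pullFst b' (expoFst η p)
  set z' := pullSnd b' (expoFst η p)
  obtain ⟨κ, k₁, k₂⟩ := hX.lift (x.comp rho') ((p.comp (expoEval η p)).comp z') fun t =>
    (hB.comm (rho' t)).trans ((congrArg (expoProj η p) (hZ.comm t)).trans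
      (h.isPullback.comm (z' t)).symm)
  obtain ⟨lam', l₁, l₂⟩ := hA.lift κ ((expoEval η p).comp z') k₂
  have hE := h.baseChange hX hA hB hZ (fun t => (congrArg ξ (l₁ t)).trans (k₁ t)) l₂
  rw [res_mk hA, nm_mk hE, nm_mk h, res_mk hB, ← M.mackey hZ]
  simp only [← M.res_comp]
  have e : (pullSnd f' p).comp lam' = (expoEval η p).comp z' := by ext t; exact l₂ t
  rw [e]

theorem distrib {f : X →[G] Y} {p : A →[G] X} {lam : Z →[G] A} {rho : Z →[G] B} {q : B →[G] Y}
    (h : IsExponential f p lam rho q) (a : Eff M A) :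
    nm f (tr p a) = tr q (nm rho (res lam a)) := by
  induction a using ind with | h C r m => ?_
  have hP := isPullback_pull lam r
  have h' := isExponential_expo rho (pullFst lam r)
  rw [tr_mk, nm_mk (h.distrib hP h'), res_mk hP, nm_mk h', tr_mk, M.res_comp]

theorem res_tr_self {i : X →[G] Y} (hi : Function.Injective i) (a : Eff M X) :
    res i (tr i a) = a := by
  have : FinGSet.IsPullback (MulActionHom.id G) (MulActionHom.id G) i i :=
    FinGSet.IsPullback.mk' (fun _ => rfl) (fun _ _ h _ => h) fun x y e => ⟨x, rfl, hi e⟩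
  rw [← mackey_tr this]
  induction a using ind with | h A p m => ?_
  rw [res_mk (isPullback_id_left p), M.res_id]
  rfl

theorem res_tr_disjoint {i : A →[G] X} {j : B →[G] X} (h : ∀ a b, i a ≠ j b) (a : Eff M B) :
    res i (tr j a) = 0 := by
  have : FinGSet.IsPullback (elim (X := empty) PEmpty.elim A) (elim PEmpty.elim B) i j :=
    FinGSet.IsPullback.mk' (fun a => PEmpty.elim a) (fun a => PEmpty.elim a)
      fun x y e => (h x y e).elim
  rw [← mackey_tr this, eq_zero_of_empty PEmpty.elim (res _ a)]
  exact map_zero (trHom _)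

theorem decomp (a : Eff M (sum X Y)) :
    tr (inl X Y) (res (inl X Y) a) + tr (inr X Y) (res (inr X Y) a) = a := by
  induction a using ind with | h A p m => ?_
  have h₁ := isPullback_pull (inl X Y) p
  have h₂ := isPullback_pull (inr X Y) p
  rw [res_mk h₁, res_mk h₂, tr_mk, tr_mk]
  refine add_mk' (i := pullSnd (inl X Y) p) (j := pullSnd (inr X Y) p) ⟨?_, ?_⟩ p m
    (fun t => (h₁.comm t).symm) (fun t => (h₂.comm t).symm) rfl rfl
  · rintro (t | t) (s | s) e
    · refine congrArg Sum.inl (h₁.ext (Sum.inl_injective (β := Y) ?_) e)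
      exact (h₁.comm t).trans ((congrArg p e).trans (h₁.comm s).symm)
    · cases (h₁.comm t).trans ((congrArg p e).trans (h₂.comm s).symm)
    · cases (h₂.comm t).trans ((congrArg p e).trans (h₁.comm s).symm)
    · refine congrArg Sum.inr (h₂.ext (Sum.inr_injective (α := X) ?_) e)
      exact (h₂.comm t).trans ((congrArg p e).trans (h₂.comm s).symm)
  · intro a
    rcases e : p a with x | y
    · obtain ⟨t, -, ht⟩ := h₁.exists_of (x := x) (y := a) e.symm
      exact ⟨Sum.inl t, ht⟩
    · obtain ⟨t, -, ht⟩ := h₂.exists_of (x := y) (y := a) e.symm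
      exact ⟨Sum.inr t, ht⟩

end Eff

/-- The semi-Tambara functor `X ↦` isomorphism classes of objects of `M-Gset/X`. -/
noncomputable def effective (M : SemiMackey.{u, v} G) : SemiTambara.{u, max (u + 1) v} G where
  obj X := Eff M X
  res f := Eff.resHom f
  tr f := Eff.trHom f
  nm f := Eff.nmHom f
  res_id a := by
    induction a using Eff.ind with | h A p m => ?_
    refine (Eff.res_mk (Eff.isPullback_id_left p) m).trans ?_
    rw [M.res_id]
  res_comp g f a := Eff.res_comp g f a
  tr_id a := by
    induction a using Eff.ind with | h A p m => ?_
    rfl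
  tr_comp g f a := by
    induction a using Eff.ind with | h A p m => ?_
    rfl
  nm_id a := by
    induction a using Eff.ind with | h A p m => ?_
    refine (Eff.nm_mk (IsExponential.id_left p) m).trans ?_
    rw [M.res_id, M.tr_id]
  nm_comp g f a := Eff.nm_comp g f a
  additive X Y := by
    constructor
    · intro a b h
      have h₁ : Eff.res (inl X Y) a = Eff.res (inl X Y) b := congrArg Prod.fst h
      have h₂ : Eff.res (inr X Y) a = Eff.res (inr X Y) b := congrArg Prod.snd h
      rw [← Eff.decomp a, ← Eff.decomp b, h₁, h₂]
    · rintro ⟨a, b⟩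
      refine ⟨Eff.trHom (inl X Y) a + Eff.trHom (inr X Y) b, Prod.ext ?_ ?_⟩
      · refine (map_add (Eff.resHom (inl X Y)) _ _).trans ?_
        refine (congrArg₂ (· + ·) (Eff.res_tr_self isSum_inl_inr.inl_inj a)
          (Eff.res_tr_disjoint isSum_inl_inr.ne b)).trans (add_zero a)
      · refine (map_add (Eff.resHom (inr X Y)) _ _).trans ?_
        refine (congrArg₂ (· + ·) (Eff.res_tr_disjoint (fun a b => (isSum_inl_inr.ne b a).symm) a)
          (Eff.res_tr_self isSum_inl_inr.inr_inj b)).trans (zero_add b)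
  mackey_tr h a := Eff.mackey_tr h a
  mackey_nm h a := Eff.mackey_nm h a
  distrib h a := Eff.distrib h a

end SemiMackey

namespace SemiTambara

variable {G : Type u} [Group G]

/-- The identity morphism. -/
def Hom.id (T : SemiTambara.{u, v} G) : Hom T T where
  app X := RingHom.id (T.obj X)
  app_res _ _ := rfl
  app_tr _ _ := rfl
  app_nm _ _ := rfl

/-- Composition of morphisms. -/
def Hom.comp {T U V : SemiTambara.{u, v} G} (φ : Hom T U) (ψ : Hom U V) : Hom T V where
  app X := (ψ.app X).comp (φ.app X)
  app_res f t := (congrArg (ψ.app _) (φ.app_res f t)).trans (ψ.app_res f _)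
  app_tr f t := (congrArg (ψ.app _) (φ.app_tr f t)).trans (ψ.app_tr f _)
  app_nm f t := (congrArg (ψ.app _) (φ.app_nm f t)).trans (ψ.app_nm f _)

end SemiTambara

namespace Tambara

variable {G : Type u} [Group G]

/-- The category of Tambara functors on `G`. -/
instance : CategoryTheory.Category (Tambara.{u, v} G) where
  Hom T U := SemiTambara.Hom T.toSemiTambara U.toSemiTambara
  id T := SemiTambara.Hom.id T.toSemiTambara
  comp φ ψ := SemiTambara.Hom.comp φ ψ

/-- The multiplicative part of a Tambara functor. -/
abbrev mul (T : Tambara.{u, v} G) : SemiMackey.{u, v} G := T.toSemiTambara.mul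

/-- The fraction `S⁻¹T` of a Tambara functor by a semi-Mackey subfunctor `S` of its multiplicative
part. -/
noncomputable def loc (T : Tambara.{u, v} G) (S : T.mul.Sub) : Tambara.{u, v} G where
  toSemiTambara := T.toSemiTambara.loc S
  exists_neg X t := by
    change ∃ t' : Localization (S.carrier X), (show Localization (S.carrier X) from t) + t' = 0
    induction t using Localization.induction_on with | H t => ?_
    obtain ⟨x', hx'⟩ := T.exists_neg X t.1
    refine ⟨Localization.mk x' t.2, ?_⟩
    rw [Localization.add_mk_self, hx', Localization.mk_zero]

/-- The morphism `T → S⁻¹T`. -/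
noncomputable def toLoc (T : Tambara.{u, v} G) (S : T.mul.Sub) :
    Quiver.Hom T (T.loc S) := T.toSemiTambara.toLoc S

/-- The morphism `S⁻¹T → S'⁻¹U` induced by a morphism `φ : T → U` with `φ(S) ⊆ S'`. -/
noncomputable def locMap {T U : Tambara.{u, v} G} (φ : Quiver.Hom T U) (S : T.mul.Sub)
    (S' : U.mul.Sub) (h : ∀ X, ∀ s ∈ S.carrier X, φ.app X s ∈ S'.carrier X) :
    Quiver.Hom (T.loc S) (U.loc S') := SemiTambara.Hom.loc φ S S' h

end Tambara

namespace SemiMackey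

variable {G : Type u} [Group G]

namespace Eff

variable {M N : SemiMackey.{u, v} G} {X Y A B : FinGSet.{u} G}

/-- The map `[A → X, m] ↦ [A → X, θ m]` induced by a morphism `θ`. -/
def map (θ : Hom M N) : Eff M X → Eff N X :=
  Quotient.map (sa := objSetoid M X) (sb := objSetoid N X) (fun a => ⟨a.A, a.p, θ.app a.A a.m⟩) <| by
    rintro a b ⟨e, he, hp, hm⟩
    exact ⟨e, he, hp, (θ.app_res e b.m).symm.trans (congrArg (θ.app a.A) hm)⟩

theorem map_mk (θ : Hom M N) (p : A →[G] X) (m : M.obj A) :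
    map θ (mk p m) = mk p (θ.app A m) := rfl

/-- The induced map, as a ring homomorphism. -/
noncomputable def mapHom (θ : Hom M N) : Eff M X →+* Eff N X where
  toFun := map θ
  map_one' := by
    rw [one_def, one_def, map_mk, map_one]
  map_zero' := mk_eq_zero PEmpty.elim _ _
  map_add' := fun a b => by
    induction a using ind with | h A p m => ?_
    induction b using ind with | h B p' m' => ?_
    rw [mk_add_mk, map_mk, map_mk, map_mk, mk_add_mk]
    congr 1
    apply N.ext_of_isSum isSum_inl_inr
    · rw [← θ.app_res, M.res_inl_glue, N.res_inl_glue]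
    · rw [← θ.app_res, M.res_inr_glue, N.res_inr_glue]
  map_mul' := fun a b => by
    induction a using ind with | h A p m => ?_
    induction b using ind with | h B p' m' => ?_
    have h := isPullback_pull p p'
    rw [mk_mul_mk h, map_mk, map_mk, map_mk, mk_mul_mk h, map_mul,
      θ.app_res, θ.app_res]

theorem map_res (θ : Hom M N) (f : X →[G] Y) (a : Eff M Y) :
    map θ (res f a) = res f (map θ a) := by
  induction a using ind with | h A p m => ?_
  have h := isPullback_pull f p
  rw [res_mk h, map_mk, map_mk, res_mk h, θ.app_res]

theorem map_nm (θ : Hom M N) (f : X →[G] Y) (a : Eff M X) :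
    map θ (nm f a) = nm f (map θ a) := by
  induction a using ind with | h A p m => ?_
  have h := isExponential_expo f p
  rw [nm_mk h, map_mk, map_mk, nm_mk h, θ.app_tr, θ.app_res]

theorem mk_id_mul (m n : M.obj X) : (mk (MulActionHom.id G) (m * n) : Eff M X) =
    mk (MulActionHom.id G) m * mk (MulActionHom.id G) n := by
  rw [mk_mul_mk (isPullback_id_left (MulActionHom.id G)), M.res_id, M.res_id]
  rfl

end Eff

/-- The morphism `[A → X, m] ↦ [A → X, θ m]` induced by a morphism `θ`. -/
noncomputable def effectiveMap {M N : SemiMackey.{u, v} G} (θ : Hom M N) :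
    SemiTambara.Hom M.effective N.effective where
  app _ := Eff.mapHom θ
  app_res f a := Eff.map_res θ f a
  app_tr f a := by
    induction a using Eff.ind with | h A p m => ?_
    rfl
  app_nm f a := Eff.map_nm θ f a

/-- The Tambarization `Ω[M]`, with `Ω[M](X)` the Grothendieck ring of `M-Gset/X`. -/
noncomputable def tambarization (M : SemiMackey.{u, v} G) : Tambara.{u, max (u + 1) v} G :=
  M.effective.completion

/-- The morphism `Ω[θ] : Ω[M] → Ω[N]` induced by `θ : M → N`. -/
noncomputable def tambarizationMap {M N : SemiMackey.{u, v} G} (θ : Hom M N) :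
    Quiver.Hom M.tambarization N.tambarization :=
  SemiTambara.Hom.completion (effectiveMap θ)

/-- The morphism `ε` from `M` to the multiplicative part of `Ω[M]`, `m ↦ [id : X → X, m]`. -/
noncomputable def unit (M : SemiMackey.{u, v} G) : Hom M M.tambarization.mul where
  app X :=
    { toFun := fun m => (GrothRing.of (Eff.mk (MulActionHom.id G) m : Eff M X))
      map_one' := rfl
      map_mul' := fun m n => by
        refine Eq.trans (congrArg GrothRing.of (Eff.mk_id_mul m n)) (GrothRing.of_mul _ _) }
  app_res f m := by
    refine Eq.trans (congrArg GrothRing.of ?_) (GrothRing.mapRing_of _ _).symm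
    exact (Eff.res_mk (Eff.isPullback_id_left f).symm m).symm
  app_tr f m := by
    refine Eq.trans (congrArg GrothRing.of ?_) (M.effective.grothNm_of _ _).symm
    refine Eq.trans ?_ (Eff.nm_mk (IsExponential.of_id f) m).symm
    rw [M.res_id]

theorem tambarizationMap_unit {M N : SemiMackey.{u, v} G} (θ : Hom M N) {X : FinGSet.{u} G}
    (m : M.obj X) : (tambarizationMap θ).app X (M.unit.app X m) = N.unit.app X (θ.app X m) :=
  GrothRing.mapRing_of _ _

theorem tambarizationMap_mem {M N : SemiMackey.{u, v} G} (θ : Hom M N) (S : M.Sub) (S' : N.Sub)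
    (h : ∀ X, ∀ s ∈ S.carrier X, θ.app X s ∈ S'.carrier X) (X : FinGSet.{u} G)
    (s : M.tambarization.mul.obj X) (hs : s ∈ (S.map M.unit).carrier X) :
    (tambarizationMap θ).app X s ∈ (S'.map N.unit).carrier X := by
  obtain ⟨m, hm, rfl⟩ := hs
  exact ⟨θ.app X m, h X m hm, (tambarizationMap_unit θ m).symm⟩

end SemiMackey

/-! The comparison map comes from a universal property, and its bijectivity from the fact that
denominators living on a $G$-set $A$ over $X$ can be replaced by denominators living on $X$.

Write $\ell\colon M\to\mathcal S^{-1}M$ for the canonical morphism. Since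
$\Omega[\ell]\varepsilon(s)=\varepsilon(s/1)$ and $s/1$ is invertible, $\Omega[\ell]$ sends
$\varepsilon(\mathcal S)$ to units. A morphism of semi-Tambara functors sending a multiplicative
subfunctor to units extends to the fraction (`locLift`). Only the additive transfer needs an
argument there, and it is the projection formula. This gives $\Phi$ together with its compatibility
with the maps from $\Omega[M]$. The extension is unique (`loc_hom_ext`), so naturality need only be
checked after precomposing with $\Omega[M]\to\mathcal S^{-1}(\Omega[M])$, where it is $\Omega$
applied to a square of semi-Mackey functors.

What remains is bijectivity at each $X$. Two facts carry it. First,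
$\varepsilon(k)\cdot[p,m]=[p,p^*(k)m]$ for $p\colon A\to X$ (`Eff.mk_id_mul_mk`). Second, for
$s\in\mathcal S(A)$ the element $p_*(s)$ lies in $\mathcal S(X)$ and $p^*p_*(s)=ws$ is a multiple of
$s$. So multiplication by $\varepsilon(p_*(s))$ clears a denominator $s$ from a class over $\mathcal
S^{-1}M$ (`Eff.exists_mul_eq_map_toLoc`). It also turns an identity in $M(A)$ that holds up to the
factor $s$ into an equality of classes (`Eff.exists_mul_eq_of_map_toLoc_eq`).

Injectivity: if classes $a,b$ over $M$ agree in the Grothendieck ring over $\mathcal S^{-1}M$, then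
$c+a=c+b$ there for some class $c$ over $\mathcal S^{-1}M$. Clear the denominators of $c$ with
$t\in\mathcal S(X)$, then descend the resulting equality to $M$ with $v\in\mathcal S(X)$. The
outcome is $\varepsilon(vt)a=\varepsilon(vt)b$ in $\Omega[M](X)$.

Surjectivity: $[p,m/s]=p_+\varepsilon(m/s)$, the element $\varepsilon(m/s)$ is the image of
$\varepsilon(m)/\varepsilon(s)$, and $\Phi$ commutes with $p_+$. Differences are reached because the
source has additive inverses. -/

/-! ### Auxiliary identities for Grothendieck rings and fractions. -/

/-- Every element is a difference of classes and all maps are additive, so a square of Grothendieck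
rings commutes once the square of semirings does. -/
theorem GrothRing.mapRing_mapRing_eq {R R₁ R₂ R₃ : Type v} [CommSemiring R] [CommSemiring R₁]
    [CommSemiring R₂] [CommSemiring R₃] {φ : R →+* R₁} {ψ : R₁ →+* R₃} {φ' : R →+* R₂}
    {ψ' : R₂ →+* R₃} (h : ∀ a, ψ (φ a) = ψ' (φ' a)) (z : GrothRing R) :
    mapRing ψ (mapRing φ z) = mapRing ψ' (mapRing φ' z) := by
  obtain ⟨a, b, rfl⟩ := exists_sub z
  simp only [map_sub, mapRing_of, h]

/-- An identity that holds in `A` after cross-multiplication needs no further factor from `S`, so 1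
serves as the equalizing element. This is enough for cancellations such as $(m/s)(s/1)=m/1$. -/
theorem SemiMackey.frac_mk_mul_mk_eq {A : Type v} [CommMonoid A] {S : Submonoid A} {a b c : A}
    {s t r : S} (h : r * (a * b) = s * t * c) :
    (Localization.mk a s * Localization.mk b t : Localization S) = Localization.mk c r := by
  rw [Localization.mk_mul]
  exact frac_mk_eq_iff.2 ⟨1, one_mem _, congrArg _ h⟩

/-! ### The universal property of fractions of semi-Tambara functors. -/

namespace SemiTambara

variable {G : Type u} [Group G]

section LocLift

variable {T U : SemiTambara.{u, v} G} (φ : Hom T U) (S : T.mul.Sub)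
  (h : ∀ X, ∀ s ∈ S.carrier X, IsUnit (φ.app X s))

/-- The extension to `(S⁻¹T)(X)` of a morphism sending `S` to units. -/
noncomputable def locLiftApp (X : FinGSet G) : Localization (S.carrier X) →+* U.obj X :=
  IsLocalization.lift (M := S.carrier X) (g := φ.app X) fun s => h X s s.2

variable {X Y : FinGSet G}

/-- The defining property of the extension in product form,
$\tilde\varphi(x/s)\,\varphi(s)=\varphi(x)$. This avoids naming the inverse of $\varphi(s)$, which
is only known to exist. -/
theorem locLiftApp_mk_mul (x : T.obj X) (s : S.carrier X) :
    locLiftApp φ S h X (Localization.mk x s) * φ.app X s.1 = φ.app X x := by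
  -- The specification characterizes an arbitrary candidate for the value at $x/s$. With the lift
  -- itself as candidate, the condition on it is reflexivity, and what remains is
  -- $\varphi(x)=\varphi(s)\,\tilde\varphi(x/s)$.
  have := (IsLocalization.lift_mk'_spec (M := S.carrier X) (S := Localization (S.carrier X))
    (g := φ.app X) (fun s : S.carrier X => h X s s.2) x
    (locLiftApp φ S h X (Localization.mk x s)) s).1 (by rw [← Localization.mk_eq_mk']; rfl)
  rw [this, mul_comm]

/-- The unit $\varphi(s)$ can be cancelled, so the product form determines the value. Each
compatibility of the extension with a structure map thereby becomes an identity without fractions in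
`U`. -/
theorem locLiftApp_mk_eq {x : T.obj X} {s : S.carrier X} {z : U.obj X}
    (hz : z * φ.app X s.1 = φ.app X x) : locLiftApp φ S h X (Localization.mk x s) = z :=
  (h X s.1 s.2).mul_right_cancel ((locLiftApp_mk_mul φ S h x s).trans hz.symm)

/-- A morphism `T → U` sending `S` to units extends to a morphism `S⁻¹T → U`. -/
noncomputable def locLift : Hom (T.loc S) U where
  app X := locLiftApp φ S h X
  app_res f t := by
    induction t using Localization.induction_on with | H t => ?_
    obtain ⟨y, t⟩ := t
    refine (congrArg _ (T.locRes_mk S f y t)).trans (locLiftApp_mk_eq φ S h ?_)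
    -- The required identity is $f^*$ applied to $\tilde\varphi(y/t)\,\varphi(t)=\varphi(y)$.
    rw [φ.app_res, φ.app_res, ← map_mul]
    exact congrArg _ (locLiftApp_mk_mul φ S h y t)
  app_tr {X Y} f t := by
    induction t using Localization.induction_on with | H t => ?_
    obtain ⟨x, s⟩ := t
    -- Here $t=f_\bullet(s)$ and $f^*(t)=as$, so that $f_+(x/s)=f_+(ax)/t$. Only the relation
    -- $f^*(t)=as$ is used.
    obtain ⟨a, t, ht, -⟩ := T.exists_denom S f s
    refine (congrArg _ (T.locTr_mk S f x ht)).trans (locLiftApp_mk_eq φ S h ?_)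
    -- By the projection formula in `U`,
    -- $f_+(\tilde\varphi(x/s))\,\varphi(t)=f_+(\tilde\varphi(x/s)\cdot f^*\varphi(t))$, and
    -- $f^*\varphi(t)=\varphi(f^*(t))=\varphi(as)$. It then suffices to compare the arguments of
    -- $f_+$: the factor $\varphi(s)$ cancels the denominator and leaves $\varphi(a)\varphi(x)$.
    rw [← U.tr_mul_res, ← φ.app_res, ht, φ.app_tr]
    refine congrArg (U.tr f) ?_
    rw [map_mul, map_mul, mul_left_comm]
    exact congrArg _ (locLiftApp_mk_mul φ S h x s)
  app_nm f t := by
    induction t using Localization.induction_on with | H t => ?_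
    obtain ⟨x, s⟩ := t
    refine (congrArg _ (T.locNm_mk S f x s)).trans (locLiftApp_mk_eq φ S h ?_)
    -- As for restriction, this is the multiplicative map $f_\bullet$ applied to
    -- $\tilde\varphi(x/s)\,\varphi(s)=\varphi(x)$.
    rw [φ.app_nm, φ.app_nm, ← map_mul]
    exact congrArg _ (locLiftApp_mk_mul φ S h x s)

/-- The existence half of the universal property, inherited from localization of semirings at each
finite $G$-set. Composition is written in diagrammatic order. -/
theorem toLoc_comp_locLift : (T.toLoc S).comp (locLift φ S h) = φ := by
  refine Hom.ext (funext fun X => RingHom.ext fun x => ?_)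
  exact IsLocalization.lift_eq (R := T.obj X) (S := Localization (S.carrier X))
    (M := S.carrier X) (fun s : S.carrier X => h X s s.2) x

/-- Morphisms out of `S⁻¹T` are determined by their restriction to `T`. -/
theorem loc_hom_ext {φ ψ : Hom (T.loc S) U} (e : (T.toLoc S).comp φ = (T.toLoc S).comp ψ) :
    φ = ψ := by
  -- The compatibilities with restrictions and transfers are properties rather than data, so a
  -- morphism is its family of ring homomorphisms, and uniqueness is that of localization of
  -- semirings at each `X`.
  refine Hom.ext (funext fun X => ?_)
  exact IsLocalization.ringHom_ext (R := T.obj X) (S := Localization (S.carrier X))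
    (S.carrier X) (congrFun (congrArg Hom.app e) X)

/-- Both composites send $x$ to $\varphi(x)/1$. By `loc_hom_ext` this property characterizes the
induced morphism of fractions. -/
theorem toLoc_comp_loc (S' : U.mul.Sub) (hφ : ∀ X, ∀ s ∈ S.carrier X, φ.app X s ∈ S'.carrier X) :
    (T.toLoc S).comp (φ.loc S S' hφ) = φ.comp (U.toLoc S') := by
  refine Hom.ext (funext fun X => RingHom.ext fun x => ?_)
  change SemiMackey.fracRingMap (φ.app X) (hφ X)
      (algebraMap (T.obj X) (Localization (S.carrier X)) x) =
    algebraMap (U.obj X) (Localization (S'.carrier X)) (φ.app X x)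
  rw [← Localization.mk_one_eq_algebraMap, ← Localization.mk_one_eq_algebraMap,
    SemiMackey.fracRingMap_mk]
  -- The two sides have the same numerator; their denominators are $\varphi(1)$ and 1.
  exact congrArg _ (Subtype.ext (map_one (φ.app X)))

end LocLift

/-! ### Pointwise bijective morphisms are isomorphisms. -/

/-- The inverse of a morphism that is bijective at every finite `G`-set. -/
noncomputable def Hom.inverse {T : SemiTambara.{u, v} G} {U : SemiTambara.{u, w} G} (φ : Hom T U)
    (h : ∀ X, Function.Bijective (φ.app X)) : Hom U T where
  app X := (RingEquiv.ofBijective (φ.app X) (h X)).symm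
  app_res {X Y} f t := by
    -- With the argument written as $\varphi(t)$, compatibility of $\varphi$ with the structure map
    -- moves that map inside $\varphi$. The inverse then undoes $\varphi$ on both sides. The two
    -- transfers are treated in the same way.
    obtain ⟨t, rfl⟩ := (h Y).2 t
    rw [← φ.app_res]
    exact (RingEquiv.symm_apply_apply _ _).trans
      (congrArg _ (RingEquiv.symm_apply_apply (RingEquiv.ofBijective _ (h Y)) t).symm)
  app_tr {X Y} f t := by
    obtain ⟨t, rfl⟩ := (h X).2 t
    rw [← φ.app_tr]
    exact (RingEquiv.symm_apply_apply _ _).trans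
      (congrArg _ (RingEquiv.symm_apply_apply (RingEquiv.ofBijective _ (h X)) t).symm)
  app_nm {X Y} f t := by
    obtain ⟨t, rfl⟩ := (h X).2 t
    rw [← φ.app_nm]
    exact (RingEquiv.symm_apply_apply _ _).trans
      (congrArg _ (RingEquiv.symm_apply_apply (RingEquiv.ofBijective _ (h X)) t).symm)

end SemiTambara

/-- A morphism of Tambara functors that is bijective at every finite `G`-set is an isomorphism. -/
noncomputable def Tambara.isoOfBijective {G : Type u} [Group G] {T U : Tambara.{u, v} G}
    (φ : Quiver.Hom T U) (h : ∀ X, Function.Bijective (SemiTambara.Hom.app φ X)) :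
    CategoryTheory.Iso T U where
  hom := φ
  inv := SemiTambara.Hom.inverse φ h
  hom_inv_id := SemiTambara.Hom.ext (funext fun X => RingHom.ext fun x =>
    RingEquiv.symm_apply_apply (RingEquiv.ofBijective _ (h X)) x)
  inv_hom_id := SemiTambara.Hom.ext (funext fun X => RingHom.ext fun x =>
    RingEquiv.apply_symm_apply (RingEquiv.ofBijective _ (h X)) x)

/-! ### The comparison morphism. -/

namespace SemiMackey

variable {G : Type u} [Group G] {M : SemiMackey.{u, v} G} (S : M.Sub) {X A : FinGSet.{u} G}

/-- The fibre product of $\mathrm{id}_X$ and $p$ is $A$ itself, so $\varepsilon(k)$ acts on a class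
without changing its underlying $G$-set, through multiplication by $p^*(k)$. This is how an element
of $\mathcal S(X)$ influences elements of $M(A)$. -/
theorem Eff.mk_id_mul_mk (k : M.obj X) (p : A →[G] X) (m : M.obj A) :
    (mk (MulActionHom.id G) k * mk p m : Eff M X) = mk p (M.res p k * m) := by
  rw [mk_mul_mk (isPullback_id_left p), M.res_id]
  rfl

theorem toLoc_app (m : M.obj X) :
    (M.toLoc S).app X m = (Localization.mk m 1 : Localization (S.carrier X)) :=
  (Localization.mk_one_eq_monoidOf_mk m).symm

theorem isUnit_toLoc {s : M.obj X} (hs : s ∈ S.carrier X) : IsUnit ((M.toLoc S).app X s) :=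
  (Localization.monoidOf (S.carrier X)).map_units ⟨s, hs⟩

/-- The elements in question are $\varepsilon(m)$ with $m\in\mathcal S(X)$. By naturality of
$\varepsilon$ they go to $\varepsilon(m/1)$, and the monoid homomorphism $\varepsilon$ preserves
units. This is the hypothesis under which the comparison morphism exists. -/
theorem isUnit_tambarizationMap_toLoc (X : FinGSet.{u} G) (s : M.tambarization.mul.obj X)
    (hs : s ∈ (S.map M.unit).carrier X) : IsUnit ((tambarizationMap (M.toLoc S)).app X s) := by
  obtain ⟨m, hm, rfl⟩ := hs
  rw [tambarizationMap_unit]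
  exact (isUnit_toLoc S hm).map ((M.loc S).unit.app X)

/-- The comparison morphism `S⁻¹(Ω[M]) → Ω[S⁻¹M]`. -/
noncomputable def tambarizationLocHom (S : M.Sub) :
    Quiver.Hom (M.tambarization.loc (S.map M.unit)) (M.loc S).tambarization :=
  SemiTambara.locLift (tambarizationMap (M.toLoc S)) (S.map M.unit)
    (isUnit_tambarizationMap_toLoc S)

/-! ### Clearing denominators over $X$. -/

/-- Classes of `M-Gset/X` that become equal over `S⁻¹M` are equalized by an element of `S(X)`. -/
theorem Eff.exists_mul_eq_of_map_toLoc_eq {a b : Eff M X}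
    (h : Eff.map (M.toLoc S) a = Eff.map (M.toLoc S) b) :
    ∃ v ∈ S.carrier X, mk (MulActionHom.id G) v * a = mk (MulActionHom.id G) v * b := by
  induction a using Eff.ind with | h A p m => ?_
  induction b using Eff.ind with | h B q n => ?_
  -- Localizing changes only the element, not the $G$-set over $X$. Hence the isomorphism `e` over
  -- $\mathcal S^{-1}M$ is already an isomorphism $A\cong B$ over $X$, and the only defect is that
  -- $e^*(n)$ and $m$ agree merely after localization.
  obtain ⟨e, he, hp, hm⟩ := Quotient.exact (s := objSetoid (M.loc S) X) h
  change A →[G] B at e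
  change ∀ x, q (e x) = p x at hp
  have hm : (M.toLoc S).app A (M.res e n) = (M.toLoc S).app A m :=
    ((M.toLoc S).app_res e n).trans hm
  rw [toLoc_app, toLoc_app] at hm
  -- The equalizing factor `c` lies in $\mathcal S(A)$, whereas the multiplier sought lies in
  -- $\mathcal S(X)$.
  obtain ⟨c, hc, hm⟩ := frac_mk_eq_iff.1 hm
  have hm : c * (1 * M.res e n) = c * (1 * m) := hm
  rw [one_mul, one_mul] at hm
  -- The transfer $p_*(c)\in\mathcal S(X)$ restricts to the multiple $wc$ of $c$ on $A$, so it still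
  -- equalizes $e^*(n)$ and $m$.
  obtain ⟨w, hw⟩ := M.exists_res_tr p c
  refine ⟨M.tr p c, S.tr_mem p c hc, ?_⟩
  rw [mk_id_mul_mk, mk_id_mul_mk]
  refine mk_eq e he hp ?_
  -- Since $qe=p$, pulling $q^*p_*(c)\cdot n$ back along `e` gives $p^*p_*(c)\cdot
  -- e^*(n)=wc\,e^*(n)$, which equals $wc\,m$.
  have k : q.comp e = p := by ext x; exact hp x
  rw [map_mul, ← M.res_comp, k, hw, mul_assoc, hm, mul_assoc]

/-- Classes over `S⁻¹M` can be cleared of denominators by an element of `S(X)`. -/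
theorem Eff.exists_mul_eq_map_toLoc (c : Eff (M.loc S) X) :
    ∃ t ∈ S.carrier X, ∃ d : Eff M X,
      mk (MulActionHom.id G) ((M.toLoc S).app X t) * c = Eff.map (M.toLoc S) d := by
  induction c using Eff.ind with | h A p m => ?_
  induction m using Localization.induction_on with | H m => ?_
  obtain ⟨m, s⟩ := m
  -- With $p^*p_*(s)=ws$, multiplication by $p_*(s)$ turns $[p,m/s]$ into
  -- $[p,(ws/1)(m/s)]=[p,wm/1]$. This explains the choice of $[p,wm]$ below.
  obtain ⟨w, hw⟩ := M.exists_res_tr p s.1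
  refine ⟨M.tr p s.1, S.tr_mem p s.1 s.2, mk p (w * m), ?_⟩
  refine (mk_id_mul_mk (M := M.loc S) _ p _).trans ((congrArg (mk p) ?_).trans (map_mk _ _ _).symm)
  rw [← (M.toLoc S).app_res, hw, toLoc_app, toLoc_app]
  exact frac_mk_mul_mk_eq (by simp [mul_comm, mul_left_comm])

/-- Elements of `Ω[M](X)` that become equal in `Ω[S⁻¹M](X)` are equalized by an element of
`S(X)`. -/
theorem exists_mul_eq_of_mapRing_toLoc_eq {x y : GrothRing (Eff M X)}
    (h : GrothRing.mapRing (Eff.mapHom (M.toLoc S)) x =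
      GrothRing.mapRing (Eff.mapHom (M.toLoc S)) y) :
    ∃ v ∈ S.carrier X, GrothRing.of (Eff.mk (MulActionHom.id G) v) * x =
      GrothRing.of (Eff.mk (MulActionHom.id G) v) * y := by
  rw [← sub_eq_zero, ← map_sub] at h
  -- The claim depends only on $x-y$, whose image vanishes. Writing this difference as $a-b$ reduces
  -- the claim to two effective classes.
  simp only [← sub_eq_zero (b := _ * y), ← mul_sub]
  generalize x - y = x at h
  obtain ⟨a, b, rfl⟩ := GrothRing.exists_sub x
  have h : (GrothRing.of (Eff.map (M.toLoc S) a) : GrothRing (Eff (M.loc S) X)) =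
      GrothRing.of (Eff.map (M.toLoc S) b) := by
    rw [map_sub, GrothRing.mapRing_of, GrothRing.mapRing_of] at h
    exact sub_eq_zero.1 h
  -- Equality in the Grothendieck ring provides only a cancelling summand `c`. This is a class over
  -- $\mathcal S^{-1}M$ and need not come from `M`, so its denominators are cleared first:
  -- $\varepsilon(t/1)\,c$ is the image of `d`.
  obtain ⟨c, hc⟩ := GrothRing.of_eq_of.1 h
  obtain ⟨t, ht, d, hd⟩ := Eff.exists_mul_eq_map_toLoc S c
  -- After multiplication by $\varepsilon(t/1)$ the whole sum $c+a$ is the image of the class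
  -- $d+\varepsilon(t)a$ over `M`, and likewise for $b$. The equality $c+a=c+b$ can then be
  -- descended.
  have key : ∀ a : Eff M X, Eff.mk (MulActionHom.id G) ((M.toLoc S).app X t) *
      (c + Eff.map (M.toLoc S) a) =
      Eff.map (M.toLoc S) (d + Eff.mk (MulActionHom.id G) t * a) := fun a => by
    rw [mul_add, hd]
    exact ((map_add (Eff.mapHom (M.toLoc S)) d _).trans
      (congrArg _ (map_mul (Eff.mapHom (M.toLoc S)) (Eff.mk (MulActionHom.id G) t) a))).symm
  obtain ⟨v, hv, e⟩ := Eff.exists_mul_eq_of_map_toLoc_eq S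
    ((key a).symm.trans ((congrArg _ hc).trans (key b)))
  -- Here `t` cleared the denominators of `c` and `v` descends the equality to `M`.
  refine ⟨v * t, mul_mem hv ht, ?_⟩
  -- This gives $\varepsilon(v)d+\varepsilon(vt)a=\varepsilon(v)d+\varepsilon(vt)b$ in the semiring
  -- over `M`. The common summand $\varepsilon(v)d$ disappears in the Grothendieck ring.
  rw [mul_add, mul_add, ← mul_assoc, ← mul_assoc, ← Eff.mk_id_mul] at e
  rw [mul_sub, ← GrothRing.of_mul, ← GrothRing.of_mul, GrothRing.of_eq_of.2 ⟨_, e⟩, sub_self]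

/-! ### Bijectivity of the comparison morphism. -/

/-- If $x/s$ and $y/t$ have the same image, then $tx$ and $sy$ have the same image in
$\Omega[\mathcal S^{-1}M](X)$. They are therefore equalized by some $\varepsilon(v)$ with
$v\in\mathcal S(X)$, which is exactly what equality of the two fractions asks for. -/
theorem tambarizationLocHom_injective (X : FinGSet.{u} G) :
    Function.Injective ((tambarizationLocHom S).app X) := by
  intro z w e
  induction z using Localization.induction_on with | H z => ?_
  induction w using Localization.induction_on with | H w => ?_
  obtain ⟨x, s⟩ := z
  obtain ⟨y, t⟩ := w
  have hx := SemiTambara.locLiftApp_mk_mul (tambarizationMap (M.toLoc S)) (S.map M.unit)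
    (isUnit_tambarizationMap_toLoc S) x s
  have hy := SemiTambara.locLiftApp_mk_mul (tambarizationMap (M.toLoc S)) (S.map M.unit)
    (isUnit_tambarizationMap_toLoc S) y t
  have e : SemiTambara.locLiftApp (tambarizationMap (M.toLoc S)) (S.map M.unit)
      (isUnit_tambarizationMap_toLoc S) X (Localization.mk x s) =
    SemiTambara.locLiftApp (tambarizationMap (M.toLoc S)) (S.map M.unit)
      (isUnit_tambarizationMap_toLoc S) X (Localization.mk y t) := e
  rw [e] at hx
  -- Let $z$ be the common image of the two fractions. Then $x\mapsto z\cdot\Omega[\ell](s)$ and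
  -- $y\mapsto z\cdot\Omega[\ell](t)$, so $tx$ and $sy$ have the same image.
  have key : (tambarizationMap (M.toLoc S)).app X (t.1 * x) =
      (tambarizationMap (M.toLoc S)).app X (s.1 * y) := by
    rw [map_mul ((tambarizationMap (M.toLoc S)).app X),
      map_mul ((tambarizationMap (M.toLoc S)).app X), ← hx, ← hy]
    ring
  obtain ⟨v, hv, h⟩ := exists_mul_eq_of_mapRing_toLoc_eq S key
  exact frac_mk_eq_iff.2 ⟨M.unit.app X v, ⟨v, hv, rfl⟩, h⟩

/-- Every effective class is an additive transfer of a class with identity structure map, and for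
such a class a preimage is a single fraction. No denominator has to be found on $X$: the additive
transfer of the fraction functor already takes care of it. -/
theorem tambarizationLocHom_surjective (X : FinGSet.{u} G) :
    Function.Surjective ((tambarizationLocHom S).app X) := by
  have key : ∀ c : Eff (M.loc S) X, ∃ z, (tambarizationLocHom S).app X z = GrothRing.of c := by
    intro c
    induction c using Eff.ind with | h A p m => ?_
    induction m using Localization.induction_on with | H m => ?_
    obtain ⟨m, s⟩ := m
    -- The preimage of $[p,m/s]=p_+\varepsilon(m/s)$ is $p_+(\varepsilon(m)/\varepsilon(s))$, with
    -- the fraction formed over $A$ and not over $X$.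
    refine ⟨((M.tambarization.loc (S.map M.unit)).tr p) (Localization.mk (M.unit.app A m)
      ⟨M.unit.app A s.1, s.1, s.2, rfl⟩), ?_⟩
    refine ((tambarizationLocHom S).app_tr p _).trans ?_
    have e : (tambarizationLocHom S).app A (Localization.mk (M.unit.app A m)
        ⟨M.unit.app A s.1, s.1, s.2, rfl⟩) = (M.loc S).unit.app A (Localization.mk m s) := by
      -- The value is identified by the relation
      -- $\varepsilon(m/s)\,\varepsilon(s/1)=\varepsilon(m/1)$.
      refine SemiTambara.locLiftApp_mk_eq _ _ (isUnit_tambarizationMap_toLoc S) ?_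
      rw [tambarizationMap_unit, tambarizationMap_unit, toLoc_app, toLoc_app]
      refine (map_mul ((M.loc S).unit.app A) _ _).symm.trans (congrArg _ ?_)
      exact frac_mk_mul_mk_eq (by simp [mul_comm])
    rw [e]
    -- The additive transfer composes structure maps, and $p\circ\mathrm{id}_A$ is $p$ by
    -- definition.
    exact GrothRing.mapAdd_of _ _
  intro y
  obtain ⟨a, b, rfl⟩ := GrothRing.exists_sub (R := Eff (M.loc S) X) y
  obtain ⟨z, hz⟩ := key a
  obtain ⟨w, hw⟩ := key b
  -- For the target element $a-b$, with `z` over $a$ and `w` over $b$, an additive inverse of `w` in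
  -- the source maps to $-b$. Hence $z+w'$ is a preimage.
  obtain ⟨w', hw'⟩ := (M.tambarization.loc (S.map M.unit)).exists_neg X w
  have h : (tambarizationLocHom S).app X w + (tambarizationLocHom S).app X w' = 0 := by
    rw [← map_add ((tambarizationLocHom S).app X), hw', map_zero]
  rw [hw] at h
  refine ⟨z + w', (map_add ((tambarizationLocHom S).app X) z w').trans ?_⟩
  rw [hz]
  -- The values of a Tambara functor carry only a semiring structure as data, so subtraction and
  -- negation are taken in the Grothendieck ring, which has to be named explicitly.
  refine Eq.trans (congrArg _ ?_) (sub_eq_add_neg (G := GrothRing (Eff (M.loc S) X)) _ _).symm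
  exact eq_neg_of_add_eq_zero_right (α := GrothRing (Eff (M.loc S) X)) h

/-! ### Compatibility with the canonical morphisms and naturality. -/

/-- This is $\Omega$ applied to the commutative square formed by $\theta$, the induced morphism of
fractions and the two canonical morphisms. On an effective class $[p,m]$ both composites give
$[p,\theta(m)/1]$. -/
theorem tambarizationMap_comp_toLoc {N : SemiMackey.{u, v} G} (θ : Hom M N) (S : M.Sub)
    (S' : N.Sub) (h : ∀ X, ∀ s ∈ S.carrier X, θ.app X s ∈ S'.carrier X) :
    (tambarizationMap θ).comp (tambarizationMap (N.toLoc S')) =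
      (tambarizationMap (M.toLoc S)).comp (tambarizationMap (θ.loc S S' h)) := by
  refine SemiTambara.Hom.ext (funext fun X => RingHom.ext fun x => ?_)
  refine GrothRing.mapRing_mapRing_eq (φ := Eff.mapHom θ) (ψ := Eff.mapHom (N.toLoc S'))
    (φ' := Eff.mapHom (M.toLoc S)) (ψ' := Eff.mapHom (Hom.loc θ S S' h)) (fun a => ?_) x
  induction a using Eff.ind with | h A p m => ?_
  refine congrArg (fun n : (N.loc S').obj A => Eff.mk p n) ?_
  refine (toLoc_app S' _).trans (Eq.trans ?_ (congrArg _ (toLoc_app S m)).symm)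
  -- The induced morphism sends $m/1$ to $\theta(m)/\theta(1)$, and $\theta(1)=1$.
  exact (congrArg _ (Subtype.ext (map_one (θ.app A)).symm)).trans (fracMap_mk (θ.app A) (h A) m 1).symm

theorem toLoc_comp_tambarizationLocHom (S : M.Sub) :
    SemiTambara.Hom.comp (M.tambarization.toLoc (S.map M.unit)) (tambarizationLocHom S) =
      tambarizationMap (M.toLoc S) :=
  SemiTambara.toLoc_comp_locLift _ _ _

/-- Both composites start at a fraction of $\Omega[M]$, so by uniqueness of extensions they need
only be compared on $\Omega[M]$. There each comparison morphism reduces to $\Omega$ of a canonical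
morphism, leaving the square of `tambarizationMap_comp_toLoc`. -/
theorem tambarizationLocHom_natural {N : SemiMackey.{u, v} G} (θ : Hom M N) (S : M.Sub)
    (S' : N.Sub) (h : ∀ X, ∀ s ∈ S.carrier X, θ.app X s ∈ S'.carrier X) :
    SemiTambara.Hom.comp (Tambara.locMap (tambarizationMap θ) (S.map M.unit) (S'.map N.unit)
        (tambarizationMap_mem θ S S' h)) (tambarizationLocHom S') =
      SemiTambara.Hom.comp (tambarizationLocHom S) (tambarizationMap (θ.loc S S' h)) := by
  refine SemiTambara.loc_hom_ext (T := M.tambarization.toSemiTambara)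
    (U := (N.loc S').tambarization.toSemiTambara) (S.map M.unit) ?_
  have e₁ := congrArg (fun ψ => SemiTambara.Hom.comp ψ (tambarizationMap (θ.loc S S' h)))
    (toLoc_comp_tambarizationLocHom S)
  have e₂ := congrArg (SemiTambara.Hom.comp (tambarizationMap θ))
    (toLoc_comp_tambarizationLocHom S')
  have e₃ := congrArg (fun ψ => SemiTambara.Hom.comp ψ (tambarizationLocHom S'))
    (SemiTambara.toLoc_comp_loc (tambarizationMap θ) (S.map M.unit) (S'.map N.unit)
      (tambarizationMap_mem θ S S' h))
  -- On $\Omega[M]$: `e₃` moves $\theta$ in front of the canonical morphism for $N$, and `e₂`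
  -- absorbs the comparison morphism for $N$. The square is then crossed, and `e₁`, reversed, brings
  -- back the comparison morphism for $M$. Composition is associative by definition, so the
  -- bracketings match without rewriting.
  exact e₃.trans (e₂.trans ((tambarizationMap_comp_toLoc θ S S' h).trans e₁.symm))

end SemiMackey

theorem mainTheorem7 {G : Type u} [Group G] [Finite G] :
    ∃ Φ : ∀ (M : SemiMackey.{u, v} G) (S : M.Sub),
        CategoryTheory.Iso (M.tambarization.loc (S.map M.unit)) (M.loc S).tambarization,
      (∀ (M : SemiMackey.{u, v} G) (S : M.Sub),
        CategoryTheory.CategoryStruct.comp (M.tambarization.toLoc (S.map M.unit)) (Φ M S).hom =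
          SemiMackey.tambarizationMap (M.toLoc S)) ∧
      ∀ (M N : SemiMackey.{u, v} G) (θ : SemiMackey.Hom M N) (S : M.Sub) (S' : N.Sub)
        (h : ∀ X, ∀ s ∈ S.carrier X, θ.app X s ∈ S'.carrier X),
        CategoryTheory.CategoryStruct.comp
            (Tambara.locMap (SemiMackey.tambarizationMap θ) (S.map M.unit) (S'.map N.unit)
              (SemiMackey.tambarizationMap_mem θ S S' h))
            (Φ N S').hom =
          CategoryTheory.CategoryStruct.comp (Φ M S).hom
            (SemiMackey.tambarizationMap (SemiMackey.Hom.loc θ S S' h)) := by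
  -- The forward map of this isomorphism is the comparison morphism by definition, and categorical
  -- composition unfolds to composition of morphisms of semi-Tambara functors. Both compatibilities
  -- therefore apply as they stand.
  exact ⟨fun M S => Tambara.isoOfBijective (SemiMackey.tambarizationLocHom S) fun X =>
    ⟨SemiMackey.tambarizationLocHom_injective S X, SemiMackey.tambarizationLocHom_surjective S X⟩,
    fun M S => SemiMackey.toLoc_comp_tambarizationLocHom S,
    fun M N θ S S' h => SemiMackey.tambarizationLocHom_natural θ S S' h⟩
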